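/- Let $\bar M$ be a smooth (Hausdorff, second countable) Riemannian manifold of dimension $d\ge 1$ with smooth non-empty boundary $\partial M$ and interior $M=\bar M\setminus\partial M$. Let $\Lambda$ and $\Lambda_\partial$ be the Riemannian volume measures of $\bar M$ and of $\partial M$ (with the induced metric), $\nabla$ and $\nabla^\partial$ the corresponding gradients, $\Delta$ the Laplace–Beltrami operator of $M$, and $N$ the unit inward normal field on $\partial M$. Let $V\in C^1(M)$ be continuous up to $\partial M$, and $W\in C^1(\partial M)$, with $$Z_V:=\int_{M} e^V\,d\Lambda<\infty,\qquad Z_W^\partial:=\int_{\partial M}e^W\,d\Lambda_\partial<\infty ,$$ and put $\mu_V:=Z_V^{-1}e^V\Lambda$, $\mu_W^\partial:=(Z_W^\partial)^{-1}e^W\Lambda_\partial$. Let $\gamma>0$, $\delta>0$, $$\theta:=\frac{\gamma Z_W^\partial}{\gamma Z_W^\partial+Z_V}\in(0,1),\qquad \mu:=\theta\mu_V+(1-\theta)\mu_W^\partial ,$$ $$\mathscr E_\delta(f,f):=\theta\,\mu_V(|\nabla f|^2)+(1-\theta)\,\delta\,\mu_W^\partial(|\nabla^\partial f|_\partial^2).$$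 (This is the Dirichlet form of the sticky-reflected diffusion on $\bar M$ generated by $1_M(\Delta+\nabla V)+1_{\partial M}\big(\delta(\Delta^\partial+\nabla^\partial W)+\gamma e^{V-W}N\big)$.) Let $C_b^1$ denote the class of bounded $C^1$ functions with bounded gradient and $C_0^2(\bar M)$ the class of $C^2$ functions on $\bar M$ with compact support. For $r>0$ let $$\beta(r):=\sup\{\mu(f^2)-r\mathscr E_\delta(f,f):\ f\in C_b^1(\bar M),\ \mu(|f|)=1\},$$ $$\alpha(r):=\sup\{(\mu(f^2)-r\|f\|_\infty^2)^+:\ f\in C_b^1(\bar M),\ \mu(f)=0,\ \mathscr E_\delta(f,f)=1\}.$$ Let $\beta_V,\beta_W^\partial,\alpha_V,\alpha_W^\partial:(0,\infty)\to[0,\infty]$ denote arbitrary functions such that, for all $r>0$ at which the respective function is finite, $$\mu_V(f^2)\le r\mu_V(|\nabla f|^2)+\beta_V(r)\mu_V(|f|)^2,\quad f\in C_b^1(\bar M),$$ $$\mu_W^\partial(f^2)\le r\mu_W^\partial(|\nabla^\partial f|_\partial^2)+\beta_W^\partial(r)\mu_W^\partial(|f|)^2,\quad f\in C_b^1(\partial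 M),$$ $$\mu_V(f^2)\le \alpha_V(r)\mu_V(|\nabla f|^2)+r\|f\|_\infty^2,\quad f\in C_b^1(\bar M),\ \mu_V(f)=0,$$ $$\mu_W^\partial(f^2)\le \alpha_W^\partial(r)\mu_W^\partial(|\nabla^\partial f|_\partial^2)+r\|f\|_\infty^2,\quad f\in C_b^1(\partial M),\ \mu_W^\partial(f)=0 .$$ **(1)** For all such $\beta_V,\beta_W^\partial$, $$\beta(r)\le\max\Big\{\frac{\beta_V(r)}{\theta},\ \frac{\beta_W^\partial(\delta r)}{1-\theta}\Big\},\qquad r>0 .$$ **(2)** Suppose that the closure of $(\mathscr E_\delta,C_0^2(\bar M))$ in $L^2(\mu)$ is conservative, i.e. there are $\chi_k\in C_0^2(\bar M)$ with $\chi_k\to1$ in $L^2(\mu)$ and $\mathscr E_\delta(\chi_k,\chi_k)\to0$ (this holds whenever $\bar M$ is complete), and that **(A)** there is $h\in C^2(\bar M)$ with $Nh|_{\partial M}=1$, $\|\nabla h\|_{L^2(\mu)}<\infty$, $\|1_{\partial M}(W-V)^+\|_\infty<\infty$ and $\|(L_Vh)^-\|_{L^2(\mu_V)}<\infty$, where $L_V:=\Delta+\nabla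 V$ on $M$. Let $C_0:=Z_Ve^{\|1_{\partial M}(W-V)^+\|_\infty}/Z_W^\partial$, $C_1:=\|(L_Vh)^-\|_{L^2(\mu_V)}$ and $C_2:=\|\nabla h\|_{L^2(\mu_V)}$. Then for all such $\alpha_V,\alpha_W^\partial$ and all $r>0$, $$\alpha(r)\le\inf\Big\{\max\Big\{(1+C_0^2C_1^2)\alpha_V(s_1)+\tfrac{1-\theta}{\theta}C_0^2C_2^2,\ \tfrac1\delta\alpha_W^\partial(s_2)\Big\}:\ s_1,s_2>0,\ \theta(1+C_0^2C_1^2)s_1+(1-\theta)s_2\le\tfrac r4\Big\}.$$ In particular, with $s(r):=\dfrac{r}{4+4\theta C_0^2C_1^2}$, $$\alpha(r)\le\max\Big\{(1+C_0^2C_1^2)\alpha_V(s(r))+\tfrac{1-\theta}{\theta}C_0^2C_2^2,\ \tfrac1\delta\alpha_W^\partial(s(r))\Big\},\qquad r>0,$$ and there is a constant $c>1$, not depending on $\alpha_V$, $\alpha_W^\partial$ and $r$, such that $$\alpha(r)\le c+c\,\alpha_V(r/c)+c\,\alpha_W^\partial(r/c),\qquad r>0 ;$$ if $\alpha_V$ and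 $\alpha_W^\partial$ are non-increasing, then with the same $c$ the last right-hand side also bounds the preceding maximum. -/

import Mathlib

open Bundle Set MeasureTheory Filter Topology
open scoped Manifold ContDiff ENNReal

noncomputable section

namespace StickyReflected

/-! ### Riemannian geometry of a manifold with boundary

`M` stands for the whole manifold with boundary (often written with a bar), of dimension `n + 1`:
it is modelled on the half-space `{y : ℝⁿ⁺¹ | 0 ≤ y 0}`, its interior is
`(𝓡∂ (n + 1)).interior M` and its boundary is `(𝓡∂ (n + 1)).boundary M`. -/

section Geometry

variable (n : ℕ) {M : Type*} [TopologicalSpace M] [ChartedSpace (EuclideanHalfSpace (n + 1)) M]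

/-- The differential `d_p f : T_p M → ℝ` of a function on `M`. -/
def differential (f : M → ℝ) (p : M) : TangentSpace (𝓡∂ (n + 1)) p →L[ℝ] ℝ :=
  mfderiv (𝓡∂ (n + 1)) 𝓘(ℝ, ℝ) f p

/-- The differential at `p` of the zeroth coordinate of the chart at `p`. At a boundary point this
coordinate vanishes on the boundary and is positive inside, so the kernel of its differential is
the tangent space of the boundary, and it is positive on the inward vectors. -/
def boundaryCovector (p : M) : TangentSpace (𝓡∂ (n + 1)) p →L[ℝ] ℝ :=
  differential n (fun q : M => extChartAt (𝓡∂ (n + 1)) p q 0) p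

/-- The tangent space `T_p ∂M ⊆ T_p M` of the boundary at a boundary point `p`. -/
def boundaryTangent (p : M) : Submodule ℝ (TangentSpace (𝓡∂ (n + 1)) p) :=
  LinearMap.ker (boundaryCovector n p).toLinearMap

/-- The differential at `p ∈ ∂M`, on `T_p ∂M`, of a function on `∂M`; only the values of `f` on the
boundary matter. (The derivative within the boundary is determined in the directions tangent to
the boundary, and only these are retained.) -/
def boundaryDifferential (f : M → ℝ) (p : M) : boundaryTangent n p →L[ℝ] ℝ :=
  ContinuousLinearMap.comp
    (mfderivWithin (𝓡∂ (n + 1)) 𝓘(ℝ, ℝ) f ((𝓡∂ (n + 1)).boundary M) p :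
      TangentSpace (𝓡∂ (n + 1)) p →L[ℝ] ℝ)
    (boundaryTangent n p).subtypeL

/-- The coordinate vector field `∂ᵢ` of the chart at `x`, at the point with coordinates `y`. -/
def coordVector (x : M) (y : EuclideanSpace ℝ (Fin (n + 1))) (i : Fin (n + 1)) :
    TangentSpace (𝓡∂ (n + 1)) ((extChartAt (𝓡∂ (n + 1)) x).symm y) :=
  mfderivWithin 𝓘(ℝ, EuclideanSpace ℝ (Fin (n + 1))) (𝓡∂ (n + 1))
    (extChartAt (𝓡∂ (n + 1)) x).symm (range (𝓡∂ (n + 1))) y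
    (EuclideanSpace.single i (1 : ℝ) : EuclideanSpace ℝ (Fin (n + 1)))

/-- The inclusion `y ↦ (0, y)` of `ℝⁿ` into `ℝⁿ⁺¹` as the boundary of the half-space. -/
def hyperplane (y : EuclideanSpace ℝ (Fin n)) : EuclideanSpace ℝ (Fin (n + 1)) :=
  WithLp.toLp 2 (Fin.cons (0 : ℝ) (fun i => y i) : Fin (n + 1) → ℝ)

variable [RiemannianBundle (fun x : M => TangentSpace (𝓡∂ (n + 1)) x)]

instance (p : M) : FiniteDimensional ℝ (TangentSpace (𝓡∂ (n + 1)) p) :=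
  inferInstanceAs (FiniteDimensional ℝ (EuclideanSpace ℝ (Fin (n + 1))))

instance (p : M) : CompleteSpace (TangentSpace (𝓡∂ (n + 1)) p) :=
  FiniteDimensional.complete ℝ _

instance (p : M) : CompleteSpace (boundaryTangent n p) :=
  FiniteDimensional.complete ℝ _

/-- The gradient `∇f`. -/
def grad (f : M → ℝ) (p : M) : TangentSpace (𝓡∂ (n + 1)) p :=
  (InnerProductSpace.toDual ℝ (TangentSpace (𝓡∂ (n + 1)) p)).symm (differential n f p)

/-- The gradient on `∂M`, for the induced metric, of a function on `∂M`. -/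
def boundaryGrad (f : M → ℝ) (p : M) : boundaryTangent n p :=
  (InnerProductSpace.toDual ℝ (boundaryTangent n p)).symm (boundaryDifferential n f p)

/-- The unit inward normal `N` at a boundary point: the normalised gradient of the zeroth
coordinate. -/
def inwardNormal (p : M) : TangentSpace (𝓡∂ (n + 1)) p :=
  let ν := (InnerProductSpace.toDual ℝ (TangentSpace (𝓡∂ (n + 1)) p)).symm (boundaryCovector n p)
  ‖ν‖⁻¹ • ν

/-- The matrix `g_{ij}` of the metric in the chart at `x`, as a function of the coordinates. -/
def gram (x : M) (y : EuclideanSpace ℝ (Fin (n + 1))) : Matrix (Fin (n + 1)) (Fin (n + 1)) ℝ :=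
  Matrix.of fun i j => inner ℝ (coordVector n x y i) (coordVector n x y j)

/-- The Laplacian `(det g)^{-1/2} ∑ᵢ ∂ᵢ ((det g)^{1/2} ∑ⱼ g^{ij} ∂ⱼ h)` in the chart at `x`. -/
def chartLaplacian (x : M) (h : M → ℝ) (y : EuclideanSpace ℝ (Fin (n + 1))) : ℝ :=
  (Real.sqrt (gram n x y).det)⁻¹ *
    ∑ i, fderivWithin ℝ (fun z => Real.sqrt (gram n x z).det *
        ∑ j, (gram n x z)⁻¹ i j *
          fderivWithin ℝ (h ∘ (extChartAt (𝓡∂ (n + 1)) x).symm) (range (𝓡∂ (n + 1))) z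
            (EuclideanSpace.single j 1))
      (range (𝓡∂ (n + 1))) y (EuclideanSpace.single i 1)

/-- The Laplace–Beltrami operator `Δ` of `M`. -/
def laplacian (h : M → ℝ) (p : M) : ℝ :=
  chartLaplacian n p h (extChartAt (𝓡∂ (n + 1)) p p)

variable [MeasurableSpace M]

/-- The Riemannian volume `(det g)^{1/2} dy` on the domain of the chart at `x`. -/
def chartVolume (x : M) : Measure M :=
  Measure.map (extChartAt (𝓡∂ (n + 1)) x).symm
    ((volume.restrict (extChartAt (𝓡∂ (n + 1)) x).target).withDensity
      fun y => ENNReal.ofReal (Real.sqrt (gram n x y).det))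

/-- The Riemannian volume of the induced metric on the part of `∂M` in the chart at `x`. -/
def boundaryChartVolume (x : M) : Measure M :=
  Measure.map (fun y => (extChartAt (𝓡∂ (n + 1)) x).symm (hyperplane n y))
    ((volume.restrict (hyperplane n ⁻¹' (extChartAt (𝓡∂ (n + 1)) x).target)).withDensity
      fun y => ENNReal.ofReal
        (Real.sqrt ((gram n x (hyperplane n y)).submatrix Fin.succ Fin.succ).det))

variable (M) in
/-- The Riemannian volume measure `Λ` of `M`: the least measure that dominates the volume of each
chart domain. Since these agree on overlaps, it restricts to each of them. -/
def volumeMeasure : Measure M := ⨆ x : M, chartVolume n x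

variable (M) in
/-- The Riemannian volume measure `Λ_∂` of `∂M`, as a measure on `M` carried by `∂M`. -/
def boundaryMeasure : Measure M := ⨆ x : M, boundaryChartVolume n x

/-- `sup_S |f|`. -/
def supNormOn {X : Type*} (S : Set X) (f : X → ℝ) : ℝ := sSup ((fun x => |f x|) '' S)

variable (M) in
/-- `C_b^1(M)`: the bounded `C¹` functions on `M` (up to the boundary) with bounded gradient. -/
def Cb1 : Set (M → ℝ) :=
  {f | ContMDiff (𝓡∂ (n + 1)) 𝓘(ℝ, ℝ) 1 f ∧ ∃ C : ℝ, ∀ p, |f p| ≤ C ∧ ‖grad n f p‖ ≤ C}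

variable (M) in
/-- `C_b^1(∂M)`: the bounded `C¹` functions on `∂M` with bounded gradient. Such a function is
represented by a function on `M` whose values off `∂M` are irrelevant. -/
def boundaryCb1 : Set (M → ℝ) :=
  {f | ContMDiffOn (𝓡∂ (n + 1)) 𝓘(ℝ, ℝ) 1 f ((𝓡∂ (n + 1)).boundary M) ∧
    ∃ C : ℝ, ∀ p ∈ (𝓡∂ (n + 1)).boundary M, |f p| ≤ C ∧ ‖boundaryGrad n f p‖ ≤ C}

variable (M) in
/-- `C_0^2(M)`: the `C²` functions on `M` (up to the boundary) with compact support. -/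
def C02 : Set (M → ℝ) :=
  {f | ContMDiff (𝓡∂ (n + 1)) 𝓘(ℝ, ℝ) 2 f ∧ HasCompactSupport f}

end Geometry

/-! ### Rate functions in super and weak Poincaré inequalities

A rate function takes values in `[0, ∞]`; the value `∞` carries no information. -/

section Rates

variable {X : Type*} [MeasurableSpace X]

/-- `ν(f²) ≤ r 𝓔(f) + β(r) ν(|f|)²` for all `r > 0` and `f ∈ F`. -/
def SuperPoincare (ν : Measure X) (F : Set (X → ℝ)) (𝓔 : (X → ℝ) → ℝ) (β : ℝ → ℝ≥0∞) : Prop :=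
  ∀ r : ℝ, 0 < r → β r ≠ ⊤ → ∀ f ∈ F,
    ∫ x, f x ^ 2 ∂ν ≤ r * 𝓔 f + (β r).toReal * (∫ x, |f x| ∂ν) ^ 2

/-- `ν(f²) ≤ α(r) 𝓔(f) + r sup_S |f|²` for all `r > 0` and `f ∈ F` with `ν(f) = 0`. -/
def WeakPoincare (ν : Measure X) (S : Set X) (F : Set (X → ℝ)) (𝓔 : (X → ℝ) → ℝ)
    (α : ℝ → ℝ≥0∞) : Prop :=
  ∀ r : ℝ, 0 < r → α r ≠ ⊤ → ∀ f ∈ F, ∫ x, f x ∂ν = 0 →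
    ∫ x, f x ^ 2 ∂ν ≤ (α r).toReal * 𝓔 f + r * supNormOn S f ^ 2

/-- `sup {ν(f²) - r 𝓔(f) : f ∈ F, ν(|f|) = 1}`. (In the use below the constant `1` belongs to `F`
and has energy `0`, so the supremum is at least `1` and the truncation at `0` is immaterial.) -/
def superRate (ν : Measure X) (F : Set (X → ℝ)) (𝓔 : (X → ℝ) → ℝ) (r : ℝ) : ℝ≥0∞ :=
  ⨆ f : X → ℝ, ⨆ _ : f ∈ F, ⨆ _ : ∫ x, |f x| ∂ν = 1,
    ENNReal.ofReal (∫ x, f x ^ 2 ∂ν - r * 𝓔 f)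

/-- `sup {(ν(f²) - r sup |f|²)⁺ : f ∈ F, ν(f) = 0, 𝓔(f) = 1}`. -/
def weakRate (ν : Measure X) (F : Set (X → ℝ)) (𝓔 : (X → ℝ) → ℝ) (r : ℝ) : ℝ≥0∞ :=
  ⨆ f : X → ℝ, ⨆ _ : f ∈ F, ⨆ _ : ∫ x, f x ∂ν = 0, ⨆ _ : 𝓔 f = 1,
    ENNReal.ofReal (∫ x, f x ^ 2 ∂ν - r * supNormOn univ f ^ 2)

end Rates

/-! ### The sticky-reflected diffusion -/

/-- The data of a sticky-reflected diffusion on the Riemannian manifold `M` with non-empty boundary: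
the potentials `V` (of class `C¹` in the interior and continuous up to the boundary) and `W` (of
class `C¹` on the boundary; its values elsewhere are irrelevant) with `e^V` and `e^W` integrable,
the strength `δ ≥ 0` of the boundary diffusion and the strength `γ > 0` of the reflection. -/
structure Data (n : ℕ) (M : Type*) [TopologicalSpace M]
    [ChartedSpace (EuclideanHalfSpace (n + 1)) M]
    [RiemannianBundle (fun x : M => TangentSpace (𝓡∂ (n + 1)) x)] [MeasurableSpace M] where
  /-- the potential of the inside diffusion -/
  V : M → ℝ
  /-- the potential of the boundary diffusion -/
  W : M → ℝ
  /-- the strength of the boundary diffusion -/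
  δ : ℝ
  /-- the strength of the reflection -/
  γ : ℝ
  boundary_nonempty : ((𝓡∂ (n + 1)).boundary M).Nonempty
  continuous_V : Continuous V
  contMDiffOn_V : ContMDiffOn (𝓡∂ (n + 1)) 𝓘(ℝ, ℝ) 1 V ((𝓡∂ (n + 1)).interior M)
  contMDiffOn_W : ContMDiffOn (𝓡∂ (n + 1)) 𝓘(ℝ, ℝ) 1 W ((𝓡∂ (n + 1)).boundary M)
  integrable_V : Integrable (fun x => Real.exp (V x)) (volumeMeasure n M)
  integrable_W : Integrable (fun x => Real.exp (W x)) (boundaryMeasure n M)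
  δ_nonneg : 0 ≤ δ
  γ_pos : 0 < γ

namespace Data

variable {n : ℕ} {M : Type*} [TopologicalSpace M] [ChartedSpace (EuclideanHalfSpace (n + 1)) M]
  [RiemannianBundle (fun x : M => TangentSpace (𝓡∂ (n + 1)) x)] [MeasurableSpace M]
  (D : Data n M)

/-- `Z_V = ∫ e^V dΛ`. -/
def ZV : ℝ := ∫ x, Real.exp (D.V x) ∂(volumeMeasure n M)

/-- `Z_W^∂ = ∫ e^W dΛ_∂`. -/
def ZW : ℝ := ∫ x, Real.exp (D.W x) ∂(boundaryMeasure n M)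

/-- `μ_V = Z_V⁻¹ e^V Λ`. -/
def μV : Measure M :=
  (volumeMeasure n M).withDensity fun x => ENNReal.ofReal (Real.exp (D.V x) / D.ZV)

/-- `μ_W^∂ = (Z_W^∂)⁻¹ e^W Λ_∂`. -/
def μW : Measure M :=
  (boundaryMeasure n M).withDensity fun x => ENNReal.ofReal (Real.exp (D.W x) / D.ZW)

/-- `θ = γ Z_W^∂ / (γ Z_W^∂ + Z_V)`. -/
def θ : ℝ := D.γ * D.ZW / (D.γ * D.ZW + D.ZV)

/-- The invariant probability measure `μ = θ μ_V + (1 - θ) μ_W^∂`. -/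
def μ : Measure M := ENNReal.ofReal D.θ • D.μV + ENNReal.ofReal (1 - D.θ) • D.μW

/-- `μ_V(|∇f|²)`. -/
def energyV (f : M → ℝ) : ℝ := ∫ x, ‖grad n f x‖ ^ 2 ∂D.μV

/-- `μ_W^∂(|∇^∂ f|²)`. -/
def energyW (f : M → ℝ) : ℝ := ∫ x, ‖boundaryGrad n f x‖ ^ 2 ∂D.μW

/-- `𝓔_δ(f, f) = θ μ_V(|∇f|²) + (1 - θ) δ μ_W^∂(|∇^∂ f|²)`. -/
def energy (f : M → ℝ) : ℝ := D.θ * D.energyV f + (1 - D.θ) * D.δ * D.energyW f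

/-- The smallest rate `β(r)` in the super Poincaré inequality of `𝓔_δ`. -/
def β (r : ℝ) : ℝ≥0∞ := superRate D.μ (Cb1 n M) D.energy r

/-- The smallest rate `α(r)` in the weak Poincaré inequality of `𝓔_δ`. -/
def α (r : ℝ) : ℝ≥0∞ := weakRate D.μ (Cb1 n M) D.energy r

/-- `β_V` is a rate function in the super Poincaré inequality of `μ_V`. -/
def IsSuperRateV (βV : ℝ → ℝ≥0∞) : Prop := SuperPoincare D.μV (Cb1 n M) D.energyV βV

/-- `β_W^∂` is a rate function in the super Poincaré inequality of `μ_W^∂`. -/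
def IsSuperRateW (βW : ℝ → ℝ≥0∞) : Prop := SuperPoincare D.μW (boundaryCb1 n M) D.energyW βW

/-- `α_V` is a rate function in the weak Poincaré inequality of `μ_V`. -/
def IsWeakRateV (αV : ℝ → ℝ≥0∞) : Prop := WeakPoincare D.μV univ (Cb1 n M) D.energyV αV

/-- `α_W^∂` is a rate function in the weak Poincaré inequality of `μ_W^∂`. -/
def IsWeakRateW (αW : ℝ → ℝ≥0∞) : Prop :=
  WeakPoincare D.μW ((𝓡∂ (n + 1)).boundary M) (boundaryCb1 n M) D.energyW αW

/-- The closure of `(𝓔_δ, C_0^2(M))` in `L²(μ)` is conservative, that is, `1` lies in its domain and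
has energy `0`: there are `χ_k ∈ C_0^2(M)` with `χ_k → 1` in `L²(μ)` and `𝓔_δ(χ_k, χ_k) → 0`. -/
def Conservative : Prop :=
  ∃ χ : ℕ → M → ℝ, (∀ k, χ k ∈ C02 n M) ∧
    Tendsto (fun k => ∫ x, (χ k x - 1) ^ 2 ∂D.μ) atTop (𝓝 0) ∧
    Tendsto (fun k => D.energy (χ k)) atTop (𝓝 0)

/-- `L_V h = Δh + ⟨∇V, ∇h⟩` in the interior of `M` (the boundary is negligible for `μ_V`). -/
def LV (h : M → ℝ) (x : M) : ℝ := laplacian n h x + inner ℝ (grad n D.V x) (grad n h x)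

/-- The function `(L_V h)⁻`. -/
def negPartLV (h : M → ℝ) (x : M) : ℝ := max (-D.LV h x) 0

/-- Assumption (A) for the function `h`: `h ∈ C²(M)` up to the boundary, `N h = 1` on `∂M`,
`|∇h| ∈ L²(μ)`, `(W - V)⁺` is bounded on `∂M`, and `(L_V h)⁻ ∈ L²(μ_V)`. -/
structure AssumptionA (h : M → ℝ) : Prop where
  contMDiff : ContMDiff (𝓡∂ (n + 1)) 𝓘(ℝ, ℝ) 2 h
  normal_deriv : ∀ p ∈ (𝓡∂ (n + 1)).boundary M, differential n h p (inwardNormal n p) = 1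
  grad_memLp : MemLp (fun x => ‖grad n h x‖) 2 D.μ
  bddAbove : BddAbove ((fun x => max (D.W x - D.V x) 0) '' (𝓡∂ (n + 1)).boundary M)
  LV_memLp : MemLp (D.negPartLV h) 2 D.μV

/-- `C₀ = Z_V exp(sup_{∂M} (W - V)⁺) / Z_W^∂`. -/
def C₀ : ℝ :=
  D.ZV * Real.exp (supNormOn ((𝓡∂ (n + 1)).boundary M) fun x => max (D.W x - D.V x) 0) / D.ZW

/-- `C₁ = ‖(L_V h)⁻‖` in `L²(μ_V)`. -/
def C₁ (h : M → ℝ) : ℝ := (eLpNorm (D.negPartLV h) 2 D.μV).toReal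

/-- `C₂ = ‖∇h‖` in `L²(μ_V)`. -/
def C₂ (h : M → ℝ) : ℝ := (eLpNorm (fun x => ‖grad n h x‖) 2 D.μV).toReal

/-- `max {(1 + C₀² C₁²) α_V(s₁) + ((1 - θ) / θ) C₀² C₂², (1 / δ) α_W^∂(s₂)}`. -/
def weakBound (h : M → ℝ) (αV αW : ℝ → ℝ≥0∞) (s₁ s₂ : ℝ) : ℝ≥0∞ :=
  max (ENNReal.ofReal (1 + D.C₀ ^ 2 * D.C₁ h ^ 2) * αV s₁
      + ENNReal.ofReal ((1 - D.θ) / D.θ * D.C₀ ^ 2 * D.C₂ h ^ 2))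
    (ENNReal.ofReal (1 / D.δ) * αW s₂)

end Data

end StickyReflected

end

/-! The measure `μ = θ μ_V + (1 - θ) μ_W^∂` is a convex combination of a measure in the interior
and one on the boundary, and the energy is the corresponding combination of energies. A function in
`C_b^1(M)` may be used in the inequality for `μ_W^∂`, because the derivative within the boundary is
determined in the tangential directions (`eqOn_of_hasMFDerivWithinAt_boundary`), so that the
boundary gradient is a projection of the gradient and is bounded by it (`norm_boundaryGrad_le`).

For the super Poincaré inequality it then suffices to add the two inequalities with the weights `θ`
and `1 - θ`, since the square of `μ(|f|) = θ μ_V(|f|) + (1 - θ) μ_W^∂(|f|)` is at least the sum of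
the squares of the two terms (`weighted_super_le`).

For the weak Poincaré inequality and `μ(f) = 0`, the second moment is

  `μ(f²) = θ Var_V(f) + (1 - θ) Var_W(f) + θ (1 - θ) (μ_V(f) - μ_W^∂(f))²`,

where `Var_V` and `Var_W` are the variances under `μ_V` and `μ_W^∂`. The variances are bounded by
the weak inequalities of the components. The difference of the means is at most `μ_W^∂(|g|)` for
`g = f - μ_V(f)`, and (`Data.integral_abs_μW_le`)

  `μ_W^∂(|g|) ≤ C₀ (C₁ Var_V(f)^{1/2} + C₂ μ_V(|∇f|²)^{1/2})`.

When the square of this sum is split by `θ (1 - θ) (A + B)² ≤ θ A² + (1 - θ) B²`, the first term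
joins `θ Var_V(f)` and the second one the energy, with exactly the stated constants
(`weighted_weak_le`).

The bound on `μ_W^∂(|g|)` rests on Green's inequality (`Data.integral_exp_boundary_le`)

  `∫ u e^V dΛ_∂ ≤ ∫ (u (L_V h)⁻ - ⟨∇u, ∇h⟩) e^V dΛ`,

for `0 ≤ u ∈ C¹` with compact support, which expresses that `h` has normal derivative `1`. It is
applied to `u = (g² + ε²)^{1/2} φ(χ_k)`, where `χ_k` are the functions that witness the
conservativity and `φ` maps `0` to `0`, `1` to `1` and the line to `[0, 1]`; then `k → ∞` and
`ε → 0`.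

Green's inequality is reduced by a partition of unity to the domain of one chart
(`integral_boundary_source_le`), and there to a divergence inequality on the half-space. As `V` is
differentiable only in the interior, the latter is obtained from the divergence theorem on
`{ε ≤ y 0}` by letting `ε → 0` (`integral_boundary_le_of_neg_divergence_le`). The passage to a
chart uses three facts. The volume measures of `M` and of its boundary, defined as suprema over all
charts, have the usual densities in each chart, by the change of variables formula
(`volumeMeasure_restrict_source`, `boundaryMeasure_restrict_source`). The zeroth component of the
flux density `(det g)^{1/2} ∇h` on the boundary is the density of the boundary volume, by Cramer's
rule for the Gram matrix (`chartDensity_mul_chartGrad_zero`, `det_submatrix_gram`). The Laplacian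
at an interior point does not depend on the chart, since its weak formulation does not
(`laplacian_eq_chartLaplacian`). -/

noncomputable section

namespace StickyReflected

/-! ### Gram matrices -/

section GramAlgebra

open scoped Matrix

variable {W : Type*} [NormedAddCommGroup W] [InnerProductSpace ℝ W]

lemma det_gram_pos {m : ℕ} {c : Fin m → W} (hc : LinearIndependent ℝ c) :
    0 < (Matrix.of fun i j => inner ℝ (c i) (c j) : Matrix (Fin m) (Fin m) ℝ).det :=
  (Matrix.posDef_gram_of_linearIndependent (𝕜 := ℝ) hc).det_pos

/-- The Riesz representative of a covector `l`, in a basis `c` with Gram matrix `g`, is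
`∑ᵢ (∑ⱼ g^{ij} l(cⱼ)) cᵢ`. -/
lemma toDual_symm_eq_sum [CompleteSpace W] {m : ℕ} {c : Fin m → W} (hc : LinearIndependent ℝ c)
    (hspan : ⊤ ≤ Submodule.span ℝ (range c)) (l : W →L[ℝ] ℝ) :
    (InnerProductSpace.toDual ℝ W).symm l =
      ∑ i, (∑ j, (Matrix.of fun i j => inner ℝ (c i) (c j) : Matrix (Fin m) (Fin m) ℝ)⁻¹ i j *
        l (c j)) • c i := by
  set g : Matrix (Fin m) (Fin m) ℝ := Matrix.of fun i j => inner ℝ (c i) (c j) with hg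
  have hu : IsUnit g.det := (det_gram_pos hc).ne'.isUnit
  rw [LinearIsometryEquiv.symm_apply_eq]
  refine ContinuousLinearMap.coe_injective ?_
  refine LinearMap.ext_on_range (v := c) (top_le_iff.1 hspan) fun k => ?_
  simp only [ContinuousLinearMap.coe_coe, InnerProductSpace.toDual_apply_apply, sum_inner,
    real_inner_smul_left]
  have h1 : ∀ i, inner ℝ (c i) (c k) = g i k := fun i => rfl
  have h2 : ((fun j => l (c j)) ᵥ* (g⁻¹)ᵀ) ᵥ* g = fun j => l (c j) := by
    have hs : gᵀ = g := by ext i j; simp [hg, real_inner_comm]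
    rw [Matrix.transpose_nonsing_inv, hs, Matrix.vecMul_vecMul, Matrix.nonsing_inv_mul _ hu,
      Matrix.vecMul_one]
  have h3 := congrFun h2 k
  simp only [Matrix.vecMul, dotProduct, Matrix.transpose_apply] at h3
  rw [← h3]
  refine Finset.sum_congr rfl fun i _ => ?_
  rw [h1]
  congr 1
  exact Finset.sum_congr rfl fun j _ => mul_comm _ _

lemma apply_toDual_symm_eq_sum [CompleteSpace W] {m : ℕ} {c : Fin m → W}
    (hc : LinearIndependent ℝ c) (hspan : ⊤ ≤ Submodule.span ℝ (range c)) (k l : W →L[ℝ] ℝ) :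
    k ((InnerProductSpace.toDual ℝ W).symm l) = ∑ i, k (c i) *
      ∑ j, (Matrix.of fun i j => inner ℝ (c i) (c j) : Matrix (Fin m) (Fin m) ℝ)⁻¹ i j *
        l (c j) := by
  rw [toDual_symm_eq_sum hc hspan, map_sum]
  exact Finset.sum_congr rfl fun i _ => by rw [map_smul, smul_eq_mul, mul_comm]

/-- The squared norm of the covector dual to the zeroth vector of a basis with Gram matrix `g` is
`g⁻¹₀₀`, which by Cramer's rule is the quotient of the Gram determinant of the other basis vectors
by `det g`. -/
lemma det_submatrix_gram [CompleteSpace W] {n : ℕ} {c : Fin (n + 1) → W}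
    (hc : LinearIndependent ℝ c) (hspan : ⊤ ≤ Submodule.span ℝ (range c)) (l : W →L[ℝ] ℝ)
    (h0 : l (c 0) = 1) (hs : ∀ i : Fin n, l (c i.succ) = 0) :
    ((Matrix.of fun i j => inner ℝ (c i) (c j) : Matrix (Fin (n + 1)) (Fin (n + 1)) ℝ).submatrix
      Fin.succ Fin.succ).det =
      ‖l‖ ^ 2 * (Matrix.of fun i j => inner ℝ (c i) (c j) :
        Matrix (Fin (n + 1)) (Fin (n + 1)) ℝ).det := by
  have hl : ‖l‖ ^ 2 = (Matrix.of fun i j => inner ℝ (c i) (c j) :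
      Matrix (Fin (n + 1)) (Fin (n + 1)) ℝ)⁻¹ 0 0 := by
    have hv : ∀ i, l ((∑ j, (Matrix.of fun i j => inner ℝ (c i) (c j) :
        Matrix (Fin (n + 1)) (Fin (n + 1)) ℝ)⁻¹ i j * l (c j)) • c i) =
        (Matrix.of fun i j => inner ℝ (c i) (c j) :
        Matrix (Fin (n + 1)) (Fin (n + 1)) ℝ)⁻¹ i 0 * l (c i) := fun i => by
      rw [map_smul, Fin.sum_univ_succ, Finset.sum_eq_zero fun j _ => by rw [hs, mul_zero], h0,
        mul_one, add_zero, smul_eq_mul]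
    rw [← (InnerProductSpace.toDual ℝ W).symm.norm_map l, ← real_inner_self_eq_norm_sq,
      InnerProductSpace.toDual_symm_apply, toDual_symm_eq_sum hc hspan, map_sum,
      Finset.sum_congr rfl fun i _ => hv i, Fin.sum_univ_succ,
      Finset.sum_eq_zero fun i _ => by rw [hs, mul_zero], h0, mul_one, add_zero]
  have hp := det_gram_pos hc
  rw [hl, Matrix.inv_def, Matrix.smul_apply, Matrix.adjugate_fin_succ_eq_det_submatrix,
    Ring.inverse_eq_inv']
  simp only [Fin.succAbove_zero, Fin.val_zero, add_zero, pow_zero, one_mul, smul_eq_mul]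
  field_simp

lemma gram_linearCombination {m k : ℕ} (c : Fin m → W) (P : Matrix (Fin k) (Fin m) ℝ) :
    (Matrix.of fun i j => inner ℝ (∑ a, P i a • c a) (∑ b, P j b • c b) :
        Matrix (Fin k) (Fin k) ℝ) =
      P * (Matrix.of fun i j => inner ℝ (c i) (c j) : Matrix (Fin m) (Fin m) ℝ) * Pᵀ := by
  ext i j
  simp only [Matrix.of_apply, Matrix.mul_apply, Matrix.transpose_apply, sum_inner, inner_sum,
    real_inner_smul_left, real_inner_smul_right, Finset.sum_mul]
  refine Finset.sum_congr rfl fun a _ => Finset.sum_congr rfl fun b _ => ?_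
  ring

end GramAlgebra

/-! ### The divergence inequality on a half-space -/

section HalfSpace

lemma continuous_fin_cons {n : ℕ} :
    Continuous fun q : ℝ × (Fin n → ℝ) => (Fin.cons q.1 q.2 : Fin (n + 1) → ℝ) := by
  refine continuous_pi fun i => ?_
  refine Fin.cases ?_ (fun j => ?_) i
  · simpa using continuous_fst
  · simp only [Fin.cons_succ]
    fun_prop

variable {n : ℕ} {X : Fin (n + 1) → (Fin (n + 1) → ℝ) → ℝ} {b : (Fin (n + 1) → ℝ) → ℝ} {R : ℝ}

/-- The divergence theorem on the shifted half-space `{ε ≤ y 0}`, in the form of an inequality. -/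
lemma integral_cons_le_of_neg_divergence_le {ε : ℝ} (hε : 0 < ε)
    (hsupp : ∀ i y, (∃ j, R ≤ |y j|) → X i y = 0)
    (hC1 : ∀ i, ContDiffOn ℝ 1 (X i) {y | 0 < y 0})
    (hb : IntegrableOn b {y | 0 < y 0})
    (hdiv : ∀ y, 0 < y 0 → -∑ i, fderiv ℝ (X i) y (Pi.single i 1) ≤ b y) :
    ∫ y : Fin n → ℝ, X 0 (Fin.cons ε y) ≤ ∫ y in {y : Fin (n + 1) → ℝ | ε ≤ y 0}, b y := by
  -- the box `[ε, R] × [-R, R]ⁿ` has to be non-empty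
  wlog hR : ε < R generalizing R
  · refine this (R := ε + 1) (fun i y ⟨j, hj⟩ => hsupp i y ⟨j, ?_⟩) (by linarith)
    linarith
  have hopen : IsOpen {y : Fin (n + 1) → ℝ | 0 < y 0} :=
    isOpen_lt continuous_const (continuous_apply 0)
  set a : Fin (n + 1) → ℝ := Fin.cons ε (fun _ => -R) with ha
  set c : Fin (n + 1) → ℝ := fun _ => R with hc
  have hR0 : 0 < R := hε.trans hR
  have hle : a ≤ c := by
    intro i
    refine Fin.cases ?_ (fun j => ?_) i
    · simpa [ha, hc] using hR.le
    · simp [ha, hc]; linarith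
  have hsub : Icc a c ⊆ {y : Fin (n + 1) → ℝ | 0 < y 0} := fun y hy => by
    have := hy.1 0
    simp only [ha, Fin.cons_zero] at this
    exact hε.trans_le this
  have hfc : ∀ i, ContinuousOn (fun y => fderiv ℝ (X i) y (Pi.single i 1))
      {y : Fin (n + 1) → ℝ | 0 < y 0} := fun i =>
    ((hC1 i).continuousOn_fderiv_of_isOpen hopen le_rfl).clm_apply continuousOn_const
  have hdc : ContinuousOn (fun y => ∑ i, fderiv ℝ (X i) y (Pi.single i 1))
      {y : Fin (n + 1) → ℝ | 0 < y 0} := continuousOn_finsetSum _ fun i _ => hfc i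
  have hdi : IntegrableOn (fun y => ∑ i, fderiv ℝ (X i) y (Pi.single i 1)) (Icc a c) :=
    (hdc.mono hsub).integrableOn_compact isCompact_Icc
  have key := integral_divergence_of_hasFDerivAt_off_countable' a c hle X
    (fun i => fderiv ℝ (X i)) ∅ countable_empty
    (fun i => (hC1 i).continuousOn.mono hsub)
    (fun y hy i => by
      have : y ∈ Icc a c := ⟨fun i => (hy.1 i trivial).1.le, fun i => (hy.1 i trivial).2.le⟩
      exact (((hC1 i).differentiableOn one_ne_zero).differentiableAt
        (hopen.mem_nhds (hsub this))).hasFDerivAt) hdi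
  rw [Fin.sum_univ_succ, Finset.sum_eq_zero, add_zero] at key
  rotate_left
  · intro j _
    rw [setIntegral_congr_fun (g := fun _ => (0:ℝ)) measurableSet_Icc
        (fun y _ => hsupp _ _ ⟨j.succ, by simp [hc, le_abs_self]⟩),
      setIntegral_congr_fun (g := fun _ => (0:ℝ)) measurableSet_Icc
        (fun y _ => hsupp _ _ ⟨j.succ, by simp [ha, le_abs_self]⟩)]
    simp
  rw [setIntegral_congr_fun (g := fun _ => (0:ℝ)) measurableSet_Icc
        (fun y _ => hsupp _ _ ⟨0, by simp [hc, le_abs_self]⟩)] at key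
  simp only [integral_zero, zero_sub, Fin.succAbove_zero] at key
  have hface : ∫ y in Icc (a ∘ Fin.succ) (c ∘ Fin.succ), X 0 (Fin.insertNth 0 (a 0) y) =
      ∫ y : Fin n → ℝ, X 0 (Fin.cons ε y) := by
    simp only [Fin.insertNth_zero', ha, Fin.cons_zero]
    refine setIntegral_eq_integral_of_forall_compl_eq_zero fun y hy => ?_
    have : ∃ j, R ≤ |y j| := by
      by_contra! hcon
      refine hy ⟨fun j => ?_, fun j => ?_⟩
      · simpa using (abs_lt.1 (hcon j)).1.le
      · simpa [hc] using (abs_lt.1 (hcon j)).2.le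
    obtain ⟨j, hj⟩ := this
    exact hsupp _ _ ⟨j.succ, by simpa using hj⟩
  rw [hface] at key
  have hmε : MeasurableSet {y : Fin (n + 1) → ℝ | ε ≤ y 0} :=
    measurableSet_le measurable_const (measurable_pi_apply 0)
  have hεsub : {y : Fin (n + 1) → ℝ | ε ≤ y 0} ⊆ {y | 0 < y 0} := fun y hy =>
    hε.trans_le hy
  have h1 : ∫ y : Fin n → ℝ, X 0 (Fin.cons ε y) =
      ∫ y in Icc a c, -∑ i, fderiv ℝ (X i) y (Pi.single i 1) := by
    rw [integral_neg, key, neg_neg]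
  rw [h1]
  refine (setIntegral_mono_on hdi.neg (hb.mono_set hsub) measurableSet_Icc
    fun y hy => hdiv y (hsub hy)).trans ?_
  -- outside the box the field vanishes locally, so that `b ≥ 0` there
  have hnull : ∀ y : Fin (n + 1) → ℝ, ε ≤ y 0 → y ∉ Icc a c → 0 ≤ b y := by
    intro y hy hyn
    have : ∃ j, R < |y j| := by
      by_contra! hcon
      refine hyn ⟨fun j => ?_, fun j => ?_⟩
      · refine Fin.cases ?_ (fun j => ?_) j
        · simpa [ha] using hy
        · simpa [ha] using (abs_le.1 (hcon j.succ)).1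
      · simpa [hc] using (abs_le.1 (hcon j)).2
    obtain ⟨j, hj⟩ := this
    have hz : ∀ i, fderiv ℝ (X i) y = 0 := fun i => by
      have : X i =ᶠ[𝓝 y] fun _ => 0 := by
        have ho : IsOpen {z : Fin (n + 1) → ℝ | R < |z j|} :=
          isOpen_lt continuous_const (continuous_apply j).abs
        filter_upwards [ho.mem_nhds hj] with z hz using hsupp i z ⟨j, le_of_lt hz⟩
      rw [this.fderiv_eq]; simp
    have := hdiv y (hεsub hy)
    simpa [hz] using this
  have hbox : Icc a c ⊆ {y : Fin (n + 1) → ℝ | ε ≤ y 0} := fun y hy => by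
    simpa [ha] using hy.1 0
  have h2 := setIntegral_sdiff measurableSet_Icc (hb.mono_set hεsub) hbox
  have h3 : 0 ≤ ∫ y in {y : Fin (n + 1) → ℝ | ε ≤ y 0} \ Icc a c, b y :=
    setIntegral_nonneg (hmε.diff measurableSet_Icc) fun y hy => hnull y hy.1 hy.2
  linarith

/-- A vector field on the closed half-space `{0 ≤ y 0}` that is continuous up to the boundary,
compactly supported, and of class `C¹` only inside, has an inward flux through the boundary of at
most the integral of any integrable majorant of its negative divergence. -/
theorem integral_boundary_le_of_neg_divergence_le
    (hsupp : ∀ i y, (∃ j, R ≤ |y j|) → X i y = 0)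
    (hcont : ContinuousOn (X 0) {y | 0 ≤ y 0})
    (hC1 : ∀ i, ContDiffOn ℝ 1 (X i) {y | 0 < y 0})
    (hb : IntegrableOn b {y | 0 < y 0})
    (hdiv : ∀ y, 0 < y 0 → -∑ i, fderiv ℝ (X i) y (Pi.single i 1) ≤ b y) :
    ∫ y : Fin n → ℝ, X 0 (Fin.cons 0 y) ≤ ∫ y in {y : Fin (n + 1) → ℝ | 0 < y 0}, b y := by
  set K : Set (Fin (n + 1) → ℝ) := Icc (Fin.cons 0 fun _ => -R) (Fin.cons 1 fun _ => R) with hK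
  have hKsub : K ⊆ {y | 0 ≤ y 0} := fun y hy => by simpa using hy.1 0
  obtain ⟨C, hC⟩ := (isCompact_Icc (a := (Fin.cons 0 fun _ => -R : Fin (n + 1) → ℝ))
    (b := Fin.cons 1 fun _ => R)).exists_bound_of_continuousOn (hcont.mono hKsub)
  have hcomp : ContinuousOn (fun q : ℝ × (Fin n → ℝ) => X 0 (Fin.cons q.1 q.2)) {q | 0 ≤ q.1} :=
    hcont.comp continuous_fin_cons.continuousOn fun q hq => by simpa using hq
  set B : Set (Fin n → ℝ) := Icc (fun _ => -R) (fun _ => R) with hB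
  have hout : ∀ ε : ℝ, ∀ y : Fin n → ℝ, y ∉ B → X 0 (Fin.cons ε y) = 0 := by
    intro ε y hy
    have : ∃ j, R ≤ |y j| := by
      by_contra! hcon
      exact hy ⟨fun j => (abs_lt.1 (hcon j)).1.le, fun j => (abs_lt.1 (hcon j)).2.le⟩
    obtain ⟨j, hj⟩ := this
    exact hsupp _ _ ⟨j.succ, by simpa using hj⟩
  have hslice : ∀ ε : ℝ, 0 ≤ ε → Continuous fun y : Fin n → ℝ => X 0 (Fin.cons ε y) := fun ε hε =>
    hcomp.comp_continuous (by fun_prop : Continuous fun y : Fin n → ℝ => (ε, y)) fun _ => hε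
  -- the flux through the slice `{y 0 = ε}`, where the field is `C¹`, converges to that through the
  -- boundary, where it is only continuous
  have hlim : Tendsto (fun ε : ℝ => ∫ y : Fin n → ℝ, X 0 (Fin.cons ε y)) (𝓝[>] 0)
      (𝓝 (∫ y : Fin n → ℝ, X 0 (Fin.cons 0 y))) := by
    refine tendsto_integral_filter_of_dominated_convergence (B.indicator fun _ => C) ?_ ?_ ?_ ?_
    · filter_upwards [self_mem_nhdsWithin] with ε hε
      exact (hslice ε (le_of_lt hε)).aestronglyMeasurable
    · filter_upwards [Ioc_mem_nhdsGT (zero_lt_one' ℝ)] with ε hε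
      refine ae_of_all _ fun y => ?_
      by_cases hy : y ∈ B
      · rw [indicator_of_mem hy]
        refine hC _ ⟨fun i => ?_, fun i => ?_⟩
        · refine Fin.cases ?_ (fun j => ?_) i
          · simpa using hε.1.le
          · simpa using hy.1 j
        · refine Fin.cases ?_ (fun j => ?_) i
          · simpa using hε.2
          · simpa using hy.2 j
      · rw [indicator_of_notMem hy, hout ε y hy, norm_zero]
    · exact (integrable_indicator_iff measurableSet_Icc).2
        (integrableOn_const isCompact_Icc.measure_lt_top.ne)
    · refine ae_of_all _ fun y => ?_
      have h1 : ContinuousWithinAt (fun ε : ℝ => X 0 (Fin.cons ε y)) (Ici 0) 0 := by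
        have := hcomp (0, y) (by simp)
        exact this.comp (f := fun ε : ℝ => (ε, y)) (by fun_prop) fun ε hε => hε
      exact h1.tendsto.mono_left (nhdsWithin_mono _ Ioi_subset_Ici_self)
  have hlim' : Tendsto (fun k : ℕ => ∫ y : Fin n → ℝ, X 0 (Fin.cons (1 / ((k : ℝ) + 1)) y)) atTop
      (𝓝 (∫ y : Fin n → ℝ, X 0 (Fin.cons 0 y))) :=
    hlim.comp (tendsto_nhdsWithin_iff.2 ⟨tendsto_one_div_add_atTop_nhds_zero_nat,
      Eventually.of_forall fun k => by simp only [mem_Ioi]; positivity⟩)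
  have hun : ⋃ k : ℕ, {y : Fin (n + 1) → ℝ | 1 / ((k : ℝ) + 1) ≤ y 0} = {y | 0 < y 0} := by
    ext y
    simp only [mem_iUnion, mem_ofPred_eq]
    refine ⟨fun ⟨k, hk⟩ => lt_of_lt_of_le (by positivity) hk, fun hy => ?_⟩
    obtain ⟨k, hk⟩ := exists_nat_one_div_lt hy
    exact ⟨k, hk.le⟩
  have hb' := tendsto_setIntegral_of_monotone (μ := volume) (f := b)
    (s := fun k : ℕ => {y : Fin (n + 1) → ℝ | 1 / ((k : ℝ) + 1) ≤ y 0})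
    (fun k => measurableSet_le measurable_const (measurable_pi_apply 0))
    (fun k l hkl y hy => (one_div_le_one_div_of_le (by positivity)
      (by simpa using hkl : (k : ℝ) + 1 ≤ l + 1)).trans (show 1 / ((k : ℝ) + 1) ≤ y 0 from hy))
    (by rw [hun]; exact hb)
  rw [hun] at hb'
  exact le_of_tendsto_of_tendsto' hlim' hb' fun k =>
    integral_cons_le_of_neg_divergence_le (by positivity) hsupp hC1 hb hdiv

end HalfSpace

/-! ### Charts of a manifold with boundary -/

section Charts

variable {n : ℕ} {M : Type*} [TopologicalSpace M] [ChartedSpace (EuclideanHalfSpace (n + 1)) M]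

lemma mem_range_model_iff {y : EuclideanSpace ℝ (Fin (n + 1))} :
    y ∈ range (𝓡∂ (n + 1)) ↔ 0 ≤ y 0 := by
  rw [range_modelWithCornersEuclideanHalfSpace]; rfl

lemma nonneg_of_mem_target {x : M} {y : EuclideanSpace ℝ (Fin (n + 1))}
    (hy : y ∈ (extChartAt (𝓡∂ (n + 1)) x).target) : 0 ≤ y 0 :=
  mem_range_model_iff.1 (extChartAt_target_subset_range x hy)

lemma measurableSet_extChartAt_target (x : M) :
    MeasurableSet (extChartAt (𝓡∂ (n + 1)) x).target := by
  rw [extChartAt_target]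
  exact (((chartAt _ x).open_target.preimage (𝓡∂ (n + 1)).continuous_symm).measurableSet).inter
    (𝓡∂ (n + 1)).isClosed_range.measurableSet

/-- The charts have targets that are relatively open in the half-space. -/
lemma exists_isOpen_target_eq (x : M) : ∃ O : Set (EuclideanSpace ℝ (Fin (n + 1))), IsOpen O ∧
    (extChartAt (𝓡∂ (n + 1)) x).target = O ∩ {y | 0 ≤ y 0} := by
  refine ⟨_, (chartAt _ x).open_target.preimage (𝓡∂ (n + 1)).continuous_symm, ?_⟩
  rw [extChartAt_target, range_modelWithCornersEuclideanHalfSpace]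

/-- Derivatives within the half-space, as in the definition of the coordinate fields, agree on the
target of a chart with derivatives within the target. -/
lemma fderivWithin_target {x : M} {y : EuclideanSpace ℝ (Fin (n + 1))}
    (hy : y ∈ (extChartAt (𝓡∂ (n + 1)) x).target) (f : EuclideanSpace ℝ (Fin (n + 1)) → ℝ) :
    fderivWithin ℝ f (range (𝓡∂ (n + 1))) y =
      fderivWithin ℝ f (extChartAt (𝓡∂ (n + 1)) x).target y := by
  obtain ⟨O, hO, hT⟩ := exists_isOpen_target_eq (n := n) x
  rw [hT, range_modelWithCornersEuclideanHalfSpace, inter_comm]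
  rw [hT] at hy
  exact (fderivWithin_inter (hO.mem_nhds hy.1)).symm

variable [IsManifold (𝓡∂ (n + 1)) ∞ M]

lemma symm_mem_interior_iff {x : M} {y : EuclideanSpace ℝ (Fin (n + 1))}
    (hy : y ∈ (extChartAt (𝓡∂ (n + 1)) x).target) :
    (extChartAt (𝓡∂ (n + 1)) x).symm y ∈ (𝓡∂ (n + 1)).interior M ↔ 0 < y 0 := by
  have hs : (extChartAt (𝓡∂ (n + 1)) x).symm y ∈ (chartAt (EuclideanHalfSpace (n + 1)) x).source :=
    by simpa using (extChartAt (𝓡∂ (n + 1)) x).map_target hy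
  have h1 := (𝓡∂ (n + 1)).isInteriorPoint_iff_of_mem_atlas (n := ∞) (by simp)
    (chart_mem_atlas (EuclideanHalfSpace (n + 1)) x) hs
  have h2 : ((chartAt (EuclideanHalfSpace (n + 1)) x).extend (𝓡∂ (n + 1)))
      ((extChartAt (𝓡∂ (n + 1)) x).symm y) = y := (extChartAt (𝓡∂ (n + 1)) x).right_inv hy
  rw [h2] at h1
  refine h1.trans ?_
  constructor
  · intro h
    have h3 := interior_mono (extChartAt_target_subset_range x) h
    rw [interior_range_modelWithCornersEuclideanHalfSpace] at h3
    exact h3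
  · intro h
    obtain ⟨O, hO, hT⟩ := exists_isOpen_target_eq (n := n) x
    refine mem_interior.2 ⟨O ∩ {y | 0 < y 0}, ?_, ?_, ?_⟩
    · show _ ⊆ (extChartAt (𝓡∂ (n + 1)) x).target
      rw [hT]
      exact fun z hz => ⟨hz.1, (le_of_lt (show (0 : ℝ) < z 0 from hz.2) : (0 : ℝ) ≤ z 0)⟩
    · exact hO.inter (isOpen_lt continuous_const (by fun_prop))
    · rw [hT] at hy; exact ⟨hy.1, h⟩

lemma symm_mem_boundary_iff {x : M} {y : EuclideanSpace ℝ (Fin (n + 1))}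
    (hy : y ∈ (extChartAt (𝓡∂ (n + 1)) x).target) :
    (extChartAt (𝓡∂ (n + 1)) x).symm y ∈ (𝓡∂ (n + 1)).boundary M ↔ y 0 = 0 := by
  rw [← (𝓡∂ (n + 1)).compl_interior, mem_compl_iff, symm_mem_interior_iff hy, not_lt]
  exact ⟨fun h => le_antisymm h (nonneg_of_mem_target hy), fun h => h.le⟩

lemma extChartAt_mem_interior_iff {x p : M} (hp : p ∈ (extChartAt (𝓡∂ (n + 1)) x).source) :
    p ∈ (𝓡∂ (n + 1)).interior M ↔ 0 < extChartAt (𝓡∂ (n + 1)) x p 0 := by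
  rw [← symm_mem_interior_iff ((extChartAt (𝓡∂ (n + 1)) x).map_source hp),
    (extChartAt (𝓡∂ (n + 1)) x).left_inv hp]

lemma extChartAt_mem_boundary_iff {x p : M} (hp : p ∈ (extChartAt (𝓡∂ (n + 1)) x).source) :
    p ∈ (𝓡∂ (n + 1)).boundary M ↔ extChartAt (𝓡∂ (n + 1)) x p 0 = 0 := by
  rw [← symm_mem_boundary_iff ((extChartAt (𝓡∂ (n + 1)) x).map_source hp),
    (extChartAt (𝓡∂ (n + 1)) x).left_inv hp]

lemma isOpen_manifold_interior : IsOpen ((𝓡∂ (n + 1)).interior M) :=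
  (𝓡∂ (n + 1)).isOpen_interior (n := ∞) (by simp)

lemma isClosed_boundary : IsClosed ((𝓡∂ (n + 1)).boundary M) :=
  (𝓡∂ (n + 1)).isClosed_boundary (n := ∞) (by simp)

/-! ### Coordinate vector fields -/

/-- The coordinate fields at a point are the images of the standard basis under a linear
equivalence, the differential of the inverse of the chart. -/
lemma exists_continuousLinearEquiv_coordVector {x : M} {y : EuclideanSpace ℝ (Fin (n + 1))}
    (hy : y ∈ (extChartAt (𝓡∂ (n + 1)) x).target) :
    ∃ e : EuclideanSpace ℝ (Fin (n + 1)) ≃L[ℝ]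
      TangentSpace (𝓡∂ (n + 1)) ((extChartAt (𝓡∂ (n + 1)) x).symm y),
      ∀ i, coordVector n x y i = e (EuclideanSpace.single i (1 : ℝ)) := by
  obtain ⟨e, he⟩ := isInvertible_mfderivWithin_extChartAt_symm hy
  refine ⟨e, fun i => ?_⟩
  rw [coordVector, ← he]
  rfl

lemma coordVector_linearIndependent {x : M} {y : EuclideanSpace ℝ (Fin (n + 1))}
    (hy : y ∈ (extChartAt (𝓡∂ (n + 1)) x).target) :
    LinearIndependent ℝ (coordVector n x y) := by
  obtain ⟨e, he⟩ := exists_continuousLinearEquiv_coordVector hy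
  have h : coordVector n x y =
      e.toLinearEquiv ∘ (EuclideanSpace.basisFun (Fin (n + 1)) ℝ).toBasis := by
    ext1 i; simp [he]; rfl
  rw [h]
  exact ((EuclideanSpace.basisFun (Fin (n + 1)) ℝ).toBasis.linearIndependent).map' _
    e.toLinearEquiv.ker

lemma coordVector_span {x : M} {y : EuclideanSpace ℝ (Fin (n + 1))}
    (hy : y ∈ (extChartAt (𝓡∂ (n + 1)) x).target) :
    ⊤ ≤ Submodule.span ℝ (range (coordVector n x y)) := by
  obtain ⟨e, he⟩ := exists_continuousLinearEquiv_coordVector hy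
  have h : coordVector n x y =
      e.toLinearEquiv ∘ (EuclideanSpace.basisFun (Fin (n + 1)) ℝ).toBasis := by
    ext1 i; simp [he]; rfl
  rw [h, range_comp, ← LinearEquiv.coe_coe, ← LinearMap.map_span, Module.Basis.span_eq,
    Submodule.map_top, LinearEquiv.range]

/-- The coordinate derivatives of a function are its derivatives along the coordinate fields. -/
lemma differential_coordVector {x : M} {y : EuclideanSpace ℝ (Fin (n + 1))}
    (hy : y ∈ (extChartAt (𝓡∂ (n + 1)) x).target) {f : M → ℝ}
    (hf : MDifferentiableAt (𝓡∂ (n + 1)) 𝓘(ℝ, ℝ) f ((extChartAt (𝓡∂ (n + 1)) x).symm y))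
    (i : Fin (n + 1)) :
    differential n f _ (coordVector n x y i) =
      fderivWithin ℝ (f ∘ (extChartAt (𝓡∂ (n + 1)) x).symm) (range (𝓡∂ (n + 1))) y
        (EuclideanSpace.single i 1) := by
  have h1 := mdifferentiableWithinAt_extChartAt_symm hy
  have h2 := mfderiv_comp_mfderivWithin (I := 𝓘(ℝ, EuclideanSpace ℝ (Fin (n + 1))))
    (I' := 𝓡∂ (n + 1)) (I'' := 𝓘(ℝ, ℝ)) y hf h1
    ((uniqueMDiffWithinAt_iff_uniqueDiffWithinAt).2
      ((𝓡∂ (n + 1)).uniqueDiffOn y (extChartAt_target_subset_range x hy)))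
  rw [← mfderivWithin_eq_fderivWithin, h2]
  rfl

/-- The coordinate fields of the chart at `x` are the images of the standard basis under the
trivialization of the tangent bundle at `x`. The smoothness of the metric is formulated in terms of
the latter. -/
lemma coordVector_eq_symmL {x : M} {y : EuclideanSpace ℝ (Fin (n + 1))}
    (hy : y ∈ (extChartAt (𝓡∂ (n + 1)) x).target) (i : Fin (n + 1)) :
    coordVector n x y i = (trivializationAt (EuclideanSpace ℝ (Fin (n + 1)))
      (TangentSpace (𝓡∂ (n + 1)) : M → Type _) x).symmL ℝ ((extChartAt (𝓡∂ (n + 1)) x).symm y)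
        (EuclideanSpace.single i 1) := by
  have hs : (extChartAt (𝓡∂ (n + 1)) x).symm y ∈ (chartAt (EuclideanHalfSpace (n + 1)) x).source :=
    by simpa using (extChartAt (𝓡∂ (n + 1)) x).map_target hy
  rw [TangentBundle.symmL_trivializationAt hs, coordVector]
  have := (extChartAt (𝓡∂ (n + 1)) x).right_inv hy
  congr 1
  congr 1; rw [this]

lemma contDiffOn_comp_extChartAt_symm {x : M} {k : ℕ∞} {f : M → ℝ} {s : Set M}
    (hf : ContMDiffOn (𝓡∂ (n + 1)) 𝓘(ℝ, ℝ) k f s) :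
    ContDiffOn ℝ k (f ∘ (extChartAt (𝓡∂ (n + 1)) x).symm)
      ((extChartAt (𝓡∂ (n + 1)) x).target ∩ (extChartAt (𝓡∂ (n + 1)) x).symm ⁻¹' s) := by
  have h1 := (contMDiffOn_extChartAt_symm (I := 𝓡∂ (n + 1)) (n := k) x)
  refine ContMDiffOn.contDiffOn ?_
  exact hf.comp (h1.mono inter_subset_left) fun y hy => hy.2

lemma contDiffOn_chart (x : M) {k : ℕ∞} {f : M → ℝ}
    (hf : ContMDiff (𝓡∂ (n + 1)) 𝓘(ℝ, ℝ) k f) :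
    ContDiffOn ℝ k (f ∘ (extChartAt (𝓡∂ (n + 1)) x).symm)
      (extChartAt (𝓡∂ (n + 1)) x).target := by
  simpa using contDiffOn_comp_extChartAt_symm (x := x) (s := univ) hf.contMDiffOn

lemma contDiffOn_fderivWithin_chart (x : M) {k l : ℕ∞} (hkl : k + 1 ≤ l) {f : M → ℝ}
    (hf : ContMDiff (𝓡∂ (n + 1)) 𝓘(ℝ, ℝ) l f) (v : EuclideanSpace ℝ (Fin (n + 1))) :
    ContDiffOn ℝ k (fun y => fderivWithin ℝ (f ∘ (extChartAt (𝓡∂ (n + 1)) x).symm)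
      (range (𝓡∂ (n + 1))) y v) (extChartAt (𝓡∂ (n + 1)) x).target := by
  refine (((contDiffOn_chart x hf).fderivWithin (uniqueDiffOn_extChartAt_target x)
    (m := k) (by exact_mod_cast hkl)).clm_apply (contDiffOn_const (c := v))).congr fun y hy => ?_
  rw [fderivWithin_target hy]

end Charts

/-! ### The metric in coordinates -/

section Metric

variable {n : ℕ} {M : Type*} [TopologicalSpace M] [ChartedSpace (EuclideanHalfSpace (n + 1)) M]
  [RiemannianBundle (fun x : M => TangentSpace (𝓡∂ (n + 1)) x)]

lemma inner_grad_left (f : M → ℝ) (p : M) (v : TangentSpace (𝓡∂ (n + 1)) p) :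
    inner ℝ (grad n f p) v = differential n f p v := by
  rw [grad, InnerProductSpace.toDual_symm_apply]

omit [RiemannianBundle (fun x : M => TangentSpace (𝓡∂ (n + 1)) x)] in
lemma differential_eq_zero_of_notMem_tsupport {f : M → ℝ} {p : M} (hp : p ∉ tsupport f) :
    differential n f p = 0 := by
  have h : f =ᶠ[𝓝 p] fun _ => 0 := notMem_tsupport_iff_eventuallyEq.1 hp
  rw [differential, h.mfderiv_eq]
  exact mfderiv_const

lemma inner_grad_eq_zero_of_notMem_tsupport {f h : M → ℝ} {p : M} (hp : p ∉ tsupport f) :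
    inner ℝ (grad n f p) (grad n h p) = 0 := by
  rw [inner_grad_left, differential_eq_zero_of_notMem_tsupport hp]
  rfl

/-- The coordinates `∑ⱼ g^{ij} ∂ⱼh` of the gradient of `h` in the chart at `x`. -/
def chartGrad (x : M) (h : M → ℝ) (i : Fin (n + 1)) (y : EuclideanSpace ℝ (Fin (n + 1))) : ℝ :=
  ∑ j, (gram n x y)⁻¹ i j *
    fderivWithin ℝ (h ∘ (extChartAt (𝓡∂ (n + 1)) x).symm) (range (𝓡∂ (n + 1))) y
      (EuclideanSpace.single j 1)

/-- The density `(det g)^{1/2}` of the Riemannian volume in the chart at `x`. -/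
def chartDensity (n : ℕ) {M : Type*} [TopologicalSpace M]
    [ChartedSpace (EuclideanHalfSpace (n + 1)) M]
    [RiemannianBundle (fun x : M => TangentSpace (𝓡∂ (n + 1)) x)] (x : M)
    (y : EuclideanSpace ℝ (Fin (n + 1))) : ℝ :=
  Real.sqrt (gram n x y).det

variable [IsManifold (𝓡∂ (n + 1)) ∞ M]

/-- The value of a covector on the gradient, in coordinates. -/
lemma apply_grad_eq {x : M} {y : EuclideanSpace ℝ (Fin (n + 1))}
    (hy : y ∈ (extChartAt (𝓡∂ (n + 1)) x).target)
    (l : TangentSpace (𝓡∂ (n + 1)) ((extChartAt (𝓡∂ (n + 1)) x).symm y) →L[ℝ] ℝ) {h : M → ℝ}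
    (hh : MDifferentiableAt (𝓡∂ (n + 1)) 𝓘(ℝ, ℝ) h ((extChartAt (𝓡∂ (n + 1)) x).symm y)) :
    l (grad n h ((extChartAt (𝓡∂ (n + 1)) x).symm y)) = ∑ i, l (coordVector n x y i) *
      chartGrad x h i y := by
  unfold chartGrad
  simp_rw [← differential_coordVector hy hh]
  have hl := coordVector_linearIndependent hy
  have hs := coordVector_span hy
  unfold gram
  generalize coordVector n x y = c at hl hs ⊢
  exact apply_toDual_symm_eq_sum
    (W := TangentSpace (𝓡∂ (n + 1)) ((extChartAt (𝓡∂ (n + 1)) x).symm y))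
    hl hs l (differential n h ((extChartAt (𝓡∂ (n + 1)) x).symm y))

lemma inner_grad_grad_eq {x : M} {y : EuclideanSpace ℝ (Fin (n + 1))}
    (hy : y ∈ (extChartAt (𝓡∂ (n + 1)) x).target) {f h : M → ℝ}
    (hf : MDifferentiableAt (𝓡∂ (n + 1)) 𝓘(ℝ, ℝ) f ((extChartAt (𝓡∂ (n + 1)) x).symm y))
    (hh : MDifferentiableAt (𝓡∂ (n + 1)) 𝓘(ℝ, ℝ) h ((extChartAt (𝓡∂ (n + 1)) x).symm y)) :
    inner ℝ (grad n f ((extChartAt (𝓡∂ (n + 1)) x).symm y))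
        (grad n h ((extChartAt (𝓡∂ (n + 1)) x).symm y)) =
      ∑ i, fderivWithin ℝ (f ∘ (extChartAt (𝓡∂ (n + 1)) x).symm) (range (𝓡∂ (n + 1))) y
        (EuclideanSpace.single i 1) * chartGrad x h i y := by
  rw [inner_grad_left, apply_grad_eq hy _ hh]
  exact Finset.sum_congr rfl fun i _ => by rw [differential_coordVector hy hf]

lemma det_gram_chart_pos {x : M} {y : EuclideanSpace ℝ (Fin (n + 1))}
    (hy : y ∈ (extChartAt (𝓡∂ (n + 1)) x).target) : 0 < (gram n x y).det := by
  have hl := coordVector_linearIndependent hy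
  unfold gram
  generalize coordVector n x y = c at hl ⊢
  exact det_gram_pos (W := TangentSpace (𝓡∂ (n + 1)) ((extChartAt (𝓡∂ (n + 1)) x).symm y)) hl

lemma chartDensity_pos {x : M} {y : EuclideanSpace ℝ (Fin (n + 1))}
    (hy : y ∈ (extChartAt (𝓡∂ (n + 1)) x).target) : 0 < chartDensity n x y :=
  Real.sqrt_pos.2 (det_gram_chart_pos hy)

variable [IsContMDiffRiemannianBundle (𝓡∂ (n + 1)) ∞ (EuclideanSpace ℝ (Fin (n + 1)))
  (fun x : M => TangentSpace (𝓡∂ (n + 1)) x)]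

/-- The coefficients of the metric in a chart are smooth. -/
lemma gram_contDiffOn (x : M) (i j : Fin (n + 1)) :
    ContDiffOn ℝ ∞ (fun y => gram n x y i j) (extChartAt (𝓡∂ (n + 1)) x).target := by
  set t := trivializationAt (EuclideanSpace ℝ (Fin (n + 1)))
      (TangentSpace (𝓡∂ (n + 1)) : M → Type _) x with ht
  have hsec : ∀ i, ContMDiffOn (𝓡∂ (n + 1)) ((𝓡∂ (n + 1)).prod 𝓘(ℝ, EuclideanSpace ℝ (Fin (n + 1))))
      ∞ (fun p : M => (TotalSpace.mk p (t.symmL ℝ p (EuclideanSpace.single i (1 : ℝ))) :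
        TangentBundle (𝓡∂ (n + 1)) M)) (chartAt (EuclideanHalfSpace (n + 1)) x).source := by
    intro i
    have := (t.contMDiffOn_section_baseSet_iff (IB := 𝓡∂ (n + 1)) (n := ∞)
      (s := fun p => t.symmL ℝ p (EuclideanSpace.single i (1 : ℝ)))).2 ?_
    · exact this
    · refine (contMDiffOn_const (c := (EuclideanSpace.single i (1 : ℝ) :
        EuclideanSpace ℝ (Fin (n + 1))))).congr fun p hp => ?_
      simp [hp]
  have h1 := (hsec i).inner_bundle (hsec j)
  have h2 := h1.comp (contMDiffOn_extChartAt_symm (I := 𝓡∂ (n + 1)) (n := ∞) x)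
    fun y hy => by simpa using (extChartAt (𝓡∂ (n + 1)) x).map_target hy
  refine h2.contDiffOn.congr fun y hy => ?_
  simp only [gram, Matrix.of_apply, coordVector_eq_symmL hy]
  rfl

lemma contDiffOn_matrix_det {F : Type*} [NormedAddCommGroup F] [NormedSpace ℝ F] {m : ℕ}
    {A : F → Matrix (Fin m) (Fin m) ℝ} {s : Set F} {k : WithTop ℕ∞}
    (hA : ∀ i j, ContDiffOn ℝ k (fun y => A y i j) s) : ContDiffOn ℝ k (fun y => (A y).det) s := by
  simp only [Matrix.det_apply']
  exact ContDiffOn.sum fun σ _ => contDiffOn_const.mul (contDiffOn_prod fun i _ => hA _ _)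

lemma contDiffOn_matrix_inv {F : Type*} [NormedAddCommGroup F] [NormedSpace ℝ F] {m : ℕ}
    {A : F → Matrix (Fin m) (Fin m) ℝ} {s : Set F} {k : WithTop ℕ∞}
    (hA : ∀ i j, ContDiffOn ℝ k (fun y => A y i j) s) (hdet : ∀ y ∈ s, (A y).det ≠ 0)
    (i j : Fin m) : ContDiffOn ℝ k (fun y => (A y)⁻¹ i j) s := by
  simp only [Matrix.inv_def, Ring.inverse_eq_inv', Matrix.smul_apply, smul_eq_mul,
    Matrix.adjugate_apply]
  refine ((contDiffOn_matrix_det hA).inv hdet).mul (contDiffOn_matrix_det fun a b => ?_)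
  by_cases h : a = j
  · subst h
    simpa using contDiffOn_const
  · simpa [Matrix.updateRow_ne h] using hA a b

lemma chartDensity_contDiffOn (x : M) :
    ContDiffOn ℝ ∞ (chartDensity n x) (extChartAt (𝓡∂ (n + 1)) x).target :=
  (contDiffOn_matrix_det (gram_contDiffOn x)).sqrt fun _ hy => (det_gram_chart_pos hy).ne'

lemma chartGrad_contDiffOn (x : M) {k l : ℕ∞} (hkl : k + 1 ≤ l) {h : M → ℝ}
    (hh : ContMDiff (𝓡∂ (n + 1)) 𝓘(ℝ, ℝ) l h) (i : Fin (n + 1)) :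
    ContDiffOn ℝ k (chartGrad x h i) (extChartAt (𝓡∂ (n + 1)) x).target :=
  ContDiffOn.sum fun j _ => ((contDiffOn_matrix_inv (gram_contDiffOn x)
    (fun _ hy => (det_gram_chart_pos hy).ne') i j).of_le (by exact_mod_cast le_top)).mul
      (contDiffOn_fderivWithin_chart x hkl hh _)

lemma continuous_inner_grad {f h : M → ℝ} (hf : ContMDiff (𝓡∂ (n + 1)) 𝓘(ℝ, ℝ) 1 f)
    (hh : ContMDiff (𝓡∂ (n + 1)) 𝓘(ℝ, ℝ) 1 h) :
    Continuous fun p => inner ℝ (grad n f p) (grad n h p) := by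
  refine continuous_iff_continuousAt.2 fun x => ?_
  have h1 : ContinuousOn (fun y => ∑ i, fderivWithin ℝ (f ∘ (extChartAt (𝓡∂ (n + 1)) x).symm)
      (range (𝓡∂ (n + 1))) y (EuclideanSpace.single i 1) * chartGrad x h i y)
      (extChartAt (𝓡∂ (n + 1)) x).target :=
    continuousOn_finsetSum _ fun i _ =>
      (contDiffOn_fderivWithin_chart x (k := 0) (l := 1) (by simp) hf _).continuousOn.mul
        (chartGrad_contDiffOn x (k := 0) (l := 1) (by simp) hh i).continuousOn
  have h2 := h1.comp (continuousOn_extChartAt x) (extChartAt (𝓡∂ (n + 1)) x).mapsTo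
  refine (h2.congr fun p hp => ?_).continuousAt (extChartAt_source_mem_nhds x)
  have h3 := (extChartAt (𝓡∂ (n + 1)) x).map_source hp
  have h4 := inner_grad_grad_eq h3 (hf.mdifferentiableAt one_ne_zero)
    (hh.mdifferentiableAt one_ne_zero)
  rw [(extChartAt (𝓡∂ (n + 1)) x).left_inv hp] at h4
  exact h4

lemma continuous_norm_grad {f : M → ℝ} (hf : ContMDiff (𝓡∂ (n + 1)) 𝓘(ℝ, ℝ) 1 f) :
    Continuous fun p => ‖grad n f p‖ := by
  have := (continuous_inner_grad hf hf).sqrt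
  simpa only [real_inner_self_eq_norm_sq, Real.sqrt_sq (norm_nonneg _)] using this

end Metric

/-! ### Transition maps -/

section Transition

open scoped Matrix

variable {n : ℕ} {M : Type*} [TopologicalSpace M] [ChartedSpace (EuclideanHalfSpace (n + 1)) M]

/-- The transition map from the chart at `x` to the chart at `x'`. -/
def transition (n : ℕ) {M : Type*} [TopologicalSpace M]
    [ChartedSpace (EuclideanHalfSpace (n + 1)) M] (x x' : M)
    (y : EuclideanSpace ℝ (Fin (n + 1))) : EuclideanSpace ℝ (Fin (n + 1)) :=
  extChartAt (𝓡∂ (n + 1)) x' ((extChartAt (𝓡∂ (n + 1)) x).symm y)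

/-- The derivative of the transition map, within the half-space. -/
def transitionDeriv (n : ℕ) {M : Type*} [TopologicalSpace M]
    [ChartedSpace (EuclideanHalfSpace (n + 1)) M] (x x' : M)
    (y : EuclideanSpace ℝ (Fin (n + 1))) :
    EuclideanSpace ℝ (Fin (n + 1)) →L[ℝ] EuclideanSpace ℝ (Fin (n + 1)) :=
  fderivWithin ℝ (transition n x x') (range (𝓡∂ (n + 1))) y

/-- The Jacobian matrix of the transition map, with the derivative along the `i`-th coordinate in
the `i`-th row. -/
def transitionMatrix (n : ℕ) {M : Type*} [TopologicalSpace M]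
    [ChartedSpace (EuclideanHalfSpace (n + 1)) M] (x x' : M)
    (y : EuclideanSpace ℝ (Fin (n + 1))) : Matrix (Fin (n + 1)) (Fin (n + 1)) ℝ :=
  Matrix.of fun i j => transitionDeriv n x x' y (EuclideanSpace.single i 1) j

lemma transition_zero_nonneg (x x' : M) (y : EuclideanSpace ℝ (Fin (n + 1))) :
    0 ≤ transition n x x' y 0 := by
  have : transition n x x' y ∈ range (𝓡∂ (n + 1)) := by
    simp only [transition, extChartAt_coe]
    exact mem_range_self _
  exact mem_range_model_iff.1 this

lemma det_transitionMatrix (x x' : M) (y : EuclideanSpace ℝ (Fin (n + 1))) :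
    (transitionMatrix n x x' y).det = (transitionDeriv n x x' y).det := by
  rw [ContinuousLinearMap.det,
    ← LinearMap.det_toMatrix (EuclideanSpace.basisFun (Fin (n + 1)) ℝ).toBasis,
    ← Matrix.det_transpose]
  congr 1

variable [IsManifold (𝓡∂ (n + 1)) ∞ M] {x x' : M} {y : EuclideanSpace ℝ (Fin (n + 1))}

lemma transition_hasFDerivWithinAt (hy : y ∈ (extChartAt (𝓡∂ (n + 1)) x).target)
    (hy' : (extChartAt (𝓡∂ (n + 1)) x).symm y ∈ (extChartAt (𝓡∂ (n + 1)) x').source) :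
    HasFDerivWithinAt (transition n x x') (transitionDeriv n x x' y) (range (𝓡∂ (n + 1))) y := by
  have h1 : MDifferentiableAt (𝓡∂ (n + 1)) 𝓘(ℝ, EuclideanSpace ℝ (Fin (n + 1)))
      (extChartAt (𝓡∂ (n + 1)) x') ((extChartAt (𝓡∂ (n + 1)) x).symm y) :=
    mdifferentiableAt_extChartAt (by simpa using hy')
  have h2 := h1.comp_mdifferentiableWithinAt y (mdifferentiableWithinAt_extChartAt_symm hy)
  exact (mdifferentiableWithinAt_iff_differentiableWithinAt.1 h2).hasFDerivWithinAt

lemma transitionDeriv_eq (hy : y ∈ (extChartAt (𝓡∂ (n + 1)) x).target)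
    (hy' : (extChartAt (𝓡∂ (n + 1)) x).symm y ∈ (extChartAt (𝓡∂ (n + 1)) x').source) :
    transitionDeriv n x x' y =
      (mfderiv (𝓡∂ (n + 1)) 𝓘(ℝ, EuclideanSpace ℝ (Fin (n + 1))) (extChartAt (𝓡∂ (n + 1)) x')
        ((extChartAt (𝓡∂ (n + 1)) x).symm y)).comp
      (mfderivWithin 𝓘(ℝ, EuclideanSpace ℝ (Fin (n + 1))) (𝓡∂ (n + 1))
        (extChartAt (𝓡∂ (n + 1)) x).symm (range (𝓡∂ (n + 1))) y) := by
  have h1 : MDifferentiableAt (𝓡∂ (n + 1)) 𝓘(ℝ, EuclideanSpace ℝ (Fin (n + 1)))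
      (extChartAt (𝓡∂ (n + 1)) x') ((extChartAt (𝓡∂ (n + 1)) x).symm y) :=
    mdifferentiableAt_extChartAt (by simpa using hy')
  rw [transitionDeriv, ← mfderivWithin_eq_fderivWithin]
  exact mfderiv_comp_mfderivWithin (I := 𝓘(ℝ, EuclideanSpace ℝ (Fin (n + 1))))
    (I' := 𝓡∂ (n + 1)) (I'' := 𝓘(ℝ, EuclideanSpace ℝ (Fin (n + 1)))) y h1
    (mdifferentiableWithinAt_extChartAt_symm hy)
    ((uniqueMDiffWithinAt_iff_uniqueDiffWithinAt).2
      ((𝓡∂ (n + 1)).uniqueDiffOn y (extChartAt_target_subset_range x hy)))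

lemma transitionDeriv_injective (hy : y ∈ (extChartAt (𝓡∂ (n + 1)) x).target)
    (hy' : (extChartAt (𝓡∂ (n + 1)) x).symm y ∈ (extChartAt (𝓡∂ (n + 1)) x').source) :
    Function.Injective (transitionDeriv n x x' y) := by
  rw [transitionDeriv_eq hy hy']
  exact (isInvertible_mfderiv_extChartAt hy').injective.comp
    (isInvertible_mfderivWithin_extChartAt_symm hy).injective

/-- At a boundary point the derivative of a transition map preserves inward vectors: the zeroth
component of the transition map has a minimum there, relative to the half-space. -/
lemma transitionDeriv_zero_nonneg (hy : y ∈ (extChartAt (𝓡∂ (n + 1)) x).target)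
    (hy' : (extChartAt (𝓡∂ (n + 1)) x).symm y ∈ (extChartAt (𝓡∂ (n + 1)) x').source)
    (h0 : y 0 = 0) {v : EuclideanSpace ℝ (Fin (n + 1))} (hv : 0 ≤ v 0) :
    0 ≤ transitionDeriv n x x' y v 0 := by
  have hτ0 : transition n x x' y 0 = 0 :=
    (extChartAt_mem_boundary_iff hy').1 ((symm_mem_boundary_iff hy).2 h0)
  have hmin : IsLocalMinOn (fun z => transition n x x' z 0) (range (𝓡∂ (n + 1))) y :=
    Eventually.of_forall fun z => by
      simpa only [hτ0] using transition_zero_nonneg x x' z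
  have hd : HasFDerivWithinAt (fun z => transition n x x' z 0)
      ((EuclideanSpace.proj 0 : EuclideanSpace ℝ (Fin (n + 1)) →L[ℝ] ℝ).comp
        (transitionDeriv n x x' y)) (range (𝓡∂ (n + 1))) y :=
    (EuclideanSpace.proj 0 :
      EuclideanSpace ℝ (Fin (n + 1)) →L[ℝ] ℝ).hasFDerivAt.comp_hasFDerivWithinAt
      y (transition_hasFDerivWithinAt hy hy')
  refine hmin.hasFDerivWithinAt_nonneg hd (mem_posTangentConeAt_of_segment_subset ?_)
  refine (𝓡∂ (n + 1)).convex_range.segment_subset (extChartAt_target_subset_range x hy) ?_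
  rw [mem_range_model_iff]
  simpa [h0] using hv

/-- At a boundary point the derivative of a transition map preserves the vectors tangent to the
boundary: both `v` and `-v` are inward in the wide sense. -/
lemma transitionDeriv_zero_eq_zero (hy : y ∈ (extChartAt (𝓡∂ (n + 1)) x).target)
    (hy' : (extChartAt (𝓡∂ (n + 1)) x).symm y ∈ (extChartAt (𝓡∂ (n + 1)) x').source)
    (h0 : y 0 = 0) {v : EuclideanSpace ℝ (Fin (n + 1))} (hv : v 0 = 0) :
    transitionDeriv n x x' y v 0 = 0 := by
  refine le_antisymm ?_ (transitionDeriv_zero_nonneg hy hy' h0 hv.ge)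
  have := transitionDeriv_zero_nonneg hy hy' h0 (v := -v) (by simp [hv])
  simpa using this

/-- The derivative of a transition map is invertible and preserves the vectors tangent to the
boundary, so it maps no transversal vector to a tangent one. -/
lemma transitionDeriv_zero_pos (hy : y ∈ (extChartAt (𝓡∂ (n + 1)) x).target)
    (hy' : (extChartAt (𝓡∂ (n + 1)) x).symm y ∈ (extChartAt (𝓡∂ (n + 1)) x').source)
    (h0 : y 0 = 0) : 0 < transitionDeriv n x x' y (EuclideanSpace.single 0 1) 0 := by
  refine lt_of_le_of_ne (transitionDeriv_zero_nonneg hy hy' h0 (by simp)) fun hz => ?_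
  have hsurj : Function.Surjective (transitionDeriv n x x' y) :=
    (LinearMap.injective_iff_surjective (f := (transitionDeriv n x x' y).toLinearMap)).1
      (transitionDeriv_injective hy hy')
  obtain ⟨v, hv⟩ := hsurj (EuclideanSpace.single 0 1)
  have h1 : v = v 0 • EuclideanSpace.single 0 (1 : ℝ) +
      (v - v 0 • EuclideanSpace.single 0 (1 : ℝ)) := by
    abel
  have h2 : transitionDeriv n x x' y v 0 = 0 := by
    rw [h1, map_add, map_smul]
    simp only [PiLp.add_apply, PiLp.smul_apply, ← hz, smul_zero, zero_add]
    exact transitionDeriv_zero_eq_zero hy hy' h0 (by simp)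
  rw [hv] at h2
  simp at h2

variable [RiemannianBundle (fun x : M => TangentSpace (𝓡∂ (n + 1)) x)]

/-- The transformation rule of the metric under a change of charts. -/
lemma gram_transition (hy : y ∈ (extChartAt (𝓡∂ (n + 1)) x).target)
    (hy' : (extChartAt (𝓡∂ (n + 1)) x).symm y ∈ (extChartAt (𝓡∂ (n + 1)) x').source) :
    gram n x y = transitionMatrix n x x' y * gram n x' (transition n x x' y) *
      (transitionMatrix n x x' y)ᵀ := by
  have hτ : transition n x x' y ∈ (extChartAt (𝓡∂ (n + 1)) x').target :=
    (extChartAt (𝓡∂ (n + 1)) x').map_source hy'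
  set p := (extChartAt (𝓡∂ (n + 1)) x).symm y with hp
  have hp' : (extChartAt (𝓡∂ (n + 1)) x').symm (transition n x x' y) = p :=
    (extChartAt (𝓡∂ (n + 1)) x').left_inv hy'
  set t' := trivializationAt (EuclideanSpace ℝ (Fin (n + 1)))
      (TangentSpace (𝓡∂ (n + 1)) : M → Type _) x' with ht'
  have h1 : gram n x' (transition n x x' y) = Matrix.of fun i j =>
      inner ℝ (t'.symmL ℝ p (EuclideanSpace.single i 1))
        (t'.symmL ℝ p (EuclideanSpace.single j 1)) := by
    rw [← hp']
    ext i j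
    simp only [gram, Matrix.of_apply, coordVector_eq_symmL hτ]
    rfl
  have hb : p ∈ (chartAt (EuclideanHalfSpace (n + 1)) x').source := by simpa using hy'
  have h2 : ∀ i, coordVector n x y i = ∑ j, transitionMatrix n x x' y i j •
      t'.symmL ℝ p (EuclideanSpace.single j 1) := by
    intro i
    have h3 : t'.continuousLinearMapAt ℝ p (coordVector n x y i) =
        transitionDeriv n x x' y (EuclideanSpace.single i 1) := by
      rw [TangentBundle.continuousLinearMapAt_trivializationAt hb, transitionDeriv_eq hy hy']
      rfl
    have h4 := t'.symmL_continuousLinearMapAt (R := ℝ) (b := p) (by simpa [t'] using hb)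
      (coordVector n x y i)
    rw [← h4, h3]
    have h5 : transitionDeriv n x x' y (EuclideanSpace.single i 1) =
        ∑ j, transitionMatrix n x x' y i j • EuclideanSpace.single j (1 : ℝ) := by
      ext k
      simp [transitionMatrix, Finset.sum_apply, Pi.single_apply]
    rw [h5]
    rw [map_sum]
    simp_rw [map_smul]
  rw [h1]
  unfold gram
  generalize coordVector n x y = c at h2
  obtain rfl : c = fun i => ∑ j, transitionMatrix n x x' y i j •
      t'.symmL ℝ p (EuclideanSpace.single j 1) := funext h2
  exact gram_linearCombination (W := TangentSpace (𝓡∂ (n + 1)) p)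
    (fun j => t'.symmL ℝ p (EuclideanSpace.single j 1)) _

end Transition

/-! ### Gluing measures given in charts -/

section Gluing

lemma ContinuousOn.measurableSet_preimage_inter {F X : Type*} [TopologicalSpace F]
    [MeasurableSpace F] [OpensMeasurableSpace F] [TopologicalSpace X] [MeasurableSpace X]
    [BorelSpace X] {Φ : F → X} {S : Set F} (hΦ : ContinuousOn Φ S) (hS : MeasurableSet S)
    {B : Set X} (hB : MeasurableSet B) : MeasurableSet (Φ ⁻¹' B ∩ S) := by
  have h := hS.subtype_image ((continuousOn_iff_continuous_domRestrict.1 hΦ).measurable hB)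
  convert h using 1
  ext y
  simp [and_comm]

/-- If measures on the members of an open cover agree on the overlaps, then their supremum restricts
to each of them. -/
lemma iSup_measure_apply_eq {ι X : Type*} [MeasurableSpace X] {m : ι → Measure X} {U : ι → Set X}
    (hU : ∀ i, MeasurableSet (U i)) (hm : ∀ i, m i (U i)ᶜ = 0) (u : ℕ → ι)
    (hu : ⋃ k, U (u k) = univ)
    (hagree : ∀ i j, ∀ B ⊆ U i ∩ U j, MeasurableSet B → m i B = m j B)
    {i : ι} {B : Set X} (hB : MeasurableSet B) (hBi : B ⊆ U i) : (⨆ i, m i) B = m i B := by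
  set A : ℕ → Set X := disjointed fun k => U (u k) with hA
  have hAm : ∀ k, MeasurableSet (A k) := MeasurableSet.disjointed fun k => hU (u k)
  have hAU : ∀ k, A k ⊆ U (u k) := disjointed_subset _
  have hAun : ⋃ k, A k = univ := by rw [hA, iUnion_disjointed, hu]
  set ν : Measure X := Measure.sum fun k => (m (u k)).restrict (A k) with hν
  have hdec : ∀ i, ∀ C : Set X, MeasurableSet C → m i C = ∑' k, m i (C ∩ A k) := by
    intro i C hC
    rw [← measure_iUnion, ← inter_iUnion, hAun, inter_univ]
    · exact fun a b hab => ((disjoint_disjointed _) hab).mono inter_subset_right inter_subset_right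
    · exact fun k => hC.inter (hAm k)
  have hνC : ∀ C : Set X, MeasurableSet C → ν C = ∑' k, m (u k) (C ∩ A k) := by
    intro C hC
    rw [hν, Measure.sum_apply _ hC]
    exact tsum_congr fun k => Measure.restrict_apply hC
  -- `ν` glues the measures along a partition subordinate to the cover; it dominates all of them,
  -- hence also their supremum, and it agrees with `m i` on `U i`
  have hle : ∀ i, m i ≤ ν := by
    intro i
    refine Measure.le_iff.2 fun C hC => ?_
    rw [hdec i C hC, hνC C hC]
    refine ENNReal.tsum_le_tsum fun k => ?_
    have h1 : m i (C ∩ A k) ≤ m i (C ∩ A k ∩ U i) := by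
      refine (measure_mono (t := (C ∩ A k ∩ U i) ∪ (U i)ᶜ) fun z hz => ?_).trans
        ((measure_union_le _ _).trans (by rw [hm i, add_zero]))
      by_cases hzi : z ∈ U i
      · exact Or.inl ⟨hz, hzi⟩
      · exact Or.inr hzi
    refine h1.trans ?_
    rw [hagree i (u k) _ (fun z hz => ⟨hz.2, hAU k hz.1.2⟩) ((hC.inter (hAm k)).inter (hU i))]
    exact measure_mono inter_subset_left
  refine le_antisymm ((Measure.le_iff.1 (iSup_le hle) B hB).trans ?_)
    (Measure.le_iff.1 (le_iSup m i) B hB)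
  rw [hνC B hB, hdec i B hB]
  exact (ENNReal.tsum_le_tsum fun k => (hagree (u k) i _ (fun z hz => ⟨hAU k hz.2, hBi hz.1⟩)
    (hB.inter (hAm k))).le)

variable {X : Type*} [TopologicalSpace X] [MeasurableSpace X] [BorelSpace X]

lemma map_withDensity_restrict_apply {F : Type*} [TopologicalSpace F] [MeasurableSpace F]
    [OpensMeasurableSpace F] (ν : Measure F) [SFinite ν] {Φ : F → X} {S : Set F}
    (hΦ : ContinuousOn Φ S) (hS : MeasurableSet S) (ρ : F → ℝ≥0∞) {B : Set X}
    (hB : MeasurableSet B) :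
    Measure.map Φ ((ν.restrict S).withDensity ρ) B = ∫⁻ y in Φ ⁻¹' B ∩ S, ρ y ∂ν := by
  rw [Measure.map_apply_of_aemeasurable
    ((hΦ.aemeasurable hS).mono_ac (withDensity_absolutelyContinuous _ _)) hB,
    withDensity_apply', Measure.restrict_restrict' hS]

lemma integrable_map_withDensity_iff {F : Type*} [TopologicalSpace F] [MeasurableSpace F]
    [OpensMeasurableSpace F] {ν : Measure F} {Φ : F → X} {S : Set F}
    (hΦ : ContinuousOn Φ S) (hS : MeasurableSet S) {ρ : F → ℝ} (hρ : ContinuousOn ρ S)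
    (hρ0 : ∀ y ∈ S, 0 ≤ ρ y) {f : X → ℝ}
    (hf : AEStronglyMeasurable f
      (Measure.map Φ ((ν.restrict S).withDensity fun y => ENNReal.ofReal (ρ y)))) :
    Integrable f (Measure.map Φ ((ν.restrict S).withDensity fun y => ENNReal.ofReal (ρ y))) ↔
      IntegrableOn (fun y => ρ y * f (Φ y)) S ν := by
  rw [integrable_map_measure hf
    ((hΦ.aemeasurable hS).mono_ac (withDensity_absolutelyContinuous _ _)),
    integrable_withDensity_iff_integrable_smul₀' (hρ.aemeasurable hS).ennreal_ofReal
      (ae_of_all _ fun _ => ENNReal.ofReal_lt_top)]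
  refine integrable_congr ((ae_restrict_iff' hS).2 (ae_of_all _ fun y hy => ?_))
  simp [ENNReal.toReal_ofReal (hρ0 y hy)]

lemma integral_map_withDensity_eq {F : Type*} [TopologicalSpace F] [MeasurableSpace F]
    [OpensMeasurableSpace F] {ν : Measure F} {Φ : F → X} {S : Set F}
    (hΦ : ContinuousOn Φ S) (hS : MeasurableSet S) {ρ : F → ℝ} (hρ : ContinuousOn ρ S)
    (hρ0 : ∀ y ∈ S, 0 ≤ ρ y) {f : X → ℝ}
    (hf : AEStronglyMeasurable f
      (Measure.map Φ ((ν.restrict S).withDensity fun y => ENNReal.ofReal (ρ y)))) :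
    ∫ p, f p ∂(Measure.map Φ ((ν.restrict S).withDensity fun y => ENNReal.ofReal (ρ y))) =
      ∫ y in S, ρ y * f (Φ y) ∂ν := by
  rw [integral_map ((hΦ.aemeasurable hS).mono_ac (withDensity_absolutelyContinuous _ _)) hf,
    integral_withDensity_eq_integral_toReal_smul₀ (hρ.aemeasurable hS).ennreal_ofReal
      (ae_of_all _ fun _ => ENNReal.ofReal_lt_top)]
  refine setIntegral_congr_fun hS fun y hy => ?_
  simp [ENNReal.toReal_ofReal (hρ0 y hy)]

lemma map_withDensity_ne_zero {F : Type*} [TopologicalSpace F] [MeasurableSpace F]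
    [OpensMeasurableSpace F] {ν : Measure F} [SFinite ν] {Φ : F → X} {S : Set F}
    (hΦ : ContinuousOn Φ S) (hS : MeasurableSet S) {ρ : F → ℝ} (hρ : ContinuousOn ρ S)
    (hρ0 : ∀ y ∈ S, 0 < ρ y) (hνS : ν S ≠ 0) :
    Measure.map Φ ((ν.restrict S).withDensity fun y => ENNReal.ofReal (ρ y)) ≠ 0 := by
  intro h
  have h1 := map_withDensity_restrict_apply ν hΦ hS (fun y => ENNReal.ofReal (ρ y))
    MeasurableSet.univ
  rw [h, Measure.coe_zero, Pi.zero_apply, preimage_univ, univ_inter, eq_comm,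
    lintegral_eq_zero_iff' (hρ.aemeasurable hS).ennreal_ofReal, EventuallyEq,
    ae_restrict_iff' hS] at h1
  refine hνS (measure_mono_null (fun y hy => ?_) h1)
  simpa [hy] using hρ0 y hy

/-- The change of variables formula, for measures given by densities in two charts. -/
lemma map_withDensity_restrict_apply_eq {F : Type*} [NormedAddCommGroup F] [NormedSpace ℝ F]
    [FiniteDimensional ℝ F] [MeasurableSpace F] [BorelSpace F] (ν : Measure F)
    [ν.IsAddHaarMeasure] {Φ Φ' : F → X} {S S' : Set F} (hΦ : ContinuousOn Φ S)
    (hS : MeasurableSet S) (hΦ' : ContinuousOn Φ' S') (hS' : MeasurableSet S')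
    (ρ ρ' : F → ℝ≥0∞) {B : Set X} (hB : MeasurableSet B) (τ τ' : F → F) (dτ : F → F →L[ℝ] F)
    (hτ : MapsTo τ (Φ ⁻¹' B ∩ S) (Φ' ⁻¹' B ∩ S'))
    (hτ' : MapsTo τ' (Φ' ⁻¹' B ∩ S') (Φ ⁻¹' B ∩ S))
    (hl : LeftInvOn τ' τ (Φ ⁻¹' B ∩ S)) (hr : LeftInvOn τ τ' (Φ' ⁻¹' B ∩ S'))
    (hd : ∀ y ∈ Φ ⁻¹' B ∩ S, HasFDerivWithinAt τ (dτ y) (Φ ⁻¹' B ∩ S) y)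
    (hρ : ∀ y ∈ Φ ⁻¹' B ∩ S, ρ y = ENNReal.ofReal |(dτ y).det| * ρ' (τ y)) :
    Measure.map Φ ((ν.restrict S).withDensity ρ) B =
      Measure.map Φ' ((ν.restrict S').withDensity ρ') B := by
  have hm := ContinuousOn.measurableSet_preimage_inter hΦ hS hB
  rw [map_withDensity_restrict_apply ν hΦ hS ρ hB, map_withDensity_restrict_apply ν hΦ' hS' ρ' hB]
  have himg : τ '' (Φ ⁻¹' B ∩ S) = Φ' ⁻¹' B ∩ S' :=
    Subset.antisymm hτ.image_subset fun z hz => ⟨τ' z, hτ' hz, hr hz⟩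
  rw [← himg, lintegral_image_eq_lintegral_abs_det_fderiv_mul ν hm hd hl.injOn]
  exact setLIntegral_congr_fun hm hρ

end Gluing

/-! ### The Riemannian volume measures in charts -/

section Volume

variable {n : ℕ} {M : Type*} [TopologicalSpace M] [ChartedSpace (EuclideanHalfSpace (n + 1)) M]

lemma exists_seq_chart_cover [SecondCountableTopology M] [Nonempty M] :
    ∃ u : ℕ → M, ⋃ k, (extChartAt (𝓡∂ (n + 1)) (u k)).source = univ := by
  obtain ⟨s, hs, hcov⟩ := TopologicalSpace.countable_cover_nhds
    (fun x : M => extChartAt_source_mem_nhds (I := 𝓡∂ (n + 1)) x)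
  have hne : s.Nonempty := by
    rw [nonempty_iff_ne_empty]
    rintro rfl
    simp only [mem_empty_iff_false, iUnion_of_empty, iUnion_empty] at hcov
    exact empty_ne_univ hcov
  obtain ⟨u, rfl⟩ := hs.exists_eq_range hne
  exact ⟨u, by simpa using hcov⟩

variable (n) in
/-- The inclusion of the boundary hyperplane into the half-space, as a continuous linear map. -/
def hyperplaneL : EuclideanSpace ℝ (Fin n) →L[ℝ] EuclideanSpace ℝ (Fin (n + 1)) :=
  LinearMap.toContinuousLinearMap
    { toFun := hyperplane n
      map_add' := fun y z => by
        ext i; refine Fin.cases ?_ (fun j => ?_) i <;> simp [hyperplane]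
      map_smul' := fun c y => by
        ext i; refine Fin.cases ?_ (fun j => ?_) i <;> simp [hyperplane] }

variable (n) in
/-- The projection of the half-space onto the boundary hyperplane. -/
def tailL : EuclideanSpace ℝ (Fin (n + 1)) →L[ℝ] EuclideanSpace ℝ (Fin n) :=
  LinearMap.toContinuousLinearMap
    { toFun := fun y => WithLp.toLp 2 fun i => y i.succ
      map_add' := fun y z => by ext i; simp
      map_smul' := fun c y => by ext i; simp }

@[simp] lemma hyperplane_zero (z : EuclideanSpace ℝ (Fin n)) : hyperplane n z 0 = 0 := rfl

@[simp] lemma hyperplane_succ (z : EuclideanSpace ℝ (Fin n)) (i : Fin n) :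
    hyperplane n z i.succ = z i := rfl

lemma hyperplaneL_apply (z : EuclideanSpace ℝ (Fin n)) : hyperplaneL n z = hyperplane n z := rfl

lemma continuous_hyperplane : Continuous (hyperplane n) := (hyperplaneL n).continuous

@[simp] lemma tailL_apply (y : EuclideanSpace ℝ (Fin (n + 1))) (i : Fin n) :
    tailL n y i = y i.succ := rfl

lemma tailL_hyperplane (z : EuclideanSpace ℝ (Fin n)) : tailL n (hyperplane n z) = z := rfl

lemma hyperplane_tailL {y : EuclideanSpace ℝ (Fin (n + 1))} (hy : y 0 = 0) :
    hyperplane n (tailL n y) = y := by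
  ext i
  refine Fin.cases ?_ (fun j => ?_) i
  · simp [hy]
  · simp

lemma hyperplane_single (i : Fin n) :
    hyperplane n (EuclideanSpace.single i 1) = EuclideanSpace.single i.succ 1 := by
  ext j
  refine Fin.cases ?_ (fun k => ?_) j
  · simp [(Fin.succ_ne_zero i).symm]
  · simp

lemma continuousOn_symm_hyperplane (x : M) :
    ContinuousOn (fun z => (extChartAt (𝓡∂ (n + 1)) x).symm (hyperplane n z))
      (hyperplane n ⁻¹' (extChartAt (𝓡∂ (n + 1)) x).target) :=
  (continuousOn_extChartAt_symm x).comp continuous_hyperplane.continuousOn fun _ hz => hz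

lemma measurableSet_hyperplane_preimage_target (x : M) :
    MeasurableSet (hyperplane n ⁻¹' (extChartAt (𝓡∂ (n + 1)) x).target) :=
  continuous_hyperplane.measurable (measurableSet_extChartAt_target x)

lemma volume_zero_eq_zero :
    volume {y : EuclideanSpace ℝ (Fin (n + 1)) | y 0 = 0} = 0 := by
  refine Measure.addHaar_submodule volume (LinearMap.ker
    (EuclideanSpace.proj 0 : EuclideanSpace ℝ (Fin (n + 1)) →L[ℝ] ℝ).toLinearMap) fun h => ?_
  have : (EuclideanSpace.single 0 1 : EuclideanSpace ℝ (Fin (n + 1))) ∈ LinearMap.ker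
    (EuclideanSpace.proj 0 : EuclideanSpace ℝ (Fin (n + 1)) →L[ℝ] ℝ).toLinearMap := h ▸ trivial
  simp at this

variable [RiemannianBundle (fun x : M => TangentSpace (𝓡∂ (n + 1)) x)]

/-- The density of the volume of the boundary in the chart at `x`. -/
def boundaryDensity (n : ℕ) {M : Type*} [TopologicalSpace M]
    [ChartedSpace (EuclideanHalfSpace (n + 1)) M]
    [RiemannianBundle (fun x : M => TangentSpace (𝓡∂ (n + 1)) x)] (x : M)
    (z : EuclideanSpace ℝ (Fin n)) : ℝ :=
  Real.sqrt ((gram n x (hyperplane n z)).submatrix Fin.succ Fin.succ).det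

/-- The transition map between the charts of the boundary. -/
def boundaryTransition (n : ℕ) {M : Type*} [TopologicalSpace M]
    [ChartedSpace (EuclideanHalfSpace (n + 1)) M] (x x' : M) (z : EuclideanSpace ℝ (Fin n)) :
    EuclideanSpace ℝ (Fin n) :=
  tailL n (transition n x x' (hyperplane n z))

/-- The derivative of the transition map between the charts of the boundary. -/
def boundaryTransitionDeriv (n : ℕ) {M : Type*} [TopologicalSpace M]
    [ChartedSpace (EuclideanHalfSpace (n + 1)) M] (x x' : M) (z : EuclideanSpace ℝ (Fin n)) :
    EuclideanSpace ℝ (Fin n) →L[ℝ] EuclideanSpace ℝ (Fin n) :=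
  (tailL n).comp ((transitionDeriv n x x' (hyperplane n z)).comp (hyperplaneL n))

omit [RiemannianBundle (fun x : M => TangentSpace (𝓡∂ (n + 1)) x)] in
lemma det_submatrix_transitionMatrix (x x' : M) (z : EuclideanSpace ℝ (Fin n)) :
    ((transitionMatrix n x x' (hyperplane n z)).submatrix Fin.succ Fin.succ).det =
      (boundaryTransitionDeriv n x x' z).det := by
  rw [ContinuousLinearMap.det,
    ← LinearMap.det_toMatrix (EuclideanSpace.basisFun (Fin n) ℝ).toBasis,
    ← Matrix.det_transpose]
  congr 1
  ext i j
  simp [LinearMap.toMatrix_apply, transitionMatrix, boundaryTransitionDeriv, hyperplaneL_apply,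
    hyperplane_single]

section Densities

variable [IsManifold (𝓡∂ (n + 1)) ∞ M]

lemma boundaryDensity_pos {x : M} {z : EuclideanSpace ℝ (Fin n)}
    (hz : hyperplane n z ∈ (extChartAt (𝓡∂ (n + 1)) x).target) : 0 < boundaryDensity n x z := by
  refine Real.sqrt_pos.2 ?_
  have hl := (coordVector_linearIndependent hz).comp _ (Fin.succ_injective n)
  unfold gram
  generalize coordVector n x (hyperplane n z) = c at hl ⊢
  exact det_gram_pos
    (W := TangentSpace (𝓡∂ (n + 1)) ((extChartAt (𝓡∂ (n + 1)) x).symm (hyperplane n z))) hl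

lemma boundaryDensity_continuousOn [IsContMDiffRiemannianBundle (𝓡∂ (n + 1)) ∞
    (EuclideanSpace ℝ (Fin (n + 1))) (fun x : M => TangentSpace (𝓡∂ (n + 1)) x)] (x : M) :
    ContinuousOn (boundaryDensity n x) (hyperplane n ⁻¹' (extChartAt (𝓡∂ (n + 1)) x).target) := by
  refine ContinuousOn.sqrt ?_
  have h : ContinuousOn (fun y => ((gram n x y).submatrix Fin.succ Fin.succ).det)
      (extChartAt (𝓡∂ (n + 1)) x).target :=
    (contDiffOn_matrix_det fun i j => gram_contDiffOn x i.succ j.succ).continuousOn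
  exact h.comp continuous_hyperplane.continuousOn fun _ hz => hz

lemma chartDensity_transition {x x' : M} {y : EuclideanSpace ℝ (Fin (n + 1))}
    (hy : y ∈ (extChartAt (𝓡∂ (n + 1)) x).target)
    (hy' : (extChartAt (𝓡∂ (n + 1)) x).symm y ∈ (extChartAt (𝓡∂ (n + 1)) x').source) :
    chartDensity n x y =
      |(transitionDeriv n x x' y).det| * chartDensity n x' (transition n x x' y) := by
  rw [chartDensity, gram_transition hy hy', Matrix.det_mul, Matrix.det_mul, Matrix.det_transpose,
    det_transitionMatrix, mul_right_comm, ← sq, Real.sqrt_mul (sq_nonneg _), Real.sqrt_sq_eq_abs,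
    chartDensity]

lemma boundaryDensity_transition {x x' : M} {z : EuclideanSpace ℝ (Fin n)}
    (hy : hyperplane n z ∈ (extChartAt (𝓡∂ (n + 1)) x).target)
    (hy' : (extChartAt (𝓡∂ (n + 1)) x).symm (hyperplane n z) ∈
      (extChartAt (𝓡∂ (n + 1)) x').source) :
    boundaryDensity n x z =
      |(boundaryTransitionDeriv n x x' z).det| *
        boundaryDensity n x' (boundaryTransition n x x' z) := by
  have h0 : transition n x x' (hyperplane n z) 0 = 0 :=
    (extChartAt_mem_boundary_iff hy').1 ((symm_mem_boundary_iff hy).2 rfl)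
  -- the rows of the Jacobian matrix in the directions tangent to the boundary have no component
  -- in the direction of the zeroth coordinate
  have hP : ∀ i : Fin n, transitionMatrix n x x' (hyperplane n z) i.succ 0 = 0 := fun i =>
    transitionDeriv_zero_eq_zero hy hy' rfl (by simp [(Fin.succ_ne_zero i).symm])
  have hsub : (gram n x (hyperplane n z)).submatrix Fin.succ Fin.succ =
      (transitionMatrix n x x' (hyperplane n z)).submatrix Fin.succ Fin.succ *
      (gram n x' (transition n x x' (hyperplane n z))).submatrix Fin.succ Fin.succ *
      ((transitionMatrix n x x' (hyperplane n z)).submatrix Fin.succ Fin.succ).transpose := by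
    rw [gram_transition hy hy']
    ext i j
    simp only [Matrix.submatrix_apply, Matrix.mul_apply, Matrix.transpose_apply,
      Fin.sum_univ_succ, hP, zero_mul, mul_zero, zero_add]
  rw [boundaryDensity, hsub, Matrix.det_mul, Matrix.det_mul, Matrix.det_transpose,
    det_submatrix_transitionMatrix, mul_right_comm, ← sq, Real.sqrt_mul (sq_nonneg _),
    Real.sqrt_sq_eq_abs, boundaryDensity, boundaryTransition, hyperplane_tailL h0]

end Densities

variable [MeasurableSpace M] [BorelSpace M]

lemma chartVolume_compl_source (x : M) :
    chartVolume n x (extChartAt (𝓡∂ (n + 1)) x).sourceᶜ = 0 := by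
  rw [chartVolume, map_withDensity_restrict_apply volume (continuousOn_extChartAt_symm x)
    (measurableSet_extChartAt_target x) _ (isOpen_extChartAt_source x).measurableSet.compl]
  have : (extChartAt (𝓡∂ (n + 1)) x).symm ⁻¹' (extChartAt (𝓡∂ (n + 1)) x).sourceᶜ ∩
      (extChartAt (𝓡∂ (n + 1)) x).target = ∅ := by
    ext y
    simp only [mem_inter_iff, mem_preimage, mem_compl_iff, mem_empty_iff_false, iff_false, not_and]
    exact fun h hy => h ((extChartAt (𝓡∂ (n + 1)) x).map_target hy)
  rw [this, setLIntegral_empty]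

lemma boundaryChartVolume_compl_source (x : M) :
    boundaryChartVolume n x (extChartAt (𝓡∂ (n + 1)) x).sourceᶜ = 0 := by
  rw [boundaryChartVolume, map_withDensity_restrict_apply volume (continuousOn_symm_hyperplane x)
    (measurableSet_hyperplane_preimage_target x) _ (isOpen_extChartAt_source x).measurableSet.compl]
  have : (fun z => (extChartAt (𝓡∂ (n + 1)) x).symm (hyperplane n z)) ⁻¹'
      (extChartAt (𝓡∂ (n + 1)) x).sourceᶜ ∩
      hyperplane n ⁻¹' (extChartAt (𝓡∂ (n + 1)) x).target = ∅ := by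
    ext z
    simp only [mem_inter_iff, mem_preimage, mem_compl_iff, mem_empty_iff_false, iff_false, not_and]
    exact fun h hz => h ((extChartAt (𝓡∂ (n + 1)) x).map_target hz)
  rw [this, setLIntegral_empty]

variable [IsManifold (𝓡∂ (n + 1)) ∞ M]

/-- The volumes given by two charts agree on the overlap of their domains. -/
lemma chartVolume_apply_eq (x x' : M) {B : Set M} (hB : MeasurableSet B)
    (hBx : B ⊆ (extChartAt (𝓡∂ (n + 1)) x).source ∩ (extChartAt (𝓡∂ (n + 1)) x').source) :
    chartVolume n x B = chartVolume n x' B := by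
  refine map_withDensity_restrict_apply_eq volume (continuousOn_extChartAt_symm x)
    (measurableSet_extChartAt_target x) (continuousOn_extChartAt_symm x')
    (measurableSet_extChartAt_target x') _ _ hB (transition n x x') (transition n x' x)
    (transitionDeriv n x x') ?_ ?_ ?_ ?_ ?_ ?_
  · rintro y ⟨hyB, hy⟩
    refine ⟨?_, (extChartAt (𝓡∂ (n + 1)) x').map_source (hBx hyB).2⟩
    rw [mem_preimage, transition, (extChartAt (𝓡∂ (n + 1)) x').left_inv (hBx hyB).2]
    exact hyB
  · rintro y ⟨hyB, hy⟩
    refine ⟨?_, (extChartAt (𝓡∂ (n + 1)) x).map_source (hBx hyB).1⟩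
    rw [mem_preimage, transition, (extChartAt (𝓡∂ (n + 1)) x).left_inv (hBx hyB).1]
    exact hyB
  · rintro y ⟨hyB, hy⟩
    rw [transition, transition, (extChartAt (𝓡∂ (n + 1)) x').left_inv (hBx hyB).2,
      (extChartAt (𝓡∂ (n + 1)) x).right_inv hy]
  · rintro y ⟨hyB, hy⟩
    rw [transition, transition, (extChartAt (𝓡∂ (n + 1)) x).left_inv (hBx hyB).1,
      (extChartAt (𝓡∂ (n + 1)) x').right_inv hy]
  · rintro y ⟨hyB, hy⟩
    exact (transition_hasFDerivWithinAt hy (hBx hyB).2).mono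
      (inter_subset_right.trans (extChartAt_target_subset_range x))
  · rintro y ⟨hyB, hy⟩
    rw [← ENNReal.ofReal_mul (abs_nonneg _)]
    exact congrArg ENNReal.ofReal (chartDensity_transition hy (hBx hyB).2)

/-- The boundary volumes given by two charts agree on the overlap of their domains. The charts of
the boundary are the restrictions of those of the manifold to the hyperplane `y 0 = 0`, which the
transition maps preserve. -/
lemma boundaryChartVolume_apply_eq (x x' : M) {B : Set M} (hB : MeasurableSet B)
    (hBx : B ⊆ (extChartAt (𝓡∂ (n + 1)) x).source ∩ (extChartAt (𝓡∂ (n + 1)) x').source) :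
    boundaryChartVolume n x B = boundaryChartVolume n x' B := by
  have h0 : ∀ x x' : M, ∀ z, hyperplane n z ∈ (extChartAt (𝓡∂ (n + 1)) x).target →
      (extChartAt (𝓡∂ (n + 1)) x).symm (hyperplane n z) ∈ (extChartAt (𝓡∂ (n + 1)) x').source →
      hyperplane n (boundaryTransition n x x' z) = transition n x x' (hyperplane n z) :=
    fun x x' z hz hz' => hyperplane_tailL
      ((extChartAt_mem_boundary_iff hz').1 ((symm_mem_boundary_iff hz).2 rfl))
  have hmaps : ∀ x x' : M, ∀ z, (extChartAt (𝓡∂ (n + 1)) x).symm (hyperplane n z) ∈ B →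
      B ⊆ (extChartAt (𝓡∂ (n + 1)) x').source →
      hyperplane n z ∈ (extChartAt (𝓡∂ (n + 1)) x).target →
      ((extChartAt (𝓡∂ (n + 1)) x').symm (hyperplane n (boundaryTransition n x x' z)) =
        (extChartAt (𝓡∂ (n + 1)) x).symm (hyperplane n z)) ∧
      hyperplane n (boundaryTransition n x x' z) ∈ (extChartAt (𝓡∂ (n + 1)) x').target := by
    intro x x' z hzB hBx' hz
    rw [h0 x x' z hz (hBx' hzB), transition]
    exact ⟨(extChartAt (𝓡∂ (n + 1)) x').left_inv (hBx' hzB),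
      (extChartAt (𝓡∂ (n + 1)) x').map_source (hBx' hzB)⟩
  have hinv : ∀ x x' : M, ∀ z, (extChartAt (𝓡∂ (n + 1)) x).symm (hyperplane n z) ∈ B →
      B ⊆ (extChartAt (𝓡∂ (n + 1)) x').source →
      hyperplane n z ∈ (extChartAt (𝓡∂ (n + 1)) x).target →
      boundaryTransition n x' x (boundaryTransition n x x' z) = z := by
    intro x x' z hzB hBx' hz
    rw [boundaryTransition, transition, (hmaps x x' z hzB hBx' hz).1,
      (extChartAt (𝓡∂ (n + 1)) x).right_inv hz, tailL_hyperplane]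
  have hBx1 : B ⊆ (extChartAt (𝓡∂ (n + 1)) x).source := fun _ h => (hBx h).1
  have hBx2 : B ⊆ (extChartAt (𝓡∂ (n + 1)) x').source := fun _ h => (hBx h).2
  refine map_withDensity_restrict_apply_eq volume (continuousOn_symm_hyperplane x)
    (measurableSet_hyperplane_preimage_target x) (continuousOn_symm_hyperplane x')
    (measurableSet_hyperplane_preimage_target x') _ _ hB (boundaryTransition n x x')
    (boundaryTransition n x' x) (boundaryTransitionDeriv n x x') ?_ ?_ ?_ ?_ ?_ ?_
  · rintro z ⟨hzB, hz⟩
    obtain ⟨h1, h2⟩ := hmaps x x' z hzB hBx2 hz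
    exact ⟨by rw [mem_preimage, h1]; exact hzB, h2⟩
  · rintro z ⟨hzB, hz⟩
    obtain ⟨h1, h2⟩ := hmaps x' x z hzB hBx1 hz
    exact ⟨by rw [mem_preimage, h1]; exact hzB, h2⟩
  · exact fun z hz => hinv x x' z hz.1 hBx2 hz.2
  · exact fun z hz => hinv x' x z hz.1 hBx1 hz.2
  · rintro z ⟨hzB, hz⟩
    have h1 := transition_hasFDerivWithinAt hz (hBx2 hzB)
    have h2 := h1.comp z ((hyperplaneL n).hasFDerivWithinAt
      (s := (fun z => (extChartAt (𝓡∂ (n + 1)) x).symm (hyperplane n z)) ⁻¹' B ∩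
        hyperplane n ⁻¹' (extChartAt (𝓡∂ (n + 1)) x).target))
      fun w _ => mem_range_model_iff.2 (le_refl (0 : ℝ))
    exact (tailL n).hasFDerivAt.comp_hasFDerivWithinAt z h2
  · rintro z ⟨hzB, hz⟩
    rw [← ENNReal.ofReal_mul (abs_nonneg _)]
    exact congrArg ENNReal.ofReal (boundaryDensity_transition hz (hBx2 hzB))

lemma boundaryChartVolume_compl_boundary (x : M) :
    boundaryChartVolume n x ((𝓡∂ (n + 1)).boundary M)ᶜ = 0 := by
  rw [boundaryChartVolume, map_withDensity_restrict_apply volume (continuousOn_symm_hyperplane x)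
    (measurableSet_hyperplane_preimage_target x) _ isClosed_boundary.measurableSet.compl]
  have : (fun z => (extChartAt (𝓡∂ (n + 1)) x).symm (hyperplane n z)) ⁻¹'
      ((𝓡∂ (n + 1)).boundary M)ᶜ ∩
      hyperplane n ⁻¹' (extChartAt (𝓡∂ (n + 1)) x).target = ∅ := by
    ext z
    simp only [mem_inter_iff, mem_preimage, mem_compl_iff, mem_empty_iff_false, iff_false, not_and]
    exact fun h hz => h ((symm_mem_boundary_iff hz).2 rfl)
  rw [this, setLIntegral_empty]

lemma boundaryMeasure_compl_boundary :
    boundaryMeasure n M ((𝓡∂ (n + 1)).boundary M)ᶜ = 0 := by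
  have h : boundaryMeasure n M ≤
      (boundaryMeasure n M).restrict ((𝓡∂ (n + 1)).boundary M) := by
    refine iSup_le fun x => ?_
    have h1 : boundaryChartVolume n x =
        (boundaryChartVolume n x).restrict ((𝓡∂ (n + 1)).boundary M) :=
      (Measure.restrict_eq_self_of_ae_mem
        (mem_ae_iff.2 (boundaryChartVolume_compl_boundary x))).symm
    rw [h1]
    exact Measure.restrict_mono subset_rfl (le_iSup (boundaryChartVolume n) x)
  refine le_antisymm ((h _).trans ?_) zero_le
  rw [Measure.restrict_apply isClosed_boundary.measurableSet.compl]
  simp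

variable [SecondCountableTopology M]

/-- The volume measure, defined as a supremum over all charts, has the usual expression in each of
them. -/
lemma volumeMeasure_restrict_source (x : M) :
    (volumeMeasure n M).restrict (extChartAt (𝓡∂ (n + 1)) x).source = chartVolume n x := by
  have : Nonempty M := ⟨x⟩
  obtain ⟨u, hu⟩ := exists_seq_chart_cover (n := n) (M := M)
  have hs : ∀ x : M, MeasurableSet (extChartAt (𝓡∂ (n + 1)) x).source := fun x =>
    (isOpen_extChartAt_source x).measurableSet
  ext B hB
  rw [Measure.restrict_apply hB, volumeMeasure, iSup_measure_apply_eq hs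
    chartVolume_compl_source u hu (fun x x' B hBx hB => chartVolume_apply_eq x x' hB hBx)
    (hB.inter (hs x)) inter_subset_right]
  exact measure_inter_conull (chartVolume_compl_source x)

lemma boundaryMeasure_restrict_source (x : M) :
    (boundaryMeasure n M).restrict (extChartAt (𝓡∂ (n + 1)) x).source =
      boundaryChartVolume n x := by
  have : Nonempty M := ⟨x⟩
  obtain ⟨u, hu⟩ := exists_seq_chart_cover (n := n) (M := M)
  have hs : ∀ x : M, MeasurableSet (extChartAt (𝓡∂ (n + 1)) x).source := fun x =>
    (isOpen_extChartAt_source x).measurableSet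
  ext B hB
  rw [Measure.restrict_apply hB, boundaryMeasure, iSup_measure_apply_eq hs
    boundaryChartVolume_compl_source u hu
    (fun x x' B hBx hB => boundaryChartVolume_apply_eq x x' hB hBx)
    (hB.inter (hs x)) inter_subset_right]
  exact measure_inter_conull (boundaryChartVolume_compl_source x)

variable [IsContMDiffRiemannianBundle (𝓡∂ (n + 1)) ∞ (EuclideanSpace ℝ (Fin (n + 1)))
  (fun x : M => TangentSpace (𝓡∂ (n + 1)) x)]

lemma integrableOn_source_iff (x : M) {f : M → ℝ}
    (hf : AEStronglyMeasurable f
      ((volumeMeasure n M).restrict (extChartAt (𝓡∂ (n + 1)) x).source)) :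
    IntegrableOn f (extChartAt (𝓡∂ (n + 1)) x).source (volumeMeasure n M) ↔
      IntegrableOn (fun y => chartDensity n x y * f ((extChartAt (𝓡∂ (n + 1)) x).symm y))
        (extChartAt (𝓡∂ (n + 1)) x).target := by
  rw [volumeMeasure_restrict_source] at hf
  rw [IntegrableOn, volumeMeasure_restrict_source]
  exact integrable_map_withDensity_iff (continuousOn_extChartAt_symm x)
    (measurableSet_extChartAt_target x) (chartDensity_contDiffOn x).continuousOn
    (fun y hy => (chartDensity_pos hy).le) hf

lemma setIntegral_source_eq (x : M) {f : M → ℝ}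
    (hf : AEStronglyMeasurable f
      ((volumeMeasure n M).restrict (extChartAt (𝓡∂ (n + 1)) x).source)) :
    ∫ p in (extChartAt (𝓡∂ (n + 1)) x).source, f p ∂(volumeMeasure n M) =
      ∫ y in (extChartAt (𝓡∂ (n + 1)) x).target,
        chartDensity n x y * f ((extChartAt (𝓡∂ (n + 1)) x).symm y) := by
  rw [volumeMeasure_restrict_source] at hf
  rw [volumeMeasure_restrict_source]
  exact integral_map_withDensity_eq (continuousOn_extChartAt_symm x)
    (measurableSet_extChartAt_target x) (chartDensity_contDiffOn x).continuousOn
    (fun y hy => (chartDensity_pos hy).le) hf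

lemma integrableOn_boundary_source_iff (x : M) {f : M → ℝ}
    (hf : AEStronglyMeasurable f
      ((boundaryMeasure n M).restrict (extChartAt (𝓡∂ (n + 1)) x).source)) :
    IntegrableOn f (extChartAt (𝓡∂ (n + 1)) x).source (boundaryMeasure n M) ↔
      IntegrableOn (fun z => boundaryDensity n x z *
        f ((extChartAt (𝓡∂ (n + 1)) x).symm (hyperplane n z)))
        (hyperplane n ⁻¹' (extChartAt (𝓡∂ (n + 1)) x).target) := by
  rw [boundaryMeasure_restrict_source] at hf
  rw [IntegrableOn, boundaryMeasure_restrict_source]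
  exact integrable_map_withDensity_iff (continuousOn_symm_hyperplane x)
    (measurableSet_hyperplane_preimage_target x) (boundaryDensity_continuousOn x)
    (fun y hy => (boundaryDensity_pos hy).le) hf

lemma setIntegral_boundary_source_eq (x : M) {f : M → ℝ}
    (hf : AEStronglyMeasurable f
      ((boundaryMeasure n M).restrict (extChartAt (𝓡∂ (n + 1)) x).source)) :
    ∫ p in (extChartAt (𝓡∂ (n + 1)) x).source, f p ∂(boundaryMeasure n M) =
      ∫ z in hyperplane n ⁻¹' (extChartAt (𝓡∂ (n + 1)) x).target,
        boundaryDensity n x z * f ((extChartAt (𝓡∂ (n + 1)) x).symm (hyperplane n z)) := by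
  rw [boundaryMeasure_restrict_source] at hf
  rw [boundaryMeasure_restrict_source]
  exact integral_map_withDensity_eq (continuousOn_symm_hyperplane x)
    (measurableSet_hyperplane_preimage_target x) (boundaryDensity_continuousOn x)
    (fun y hy => (boundaryDensity_pos hy).le) hf

omit [SecondCountableTopology M] in
lemma volumeMeasure_ne_zero [Nonempty M] : volumeMeasure n M ≠ 0 := by
  obtain ⟨x⟩ := ‹Nonempty M›
  intro h
  refine map_withDensity_ne_zero (ν := volume) (continuousOn_extChartAt_symm x)
    (measurableSet_extChartAt_target x) (chartDensity_contDiffOn x).continuousOn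
    (fun y hy => chartDensity_pos hy) ?_
    (le_antisymm ((le_iSup (chartVolume n) x).trans h.le) (Measure.zero_le _))
  obtain ⟨O, hO, hT⟩ := exists_isOpen_target_eq (n := n) x
  have hx := mem_extChartAt_target (I := 𝓡∂ (n + 1)) x
  rw [hT] at hx ⊢
  have hcl : extChartAt (𝓡∂ (n + 1)) x x ∈ closure (interior (range (𝓡∂ (n + 1)))) :=
    (𝓡∂ (n + 1)).range_subset_closure_interior (extChartAt_target_subset_range x
      (mem_extChartAt_target x))
  obtain ⟨y, hyO, hy⟩ := mem_closure_iff.1 hcl O hO hx.1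
  have hne : (O ∩ interior (range (𝓡∂ (n + 1)))).Nonempty := ⟨y, hyO, hy⟩
  have hpos := (hO.inter isOpen_interior).measure_pos volume hne
  have hsub : O ∩ interior (range (𝓡∂ (n + 1))) ⊆
      O ∩ {y : EuclideanSpace ℝ (Fin (n + 1)) | 0 ≤ y 0} := fun z hz =>
    ⟨hz.1, mem_range_model_iff.1 (interior_subset hz.2)⟩
  exact (hpos.trans_le (measure_mono hsub)).ne'

omit [SecondCountableTopology M] in
lemma boundaryMeasure_ne_zero (hb : ((𝓡∂ (n + 1)).boundary M).Nonempty) :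
    boundaryMeasure n M ≠ 0 := by
  obtain ⟨x, hx⟩ := hb
  intro h
  refine map_withDensity_ne_zero (ν := volume) (continuousOn_symm_hyperplane x)
    (measurableSet_hyperplane_preimage_target x) (boundaryDensity_continuousOn x)
    (fun y hy => boundaryDensity_pos hy) ?_
    (le_antisymm ((le_iSup (boundaryChartVolume n) x).trans h.le) (Measure.zero_le _))
  obtain ⟨O, hO, hT⟩ := exists_isOpen_target_eq (n := n) x
  have hT' : hyperplane n ⁻¹' (extChartAt (𝓡∂ (n + 1)) x).target = hyperplane n ⁻¹' O := by
    rw [hT]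
    exact Subset.antisymm (fun z hz => hz.1) fun z hz => ⟨hz, le_refl (0 : ℝ)⟩
  have h0 := (extChartAt_mem_boundary_iff (mem_extChartAt_source x)).1 hx
  have hxT := mem_extChartAt_target (I := 𝓡∂ (n + 1)) x
  rw [hT']
  rw [hT] at hxT
  refine ((hO.preimage continuous_hyperplane).measure_pos volume
    ⟨tailL n (extChartAt (𝓡∂ (n + 1)) x x), ?_⟩).ne'
  rw [mem_preimage, hyperplane_tailL h0]
  exact hxT.1

end Volume

/-! ### The normal derivative in a chart -/

section Normal

/-- If `b` is a positive multiple of `k`, then the normalised vectors dual to `b` and to `k` agree.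
Hence, if `l` takes the value `1` on that vector, then `k` takes the value `‖k‖` on the vector dual
to `l`. It is applied to the differentials `b`, `k` of the zeroth coordinates of two charts at a
boundary point and to `l = dh`. -/
lemma apply_toDual_symm_of_normal {W : Type*} [NormedAddCommGroup W] [InnerProductSpace ℝ W]
    [CompleteSpace W] {b k l : W →L[ℝ] ℝ} {c : ℝ} (hc : 0 < c) (hbk : b = c • k)
    (hl : l (‖(InnerProductSpace.toDual ℝ W).symm b‖⁻¹ • (InnerProductSpace.toDual ℝ W).symm b)
      = 1) :
    k ((InnerProductSpace.toDual ℝ W).symm l) = ‖k‖ := by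
  have h1 : l ((InnerProductSpace.toDual ℝ W).symm b) =
      b ((InnerProductSpace.toDual ℝ W).symm l) := by
    rw [← InnerProductSpace.toDual_symm_apply (y := l), real_inner_comm,
      InnerProductSpace.toDual_symm_apply]
  rw [map_smul, h1, LinearIsometryEquiv.norm_map, hbk, norm_smul, Real.norm_of_nonneg hc.le,
    smul_eq_mul, smul_apply, smul_eq_mul] at hl
  have hk : ‖k‖ ≠ 0 := by
    rintro h
    rw [h, mul_zero, inv_zero, zero_mul] at hl
    exact zero_ne_one hl
  field_simp at hl
  exact hl

variable {n : ℕ} {M : Type*} [TopologicalSpace M] [ChartedSpace (EuclideanHalfSpace (n + 1)) M]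
  [IsManifold (𝓡∂ (n + 1)) ∞ M]

/-- The differential of the zeroth coordinate of one chart along the coordinate fields of another
one. -/
lemma differential_zero_coordVector {x x' : M} {y : EuclideanSpace ℝ (Fin (n + 1))}
    (hy : y ∈ (extChartAt (𝓡∂ (n + 1)) x).target)
    (hy' : (extChartAt (𝓡∂ (n + 1)) x).symm y ∈ (extChartAt (𝓡∂ (n + 1)) x').source)
    (i : Fin (n + 1)) :
    differential n (fun q : M => extChartAt (𝓡∂ (n + 1)) x' q 0) _ (coordVector n x y i) =
      transitionDeriv n x x' y (EuclideanSpace.single i 1) 0 := by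
  have h1 : MDifferentiableAt (𝓡∂ (n + 1)) 𝓘(ℝ, ℝ)
      (fun q : M => extChartAt (𝓡∂ (n + 1)) x' q 0) ((extChartAt (𝓡∂ (n + 1)) x).symm y) :=
    ((EuclideanSpace.proj 0 : EuclideanSpace ℝ (Fin (n + 1)) →L[ℝ] ℝ).differentiableAt
      |>.mdifferentiableAt).comp _ (mdifferentiableAt_extChartAt (by simpa using hy'))
  rw [differential_coordVector hy h1]
  have hd : HasFDerivWithinAt (fun z => transition n x x' z 0)
      ((EuclideanSpace.proj 0 : EuclideanSpace ℝ (Fin (n + 1)) →L[ℝ] ℝ).comp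
        (transitionDeriv n x x' y)) (range (𝓡∂ (n + 1))) y :=
    (EuclideanSpace.proj 0 :
      EuclideanSpace ℝ (Fin (n + 1)) →L[ℝ] ℝ).hasFDerivAt.comp_hasFDerivWithinAt
      y (transition_hasFDerivWithinAt hy hy')
  have h2 := hd.fderivWithin ((𝓡∂ (n + 1)).uniqueDiffOn y (extChartAt_target_subset_range x hy))
  exact congrArg (fun L => L (EuclideanSpace.single i 1)) h2

omit [IsManifold (𝓡∂ (n + 1)) ∞ M] in
lemma transitionDeriv_self {x : M} {y : EuclideanSpace ℝ (Fin (n + 1))}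
    (hy : y ∈ (extChartAt (𝓡∂ (n + 1)) x).target) :
    transitionDeriv n x x y = ContinuousLinearMap.id ℝ _ := by
  have hu := (𝓡∂ (n + 1)).uniqueDiffOn y (extChartAt_target_subset_range x hy)
  rw [transitionDeriv, ← fderivWithin_id hu]
  refine Filter.EventuallyEq.fderivWithin_eq ?_ ((extChartAt (𝓡∂ (n + 1)) x).right_inv hy)
  filter_upwards [extChartAt_target_mem_nhdsWithin_of_mem hy] with z hz
  exact (extChartAt (𝓡∂ (n + 1)) x).right_inv hz

variable [RiemannianBundle (fun x : M => TangentSpace (𝓡∂ (n + 1)) x)]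

/-- If `N h = 1` at a boundary point, then the zeroth component of the flux density
`(det g)^{1/2} ∇h` in any chart is the density of the volume of the boundary. -/
lemma chartDensity_mul_chartGrad_zero {x : M} {z : EuclideanSpace ℝ (Fin n)}
    (hz : hyperplane n z ∈ (extChartAt (𝓡∂ (n + 1)) x).target) {h : M → ℝ}
    (hh : MDifferentiableAt (𝓡∂ (n + 1)) 𝓘(ℝ, ℝ) h
      ((extChartAt (𝓡∂ (n + 1)) x).symm (hyperplane n z)))
    (hN : differential n h ((extChartAt (𝓡∂ (n + 1)) x).symm (hyperplane n z))
      (inwardNormal n ((extChartAt (𝓡∂ (n + 1)) x).symm (hyperplane n z))) = 1) :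
    chartDensity n x (hyperplane n z) * chartGrad x h 0 (hyperplane n z) =
      boundaryDensity n x z := by
  set y := hyperplane n z with hy
  set p := (extChartAt (𝓡∂ (n + 1)) x).symm y with hp
  have hpx : p ∈ (extChartAt (𝓡∂ (n + 1)) x).source := (extChartAt (𝓡∂ (n + 1)) x).map_target hz
  have hpp : p ∈ (extChartAt (𝓡∂ (n + 1)) p).source := mem_extChartAt_source p
  set k : TangentSpace (𝓡∂ (n + 1)) p →L[ℝ] ℝ :=
    differential n (fun q : M => extChartAt (𝓡∂ (n + 1)) x q 0) p with hk
  have hk0 : k (coordVector n x y 0) = 1 := by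
    rw [hk, differential_zero_coordVector hz hpx, transitionDeriv_self hz]
    simp
  have hks : ∀ i : Fin n, k (coordVector n x y i.succ) = 0 := fun i => by
    rw [hk, differential_zero_coordVector hz hpx, transitionDeriv_self hz]
    simp [(Fin.succ_ne_zero i).symm]
  set c := transitionDeriv n x p y (EuclideanSpace.single 0 1) 0 with hc
  have hcpos : 0 < c := transitionDeriv_zero_pos hz hpp rfl
  -- the normal is defined by the chart at `p`; its covector is a positive multiple of the one of
  -- the chart at `x`
  have hω : boundaryCovector n p = c • k := by
    refine ContinuousLinearMap.coe_injective (LinearMap.ext_on_range (v := coordVector n x y)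
      (top_le_iff.1 (coordVector_span hz)) fun i => ?_)
    have h1 : boundaryCovector n p (coordVector n x y i) = _ :=
      differential_zero_coordVector hz hpp i
    show boundaryCovector n p (coordVector n x y i) = c * k (coordVector n x y i)
    rw [h1]
    refine Fin.cases ?_ (fun j => ?_) i
    · rw [hk0, mul_one]
    · rw [hks, mul_zero]
      exact transitionDeriv_zero_eq_zero hz hpp rfl (by simp [(Fin.succ_ne_zero j).symm])
  have h1 : k (grad n h p) = ‖k‖ :=
    apply_toDual_symm_of_normal (W := TangentSpace (𝓡∂ (n + 1)) p) hcpos hω hN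
  have h2 : k (grad n h p) = chartGrad x h 0 y := by
    rw [hp, apply_grad_eq hz k hh, Fin.sum_univ_succ, Finset.sum_eq_zero, hk0, one_mul, add_zero]
    intro i _
    rw [hks, zero_mul]
  have h3 : ((gram n x y).submatrix Fin.succ Fin.succ).det = ‖k‖ ^ 2 * (gram n x y).det := by
    have hl := coordVector_linearIndependent hz
    have hs := coordVector_span hz
    unfold gram
    generalize coordVector n x y = c at hl hs hk0 hks ⊢
    exact det_submatrix_gram (W := TangentSpace (𝓡∂ (n + 1)) p) hl hs k hk0 hks
  have h4 : 0 ≤ ‖k‖ := norm_nonneg k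
  rw [← h2, h1, boundaryDensity, h3]
  generalize ‖k‖ = m at h4
  rw [Real.sqrt_mul (sq_nonneg _), Real.sqrt_sq h4, mul_comm, chartDensity]

end Normal

/-! ### Green's inequality in a chart -/

section Extension

/-- A function that is smooth on a relatively open subset of `H` and vanishes there off a closed set
extends by zero to a smooth function on `H`. -/
lemma contDiffOn_of_eq_zero_off {F : Type*} [NormedAddCommGroup F] [NormedSpace ℝ F]
    {k : WithTop ℕ∞} {O H K : Set F} (hO : IsOpen O) (hK : IsClosed K) (hKO : K ⊆ O)
    {g G : F → ℝ} (hg : ContDiffOn ℝ k g (O ∩ H)) (hG : ∀ y ∈ O ∩ H, G y = g y)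
    (hG0 : ∀ y ∈ H, y ∉ K → G y = 0) : ContDiffOn ℝ k G H := by
  intro y hy
  by_cases hyO : y ∈ O
  · have h1 := (hg y ⟨hyO, hy⟩).congr hG (hG y ⟨hyO, hy⟩)
    rw [inter_comm] at h1
    exact (contDiffWithinAt_inter (hO.mem_nhds hyO)).1 h1
  · refine (contDiffWithinAt_const (c := (0 : ℝ))).congr_of_eventuallyEq ?_
      (hG0 y hy fun h => hyO (hKO h))
    filter_upwards [mem_nhdsWithin_of_mem_nhds (hK.isOpen_compl.mem_nhds fun h => hyO (hKO h)),
      self_mem_nhdsWithin] with z hz hzH using hG0 z hzH hz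

end Extension

section Green

variable {n : ℕ}

/-- The half-space inequality for the divergence, on Euclidean space. -/
lemma integral_hyperplane_le_of_neg_divergence_le
    {X : Fin (n + 1) → EuclideanSpace ℝ (Fin (n + 1)) → ℝ} {b : EuclideanSpace ℝ (Fin (n + 1)) → ℝ}
    {R : ℝ} (hsupp : ∀ i y, (∃ j, R ≤ |y j|) → X i y = 0)
    (hcont : ContinuousOn (X 0) {y | 0 ≤ y 0})
    (hC1 : ∀ i, ContDiffOn ℝ 1 (X i) {y | 0 < y 0})
    (hb : IntegrableOn b {y | 0 < y 0})
    (hdiv : ∀ y, 0 < y 0 → -∑ i, fderiv ℝ (X i) y (EuclideanSpace.single i 1) ≤ b y) :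
    ∫ z : EuclideanSpace ℝ (Fin n), X 0 (hyperplane n z) ≤
      ∫ y in {y : EuclideanSpace ℝ (Fin (n + 1)) | 0 < y 0}, b y := by
  set e : (Fin (n + 1) → ℝ) ≃L[ℝ] EuclideanSpace ℝ (Fin (n + 1)) :=
    (EuclideanSpace.equiv (Fin (n + 1)) ℝ).symm with he
  have heq : ∀ y, e y = WithLp.toLp 2 y := fun y => rfl
  have hmp : MeasurePreserving e := PiLp.volume_preserving_toLp (Fin (n + 1))
  have hme : MeasurableEmbedding e := e.toHomeomorph.measurableEmbedding
  have hmp' : MeasurePreserving (WithLp.toLp 2 : (Fin n → ℝ) → EuclideanSpace ℝ (Fin n)) :=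
    PiLp.volume_preserving_toLp (Fin n)
  have hme' : MeasurableEmbedding (WithLp.toLp 2 : (Fin n → ℝ) → EuclideanSpace ℝ (Fin n)) :=
    (EuclideanSpace.equiv (Fin n) ℝ).symm.toHomeomorph.measurableEmbedding
  have key := integral_boundary_le_of_neg_divergence_le (X := fun i y => X i (e y))
    (b := fun y => b (e y)) (R := R) (fun i y hy => hsupp i (e y) hy)
    (hcont.comp e.continuous.continuousOn fun y hy => hy)
    (fun i => (hC1 i).comp e.contDiff.contDiffOn fun y hy => hy)
    ((hmp.integrableOn_comp_preimage hme).2 hb) (fun y hy => ?_)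
  · rw [← hmp.setIntegral_preimage_emb hme b, ← hmp'.integral_comp hme']
    exact key
  · refine le_trans (le_of_eq ?_) (hdiv (e y) hy)
    refine congrArg Neg.neg (Finset.sum_congr rfl fun i _ => ?_)
    have h1 := e.comp_right_fderiv (f := X i) (x := y)
    have h2 := congrArg (fun L => L (Pi.single i (1 : ℝ))) h1
    exact h2

variable {M : Type*} [TopologicalSpace M] [ChartedSpace (EuclideanHalfSpace (n + 1)) M]
  [IsManifold (𝓡∂ (n + 1)) ∞ M] [RiemannianBundle (fun x : M => TangentSpace (𝓡∂ (n + 1)) x)]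
  [IsContMDiffRiemannianBundle (𝓡∂ (n + 1)) ∞ (EuclideanSpace ℝ (Fin (n + 1)))
    (fun x : M => TangentSpace (𝓡∂ (n + 1)) x)]

/-- The divergence of the flux density `w (det g)^{1/2} ∇h` in a chart. -/
lemma sum_fderiv_flux {x : M} {y : EuclideanSpace ℝ (Fin (n + 1))}
    (hy : y ∈ (extChartAt (𝓡∂ (n + 1)) x).target) (hy0 : 0 < y 0) {w h : M → ℝ}
    (hw : ContMDiffOn (𝓡∂ (n + 1)) 𝓘(ℝ, ℝ) 1 w ((𝓡∂ (n + 1)).interior M))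
    (hh : ContMDiff (𝓡∂ (n + 1)) 𝓘(ℝ, ℝ) 2 h) :
    ∑ i, fderiv ℝ (fun z => w ((extChartAt (𝓡∂ (n + 1)) x).symm z) *
        (chartDensity n x z * chartGrad x h i z)) y (EuclideanSpace.single i 1) =
      chartDensity n x y * (inner ℝ (grad n w ((extChartAt (𝓡∂ (n + 1)) x).symm y))
          (grad n h ((extChartAt (𝓡∂ (n + 1)) x).symm y)) +
        w ((extChartAt (𝓡∂ (n + 1)) x).symm y) * chartLaplacian n x h y) := by
  have hint := (symm_mem_interior_iff hy).2 hy0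
  have hwp : MDifferentiableAt (𝓡∂ (n + 1)) 𝓘(ℝ, ℝ) w ((extChartAt (𝓡∂ (n + 1)) x).symm y) :=
    (hw.contMDiffAt (isOpen_manifold_interior.mem_nhds hint)).mdifferentiableAt one_ne_zero
  have hhp := hh.mdifferentiableAt (x := (extChartAt (𝓡∂ (n + 1)) x).symm y) two_ne_zero
  have hr : range (𝓡∂ (n + 1)) ∈ 𝓝 y := by
    rw [range_modelWithCornersEuclideanHalfSpace]
    filter_upwards [(isOpen_lt continuous_const (by fun_prop :
      Continuous fun z : EuclideanSpace ℝ (Fin (n + 1)) => z 0)).mem_nhds hy0] with z hz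
    exact le_of_lt (show (0 : ℝ) < z 0 from hz)
  have hT : (extChartAt (𝓡∂ (n + 1)) x).target ∈ 𝓝 y := by
    have := extChartAt_target_mem_nhdsWithin_of_mem hy
    rwa [nhdsWithin_eq_nhds.2 hr] at this
  have hw1 : DifferentiableAt ℝ (w ∘ (extChartAt (𝓡∂ (n + 1)) x).symm) y := by
    have h1 := contDiffOn_comp_extChartAt_symm (x := x) (k := 1) hw
    refine ((h1 y ⟨hy, hint⟩).differentiableWithinAt one_ne_zero).differentiableAt ?_
    filter_upwards [hT, (isOpen_lt continuous_const (by fun_prop :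
      Continuous fun z : EuclideanSpace ℝ (Fin (n + 1)) => z 0)).mem_nhds hy0] with z hz hz0
    exact ⟨hz, (symm_mem_interior_iff hz).2 hz0⟩
  have hF : ∀ i, DifferentiableAt ℝ (fun z => chartDensity n x z * chartGrad x h i z) y := fun i =>
    ((((chartDensity_contDiffOn x).of_le (by exact_mod_cast le_top)).mul
      (chartGrad_contDiffOn x (k := 1) (l := 2) (by norm_num) hh i)).differentiableOn
        one_ne_zero).differentiableAt hT
  have hterm : ∀ i, fderiv ℝ (fun z => w ((extChartAt (𝓡∂ (n + 1)) x).symm z) *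
        (chartDensity n x z * chartGrad x h i z)) y (EuclideanSpace.single i 1) =
      chartDensity n x y * (fderivWithin ℝ (w ∘ (extChartAt (𝓡∂ (n + 1)) x).symm)
        (range (𝓡∂ (n + 1))) y (EuclideanSpace.single i 1) * chartGrad x h i y) +
      w ((extChartAt (𝓡∂ (n + 1)) x).symm y) *
        fderivWithin ℝ (fun z => chartDensity n x z * chartGrad x h i z)
          (range (𝓡∂ (n + 1))) y (EuclideanSpace.single i 1) := by
    intro i
    have := fderiv_fun_mul hw1 (hF i)
    simp only [Function.comp_def] at this
    rw [this, fderivWithin_of_mem_nhds hr, fderivWithin_of_mem_nhds hr]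
    simp only [add_apply, smul_apply, smul_eq_mul,
      Function.comp_def]
    ring
  rw [Finset.sum_congr rfl fun i _ => hterm i, Finset.sum_add_distrib, ← Finset.mul_sum,
    ← Finset.mul_sum, ← inner_grad_grad_eq hy hwp hhp, mul_add]
  congr 1
  have hc : chartLaplacian n x h y = (chartDensity n x y)⁻¹ * ∑ i, fderivWithin ℝ
      (fun z => chartDensity n x z * chartGrad x h i z) (range (𝓡∂ (n + 1))) y
        (EuclideanSpace.single i 1) := rfl
  rw [hc]
  have := (chartDensity_pos hy).ne'
  field_simp

end Green

section ChartGreen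

lemma isCompact_image_extChartAt {n : ℕ} {M : Type*} [TopologicalSpace M]
    [ChartedSpace (EuclideanHalfSpace (n + 1)) M] {x : M} {K : Set M} (hK : IsCompact K)
    (hKx : K ⊆ (extChartAt (𝓡∂ (n + 1)) x).source) :
    IsCompact (extChartAt (𝓡∂ (n + 1)) x '' K) :=
  hK.image_of_continuousOn ((continuousOn_extChartAt x).mono hKx)

variable {n : ℕ} {M : Type*} [TopologicalSpace M] [SecondCountableTopology M]
  [MeasurableSpace M] [BorelSpace M] [ChartedSpace (EuclideanHalfSpace (n + 1)) M]
  [IsManifold (𝓡∂ (n + 1)) ∞ M] [RiemannianBundle (fun x : M => TangentSpace (𝓡∂ (n + 1)) x)]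
  [IsContMDiffRiemannianBundle (𝓡∂ (n + 1)) ∞ (EuclideanSpace ℝ (Fin (n + 1)))
    (fun x : M => TangentSpace (𝓡∂ (n + 1)) x)]

/-- Since `f` vanishes off a compact subset of the chart domain, its integral in the chart is that
of a continuous function over a compact set. -/
lemma integrableOn_source_of_continuousOn {x : M} {f : M → ℝ}
    (hf : ContinuousOn f (extChartAt (𝓡∂ (n + 1)) x).source) {K : Set M} (hK : IsCompact K)
    (hKx : K ⊆ (extChartAt (𝓡∂ (n + 1)) x).source)
    (hfK : ∀ p ∈ (extChartAt (𝓡∂ (n + 1)) x).source, p ∉ K → f p = 0) :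
    IntegrableOn f (extChartAt (𝓡∂ (n + 1)) x).source (volumeMeasure n M) := by
  have hs := (isOpen_extChartAt_source (I := 𝓡∂ (n + 1)) x).measurableSet
  rw [integrableOn_source_iff x (hf.aestronglyMeasurable hs)]
  have hK' := isCompact_image_extChartAt hK hKx
  have hK'T : extChartAt (𝓡∂ (n + 1)) x '' K ⊆ (extChartAt (𝓡∂ (n + 1)) x).target := by
    rintro _ ⟨p, hp, rfl⟩
    exact (extChartAt (𝓡∂ (n + 1)) x).map_source (hKx hp)
  have hc : ContinuousOn (fun y => chartDensity n x y * f ((extChartAt (𝓡∂ (n + 1)) x).symm y))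
      (extChartAt (𝓡∂ (n + 1)) x).target :=
    (chartDensity_contDiffOn x).continuousOn.mul
      (hf.comp (continuousOn_extChartAt_symm x) (extChartAt (𝓡∂ (n + 1)) x).symm.mapsTo)
  refine ((hc.mono hK'T).integrableOn_compact hK').of_forall_sdiff_eq_zero
    (measurableSet_extChartAt_target x) fun y hy => ?_
  rw [hfK _ ((extChartAt (𝓡∂ (n + 1)) x).map_target hy.1), mul_zero]
  intro h
  exact hy.2 ⟨_, h, (extChartAt (𝓡∂ (n + 1)) x).right_inv hy.1⟩

lemma integrableOn_boundary_source_of_continuousOn {x : M} {f : M → ℝ}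
    (hf : ContinuousOn f (extChartAt (𝓡∂ (n + 1)) x).source) {K : Set M} (hK : IsCompact K)
    (hKx : K ⊆ (extChartAt (𝓡∂ (n + 1)) x).source)
    (hfK : ∀ p ∈ (extChartAt (𝓡∂ (n + 1)) x).source, p ∉ K → f p = 0) :
    IntegrableOn f (extChartAt (𝓡∂ (n + 1)) x).source (boundaryMeasure n M) := by
  have hs := (isOpen_extChartAt_source (I := 𝓡∂ (n + 1)) x).measurableSet
  rw [integrableOn_boundary_source_iff x (hf.aestronglyMeasurable hs)]
  have hK' : IsCompact (hyperplane n ⁻¹' (extChartAt (𝓡∂ (n + 1)) x '' K)) := by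
    refine ((isCompact_image_extChartAt hK hKx).image (tailL n).continuous).of_isClosed_subset
      ((isCompact_image_extChartAt hK hKx).isClosed.preimage continuous_hyperplane) fun z hz => ?_
    exact ⟨_, hz, tailL_hyperplane z⟩
  have hK'T : hyperplane n ⁻¹' (extChartAt (𝓡∂ (n + 1)) x '' K) ⊆
      hyperplane n ⁻¹' (extChartAt (𝓡∂ (n + 1)) x).target := by
    rintro z ⟨p, hp, hpz⟩
    rw [mem_preimage, ← hpz]
    exact (extChartAt (𝓡∂ (n + 1)) x).map_source (hKx hp)
  have hc : ContinuousOn (fun z => boundaryDensity n x z *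
      f ((extChartAt (𝓡∂ (n + 1)) x).symm (hyperplane n z)))
      (hyperplane n ⁻¹' (extChartAt (𝓡∂ (n + 1)) x).target) :=
    (boundaryDensity_continuousOn x).mul
      (hf.comp (continuousOn_symm_hyperplane x) fun z hz =>
        (extChartAt (𝓡∂ (n + 1)) x).map_target hz)
  refine ((hc.mono hK'T).integrableOn_compact hK').of_forall_sdiff_eq_zero
    (measurableSet_hyperplane_preimage_target x) fun y hy => ?_
  rw [hfK _ ((extChartAt (𝓡∂ (n + 1)) x).map_target hy.1), mul_zero]
  intro h
  exact hy.2 ⟨_, h, (extChartAt (𝓡∂ (n + 1)) x).right_inv hy.1⟩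

/-- Green's inequality for a function supported in the domain of one chart: the flux of `w ∇h`
through the boundary is at most the integral of any integrable majorant `b` of `-div (w ∇h)`. Only
continuity of `w` up to the boundary is used. -/
theorem integral_boundary_source_le {x : M} {w h b : M → ℝ} (hwc : Continuous w)
    (hws : HasCompactSupport w) (hwx : tsupport w ⊆ (extChartAt (𝓡∂ (n + 1)) x).source)
    (hw : ContMDiffOn (𝓡∂ (n + 1)) 𝓘(ℝ, ℝ) 1 w ((𝓡∂ (n + 1)).interior M))
    (hh : ContMDiff (𝓡∂ (n + 1)) 𝓘(ℝ, ℝ) 2 h)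
    (hN : ∀ p ∈ (𝓡∂ (n + 1)).boundary M, w p ≠ 0 → differential n h p (inwardNormal n p) = 1)
    (hb : IntegrableOn b (extChartAt (𝓡∂ (n + 1)) x).source (volumeMeasure n M))
    (hdiv : ∀ p ∈ (extChartAt (𝓡∂ (n + 1)) x).source, p ∈ (𝓡∂ (n + 1)).interior M →
      -(inner ℝ (grad n w p) (grad n h p) +
        w p * chartLaplacian n x h (extChartAt (𝓡∂ (n + 1)) x p)) ≤ b p) :
    ∫ p in (extChartAt (𝓡∂ (n + 1)) x).source, w p ∂(boundaryMeasure n M) ≤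
      ∫ p in (extChartAt (𝓡∂ (n + 1)) x).source, b p ∂(volumeMeasure n M) := by
  classical
  set φ := extChartAt (𝓡∂ (n + 1)) x with hφ
  set T := φ.target with hT
  set K := φ '' tsupport w with hK
  have hKc : IsCompact K := isCompact_image_extChartAt hws hwx
  obtain ⟨O, hO, hTO⟩ := exists_isOpen_target_eq (n := n) x
  have hKT : K ⊆ T := by
    rintro _ ⟨p, hp, rfl⟩
    exact φ.map_source (hwx hp)
  have hKO : K ⊆ O := fun y hy => by
    have := hKT hy
    rw [hT, hφ, hTO] at this
    exact this.1
  have hw0 : ∀ y ∈ T, y ∉ K → w (φ.symm y) = 0 := fun y hy hyK =>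
    image_eq_zero_of_notMem_tsupport fun h => hyK ⟨_, h, φ.right_inv hy⟩
  set g : Fin (n + 1) → EuclideanSpace ℝ (Fin (n + 1)) → ℝ := fun i y =>
    w (φ.symm y) * (chartDensity n x y * chartGrad x h i y) with hg
  -- the flux density of `w ∇h` in the chart, extended by zero to the half-space
  set X : Fin (n + 1) → EuclideanSpace ℝ (Fin (n + 1)) → ℝ := fun i => T.indicator (g i) with hX
  have hX0 : ∀ i y, y ∉ K → X i y = 0 := by
    intro i y hy
    by_cases hyT : y ∈ T
    · simp only [hX, indicator_of_mem hyT, hg, hw0 y hyT hy, zero_mul]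
    · simp only [hX, indicator_of_notMem hyT]
  set B : EuclideanSpace ℝ (Fin (n + 1)) → ℝ :=
    T.indicator fun y => chartDensity n x y * b (φ.symm y) with hB
  have hpos : MeasurableSet {y : EuclideanSpace ℝ (Fin (n + 1)) | 0 < y 0} :=
    (isOpen_lt continuous_const (by fun_prop)).measurableSet
  have hTm : MeasurableSet T := measurableSet_extChartAt_target x
  have hsm := (isOpen_extChartAt_source (I := 𝓡∂ (n + 1)) x).measurableSet
  obtain ⟨R, hR⟩ := hKc.isBounded.exists_norm_le
  have hsupp : ∀ i y, (∃ j, R + 1 ≤ |y j|) → X i y = 0 := by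
    rintro i y ⟨j, hj⟩
    refine hX0 i y fun hy => ?_
    have h1 := hR y hy
    have h2 := PiLp.norm_apply_le y j
    rw [Real.norm_eq_abs] at h2
    linarith
  have hF1 : ∀ i, ContDiffOn ℝ 1 (fun y => chartDensity n x y * chartGrad x h i y) T := fun i =>
    ((chartDensity_contDiffOn x).of_le (by exact_mod_cast le_top)).mul
      (chartGrad_contDiffOn x (k := 1) (l := 2) (by norm_num) hh i)
  have hcont : ContinuousOn (X 0) {y | 0 ≤ y 0} := by
    rw [← contDiffOn_zero (𝕜 := ℝ)]
    refine contDiffOn_of_eq_zero_off hO hKc.isClosed hKO (g := g 0) ?_ (fun y hy => ?_)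
      fun y _ hy => hX0 0 y hy
    · rw [← hTO, contDiffOn_zero]
      exact (hwc.comp_continuousOn (continuousOn_extChartAt_symm x)).mul (hF1 0).continuousOn
    · rw [← hTO] at hy
      exact indicator_of_mem hy _
  have hC1 : ∀ i, ContDiffOn ℝ 1 (X i) {y | 0 < y 0} := by
    intro i
    have hsub : O ∩ {y : EuclideanSpace ℝ (Fin (n + 1)) | 0 < y 0} ⊆ T := fun y hy => by
      rw [hT, hφ, hTO]
      exact ⟨hy.1, le_of_lt (show (0 : ℝ) < y 0 from hy.2)⟩
    refine contDiffOn_of_eq_zero_off hO hKc.isClosed hKO (g := g i) ?_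
      (fun y hy => indicator_of_mem (hsub hy) _) fun y _ hy => hX0 i y hy
    refine ContDiffOn.mul ?_ ((hF1 i).mono hsub)
    exact (contDiffOn_comp_extChartAt_symm (x := x) (k := 1) hw).mono fun y hy =>
      ⟨hsub hy, (symm_mem_interior_iff (hsub hy)).2 hy.2⟩
  have hBi : Integrable B := by
    rw [hB, integrable_indicator_iff hTm]
    exact (integrableOn_source_iff x hb.aestronglyMeasurable).1 hb
  have key := integral_hyperplane_le_of_neg_divergence_le hsupp hcont hC1
    (b := B) hBi.integrableOn (fun y hy0 => ?_)
  · have hl : ∫ z : EuclideanSpace ℝ (Fin n), X 0 (hyperplane n z) =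
        ∫ p in φ.source, w p ∂(boundaryMeasure n M) := by
      rw [setIntegral_boundary_source_eq x hwc.aestronglyMeasurable,
        ← integral_indicator (measurableSet_hyperplane_preimage_target x)]
      congr 1
      ext z
      by_cases hz : hyperplane n z ∈ T
      · have hz' : z ∈ hyperplane n ⁻¹' (extChartAt (𝓡∂ (n + 1)) x).target := hz
        simp only [hX, hg]
        rw [indicator_of_mem hz, indicator_of_mem hz']
        by_cases hwz : w (φ.symm (hyperplane n z)) = 0
        · rw [hwz, zero_mul, mul_zero]
        · rw [chartDensity_mul_chartGrad_zero hz (hh.mdifferentiableAt two_ne_zero)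
            (hN _ ((symm_mem_boundary_iff hz).2 rfl) hwz), mul_comm]
      · have hz' : z ∉ hyperplane n ⁻¹' (extChartAt (𝓡∂ (n + 1)) x).target := hz
        simp only [hX, hg]
        rw [indicator_of_notMem hz, indicator_of_notMem hz']
    -- the hyperplane `{y 0 = 0}` is a null set
    have hr : ∫ y in {y : EuclideanSpace ℝ (Fin (n + 1)) | 0 < y 0}, B y =
        ∫ p in φ.source, b p ∂(volumeMeasure n M) := by
      rw [setIntegral_source_eq x hb.aestronglyMeasurable, hB, setIntegral_indicator hTm]
      refine setIntegral_congr_set ?_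
      refine (ae_eq_set.2 ⟨?_, measure_mono_null (fun y hy => ?_) (volume_zero_eq_zero (n := n))⟩)
      · rw [sdiff_eq_empty.2 inter_subset_right, measure_empty]
      · exact le_antisymm (not_lt.1 fun h => hy.2 ⟨h, hy.1⟩) (nonneg_of_mem_target hy.1)
    rw [← hl, ← hr]
    exact key
  · have hopen : IsOpen {y : EuclideanSpace ℝ (Fin (n + 1)) | 0 < y 0} :=
      isOpen_lt continuous_const (by fun_prop)
    by_cases hyK : y ∈ K
    · have hyT : y ∈ T := hKT hyK
      have hsm : φ.symm y ∈ φ.source := φ.map_target hyT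
      have hev : ∀ i, X i =ᶠ[𝓝 y] g i := fun i => by
        filter_upwards [hO.mem_nhds (hKO hyK), hopen.mem_nhds hy0] with z hzO hz0
        refine indicator_of_mem ?_ _
        rw [hT, hφ, hTO]
        exact ⟨hzO, le_of_lt (show (0 : ℝ) < z 0 from hz0)⟩
      have h1 := hdiv _ hsm ((symm_mem_interior_iff hyT).2 hy0)
      rw [φ.right_inv hyT] at h1
      rw [Finset.sum_congr rfl fun i _ => by rw [(hev i).fderiv_eq], sum_fderiv_flux hyT hy0 hw hh,
        hB, indicator_of_mem hyT, ← mul_neg]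
      exact mul_le_mul_of_nonneg_left h1 (chartDensity_pos hyT).le
    · have hev : ∀ i, X i =ᶠ[𝓝 y] fun _ => 0 := fun i => by
        filter_upwards [hKc.isClosed.isOpen_compl.mem_nhds hyK] with z hz using hX0 i z hz
      rw [Finset.sum_eq_zero fun i _ => by rw [(hev i).fderiv_eq]; simp, neg_zero, hB]
      by_cases hyT : y ∈ T
      · rw [indicator_of_mem hyT]
        refine mul_nonneg (chartDensity_pos hyT).le ?_
        have h1 := hdiv _ (φ.map_target hyT) ((symm_mem_interior_iff hyT).2 hy0)
        refine le_trans (le_of_eq ?_) h1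
        have h2 : φ.symm y ∉ tsupport w := fun h => hyK ⟨_, h, φ.right_inv hyT⟩
        rw [inner_grad_eq_zero_of_notMem_tsupport h2, image_eq_zero_of_notMem_tsupport h2, zero_mul,
          add_zero, neg_zero]
      · rw [indicator_of_notMem hyT]

end ChartGreen

/-! ### The Laplacian in different charts -/

section Laplacian

variable {n : ℕ} {M : Type*} [TopologicalSpace M] [SecondCountableTopology M]
  [MeasurableSpace M] [BorelSpace M] [ChartedSpace (EuclideanHalfSpace (n + 1)) M]
  [IsManifold (𝓡∂ (n + 1)) ∞ M] [RiemannianBundle (fun x : M => TangentSpace (𝓡∂ (n + 1)) x)]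
  [IsContMDiffRiemannianBundle (𝓡∂ (n + 1)) ∞ (EuclideanSpace ℝ (Fin (n + 1)))
    (fun x : M => TangentSpace (𝓡∂ (n + 1)) x)]

omit [SecondCountableTopology M] [MeasurableSpace M] [BorelSpace M] in
lemma chartLaplacian_continuousOn (x : M) {h : M → ℝ}
    (hh : ContMDiff (𝓡∂ (n + 1)) 𝓘(ℝ, ℝ) 2 h) :
    ContinuousOn (chartLaplacian n x h) (extChartAt (𝓡∂ (n + 1)) x).target := by
  have hF : ∀ i, ContinuousOn (fun y => fderivWithin ℝ
      (fun z => chartDensity n x z * chartGrad x h i z) (range (𝓡∂ (n + 1))) y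
        (EuclideanSpace.single i 1)) (extChartAt (𝓡∂ (n + 1)) x).target := by
    intro i
    have h1 : ContDiffOn ℝ 1 (fun z => chartDensity n x z * chartGrad x h i z)
        (extChartAt (𝓡∂ (n + 1)) x).target :=
      ((chartDensity_contDiffOn x).of_le (by exact_mod_cast le_top)).mul
        (chartGrad_contDiffOn x (k := 1) (l := 2) (by norm_num) hh i)
    refine ((h1.continuousOn_fderivWithin (uniqueDiffOn_extChartAt_target x) le_rfl).clm_apply
      (continuousOn_const (c := EuclideanSpace.single i 1))).congr fun y hy => ?_
    rw [fderivWithin_target hy]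
  exact ((chartDensity_contDiffOn x).continuousOn.inv₀ fun y hy => (chartDensity_pos hy).ne').mul
    (continuousOn_finsetSum _ fun i _ => hF i)

/-- The weak formulation of the Laplacian in a chart: `∫ (⟨∇f, ∇h⟩ + f Δh) dΛ = 0` for test
functions `f` supported in the interior. It is the inequality `integral_boundary_source_le` for `f`
and `-f`, whose boundary terms vanish. -/
lemma integral_inner_grad_add_mul_chartLaplacian {x : M} {f h : M → ℝ}
    (hf : ContMDiff (𝓡∂ (n + 1)) 𝓘(ℝ, ℝ) 1 f) (hfs : HasCompactSupport f)
    (hfx : tsupport f ⊆ (extChartAt (𝓡∂ (n + 1)) x).source)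
    (hfi : tsupport f ⊆ (𝓡∂ (n + 1)).interior M)
    (hh : ContMDiff (𝓡∂ (n + 1)) 𝓘(ℝ, ℝ) 2 h) :
    Integrable (fun p => inner ℝ (grad n f p) (grad n h p) +
        f p * chartLaplacian n x h (extChartAt (𝓡∂ (n + 1)) x p)) (volumeMeasure n M) ∧
    ∫ p, (inner ℝ (grad n f p) (grad n h p) +
        f p * chartLaplacian n x h (extChartAt (𝓡∂ (n + 1)) x p)) ∂(volumeMeasure n M) = 0 := by
  set G : M → ℝ := fun p => inner ℝ (grad n f p) (grad n h p) +
        f p * chartLaplacian n x h (extChartAt (𝓡∂ (n + 1)) x p) with hG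
  have hG0 : ∀ p, p ∉ tsupport f → G p = 0 := fun p hp => by
    simp only [hG]
    rw [inner_grad_eq_zero_of_notMem_tsupport hp, image_eq_zero_of_notMem_tsupport hp, zero_mul,
      add_zero]
  have hGi : IntegrableOn G (extChartAt (𝓡∂ (n + 1)) x).source (volumeMeasure n M) := by
    refine integrableOn_source_of_continuousOn ?_ hfs hfx fun p _ hp => hG0 p hp
    refine (continuous_inner_grad hf (hh.of_le one_le_two)).continuousOn.add
      (hf.continuous.continuousOn.mul ?_)
    exact (chartLaplacian_continuousOn x hh).comp (continuousOn_extChartAt x)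
      (extChartAt (𝓡∂ (n + 1)) x).mapsTo
  have hb0 : ∀ p ∈ (𝓡∂ (n + 1)).boundary M, f p = 0 := fun p hp => by
    refine image_eq_zero_of_notMem_tsupport fun h => ?_
    rw [← (𝓡∂ (n + 1)).compl_interior] at hp
    exact hp (hfi h)
  have hz : ∫ p in (extChartAt (𝓡∂ (n + 1)) x).source, f p ∂(boundaryMeasure n M) = 0 := by
    refine integral_eq_zero_of_ae (ae_restrict_of_ae ?_)
    filter_upwards [mem_ae_iff.2 (boundaryMeasure_compl_boundary (n := n) (M := M))] with p hp
      using hb0 p hp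
  refine ⟨(integrableOn_iff_integrable_of_support_subset fun p hp => ?_).1 hGi, ?_⟩
  · by_contra hpx
    exact hp (hG0 p fun h => hpx (hfx h))
  · rw [← setIntegral_eq_integral_of_forall_compl_eq_zero
      (s := (extChartAt (𝓡∂ (n + 1)) x).source) fun p hp => hG0 p fun h => hp (hfx h)]
    refine le_antisymm ?_ ?_
    · have := integral_boundary_source_le (b := fun p => -G p) hf.continuous hfs hfx hf.contMDiffOn
        hh (fun p hp hne => absurd (hb0 p hp) hne) hGi.neg fun p _ _ => le_rfl
      rw [hz, integral_neg] at this
      linarith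
    · have hnf : tsupport (-f) = tsupport f := by
        simp only [tsupport, Function.support_neg]
      have := integral_boundary_source_le (w := -f) (h := h) (x := x) (b := G) hf.continuous.neg
        hfs.neg (by rw [hnf]; exact hfx) hf.neg.contMDiffOn
        hh (fun p hp hne => absurd (by simp [hb0 p hp]) hne) hGi fun p _ _ => ?_
      · simp only [Pi.neg_apply, integral_neg, hz, neg_zero] at this
        exact this
      · have hd : differential n (-f) p = -differential n f p := mfderiv_neg
        simp only [hG, Pi.neg_apply]
        rw [inner_grad_left, inner_grad_left, hd]
        refine le_of_eq ?_
        show -(-(differential n f p (grad n h p)) + _) = _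
        ring

omit [SecondCountableTopology M] [MeasurableSpace M] [BorelSpace M]
  [RiemannianBundle (fun x : M => TangentSpace (𝓡∂ (n + 1)) x)]
  [IsContMDiffRiemannianBundle (𝓡∂ (n + 1)) ∞ (EuclideanSpace ℝ (Fin (n + 1)))
    (fun x : M => TangentSpace (𝓡∂ (n + 1)) x)] in
/-- Smooth functions with compact support in the target of a chart, inside the half-space, yield
smooth functions on the manifold. -/
lemma contMDiff_indicator_comp_extChartAt [T2Space M] {x : M}
    {g : EuclideanSpace ℝ (Fin (n + 1)) → ℝ} (hg : ContDiff ℝ ∞ g) (hgs : HasCompactSupport g)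
    (hgx : tsupport g ⊆ (extChartAt (𝓡∂ (n + 1)) x).target) :
    ContMDiff (𝓡∂ (n + 1)) 𝓘(ℝ, ℝ) ∞
      ((extChartAt (𝓡∂ (n + 1)) x).source.indicator (g ∘ extChartAt (𝓡∂ (n + 1)) x)) ∧
    tsupport ((extChartAt (𝓡∂ (n + 1)) x).source.indicator (g ∘ extChartAt (𝓡∂ (n + 1)) x)) ⊆
      (extChartAt (𝓡∂ (n + 1)) x).symm '' tsupport g ∧
    IsCompact ((extChartAt (𝓡∂ (n + 1)) x).symm '' tsupport g) := by
  set φ := extChartAt (𝓡∂ (n + 1)) x with hφ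
  have hK : IsCompact (φ.symm '' tsupport g) :=
    hgs.image_of_continuousOn ((continuousOn_extChartAt_symm x).mono hgx)
  have h0 : ∀ q, q ∉ φ.symm '' tsupport g → φ.source.indicator (g ∘ φ) q = 0 := by
    intro q hq
    by_cases hqs : q ∈ φ.source
    · rw [indicator_of_mem hqs]
      exact image_eq_zero_of_notMem_tsupport (f := g) fun h => hq ⟨_, h, φ.left_inv hqs⟩
    · rw [indicator_of_notMem hqs]
  refine ⟨fun q => ?_, closure_minimal (fun q hq => ?_) hK.isClosed, hK⟩
  · by_cases hqs : q ∈ φ.source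
    · have h1 : ContMDiffAt (𝓡∂ (n + 1)) 𝓘(ℝ, ℝ) ∞ (g ∘ φ) q :=
        hg.contMDiff.contMDiffAt.comp q (contMDiffAt_extChartAt' (by simpa [φ] using hqs))
      refine h1.congr_of_eventuallyEq ?_
      filter_upwards [(isOpen_extChartAt_source (I := 𝓡∂ (n + 1)) x).mem_nhds hqs] with r hr
        using indicator_of_mem hr _
    · have hqK : q ∉ φ.symm '' tsupport g := by
        rintro ⟨y, hy, rfl⟩
        exact hqs (φ.map_target (hgx hy))
      refine (contMDiffAt_const (c := (0 : ℝ))).congr_of_eventuallyEq ?_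
      filter_upwards [hK.isClosed.isOpen_compl.mem_nhds hqK] with r hr using h0 r hr
  · by_contra hqK
    exact hq (h0 q hqK)

/-- At interior points, the Laplacian may be computed in any chart: the weak formulation determines
the local expressions, which are continuous. -/
theorem laplacian_eq_chartLaplacian [T2Space M] {x p : M}
    (hp : p ∈ (extChartAt (𝓡∂ (n + 1)) x).source) (hpi : p ∈ (𝓡∂ (n + 1)).interior M) {h : M → ℝ}
    (hh : ContMDiff (𝓡∂ (n + 1)) 𝓘(ℝ, ℝ) 2 h) :
    laplacian n h p = chartLaplacian n x h (extChartAt (𝓡∂ (n + 1)) x p) := by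
  set φ := extChartAt (𝓡∂ (n + 1)) x with hφ
  set ψ := extChartAt (𝓡∂ (n + 1)) p with hψ
  obtain ⟨O, hO, hTO⟩ := exists_isOpen_target_eq (n := n) x
  set S : Set M := ψ.source ∩ (𝓡∂ (n + 1)).interior M with hS
  have hSo : IsOpen S := (isOpen_extChartAt_source p).inter isOpen_manifold_interior
  set U : Set (EuclideanSpace ℝ (Fin (n + 1))) := O ∩ {y | 0 < y 0} with hU
  have hUo : IsOpen U := hO.inter (isOpen_lt continuous_const (by fun_prop))
  have hUT : U ⊆ φ.target := fun y hy => by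
    rw [hφ, hTO]
    exact ⟨hy.1, le_of_lt (show (0 : ℝ) < y 0 from hy.2)⟩
  set Ω := U ∩ φ.symm ⁻¹' S with hΩ
  have hΩo : IsOpen Ω := ((continuousOn_extChartAt_symm x).mono hUT).isOpen_inter_preimage hUo hSo
  have hΩT : Ω ⊆ φ.target := fun y hy => hUT hy.1
  set f : EuclideanSpace ℝ (Fin (n + 1)) → ℝ := fun y => chartDensity n x y *
    (chartLaplacian n x h y - chartLaplacian n p h (ψ (φ.symm y))) with hf
  have hfc : ContinuousOn f Ω := by
    refine ((chartDensity_contDiffOn x).continuousOn.mono hΩT).mul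
      (((chartLaplacian_continuousOn x hh).mono hΩT).sub ?_)
    refine (chartLaplacian_continuousOn p hh).comp ((continuousOn_extChartAt p).comp
      ((continuousOn_extChartAt_symm x).mono hΩT) fun y hy => hy.2.1) fun y hy => ?_
    exact ψ.map_source hy.2.1
  -- both local expressions of the Laplacian have the same integral against every test function
  have hae : ∀ᵐ y, y ∈ Ω → f y = 0 := by
    refine hΩo.ae_eq_zero_of_integral_contDiff_smul_eq_zero
      (hfc.locallyIntegrableOn hΩo.measurableSet) fun g hg hgs hgΩ => ?_
    obtain ⟨hsm, hsupp, hK⟩ := contMDiff_indicator_comp_extChartAt (x := x) hg hgs (hgΩ.trans hΩT)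
    set F := φ.source.indicator (g ∘ φ) with hF
    have hsub : tsupport F ⊆ φ.source ∩ S := by
      refine hsupp.trans ?_
      rintro _ ⟨y, hy, rfl⟩
      exact ⟨φ.map_target (hΩT (hgΩ hy)), (hgΩ hy).2⟩
    have hFs : HasCompactSupport F := hK.of_isClosed_subset (isClosed_tsupport F) hsupp
    have hF1 : ContMDiff (𝓡∂ (n + 1)) 𝓘(ℝ, ℝ) 1 F := hsm.of_le (by exact_mod_cast le_top)
    obtain ⟨hi1, h1⟩ := integral_inner_grad_add_mul_chartLaplacian (x := x) hF1 hFs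
      (fun q hq => (hsub hq).1) (fun q hq => (hsub hq).2.2) hh
    obtain ⟨hi2, h2⟩ := integral_inner_grad_add_mul_chartLaplacian (x := p) hF1 hFs
      (fun q hq => (hsub hq).2.1) (fun q hq => (hsub hq).2.2) hh
    have h3 := integral_sub hi1 hi2
    have hi3 := hi1.sub hi2
    rw [h1, h2, sub_zero] at h3
    have heq : ∀ q, (inner ℝ (grad n F q) (grad n h q) + F q * chartLaplacian n x h (φ q)) -
        (inner ℝ (grad n F q) (grad n h q) + F q * chartLaplacian n p h (ψ q)) =
        F q * (chartLaplacian n x h (φ q) - chartLaplacian n p h (ψ q)) := fun q => by ring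
    rw [integral_congr_ae (ae_of_all _ heq)] at h3
    have hi4 := hi3.congr (ae_of_all _ heq)
    rw [← setIntegral_eq_integral_of_forall_compl_eq_zero (s := φ.source)
      (fun q hq => by rw [hF, indicator_of_notMem hq, zero_mul]),
      setIntegral_source_eq x hi4.aestronglyMeasurable.restrict] at h3
    rw [← setIntegral_eq_integral_of_forall_compl_eq_zero (s := φ.target) (fun y hy => by
      rw [image_eq_zero_of_notMem_tsupport fun h => hy (hΩT (hgΩ h)), zero_smul]), ← h3]
    refine setIntegral_congr_fun (measurableSet_extChartAt_target x) fun y hy => ?_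
    have hy' : φ.symm y ∈ φ.source := φ.map_target hy
    simp only [hf, hF, smul_eq_mul]
    rw [indicator_of_mem hy', Function.comp_apply, ← hφ, φ.right_inv hy]
    ring
  have hEq := Measure.eqOn_open_of_ae_eq (μ := volume) (g := fun _ => 0)
    ((ae_restrict_iff' hΩo.measurableSet).2 hae) hΩo hfc continuousOn_const
  have hpT := φ.map_source hp
  have hp0 : 0 < φ p 0 := (extChartAt_mem_interior_iff hp).1 hpi
  have hpO : φ p ∈ O := by
    have := hpT
    rw [hφ, hTO] at this
    exact this.1
  have hpΩ : φ p ∈ Ω := by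
    refine ⟨⟨hpO, hp0⟩, ?_⟩
    rw [mem_preimage, φ.left_inv hp]
    exact ⟨mem_extChartAt_source p, hpi⟩
  have hfin := hEq hpΩ
  simp only [hf, φ.left_inv hp, mul_eq_zero, (chartDensity_pos hpT).ne', false_or] at hfin
  rw [laplacian]
  linarith

end Laplacian

/-! ### Calculus of gradients -/

section GradientCalculus

variable {n : ℕ} {M : Type*} [TopologicalSpace M] [ChartedSpace (EuclideanHalfSpace (n + 1)) M]
  [RiemannianBundle (fun x : M => TangentSpace (𝓡∂ (n + 1)) x)]

lemma grad_eq_of_differential_eq {f : M → ℝ} {p : M} {v : TangentSpace (𝓡∂ (n + 1)) p}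
    (h : ∀ w, differential n f p w = inner ℝ v w) : grad n f p = v :=
  ext_inner_right ℝ fun w => by rw [inner_grad_left, h]

lemma grad_mul {f g : M → ℝ} {p : M} (hf : MDifferentiableAt (𝓡∂ (n + 1)) 𝓘(ℝ, ℝ) f p)
    (hg : MDifferentiableAt (𝓡∂ (n + 1)) 𝓘(ℝ, ℝ) g p) :
    grad n (fun q => f q * g q) p = f p • grad n g p + g p • grad n f p := by
  refine grad_eq_of_differential_eq fun w => ?_
  rw [inner_add_left, inner_smul_left, inner_smul_left, inner_grad_left, inner_grad_left]
  have := (hf.hasMFDerivAt.mul hg.hasMFDerivAt).mfderiv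
  exact congrArg (fun L : TangentSpace (𝓡∂ (n + 1)) p →L[ℝ] ℝ => L w) this

lemma grad_comp {φ : ℝ → ℝ} {φ' : ℝ} {f : M → ℝ} {p : M} (hφ : HasDerivAt φ φ' (f p))
    (hf : MDifferentiableAt (𝓡∂ (n + 1)) 𝓘(ℝ, ℝ) f p) :
    grad n (fun q => φ (f q)) p = φ' • grad n f p := by
  refine grad_eq_of_differential_eq fun w => ?_
  rw [inner_smul_left, inner_grad_left]
  have := (hφ.hasFDerivAt.hasMFDerivAt.comp p hf.hasMFDerivAt).mfderiv
  refine (congrArg (fun L : TangentSpace (𝓡∂ (n + 1)) p →L[ℝ] ℝ => L w) this).trans ?_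
  exact mul_comm _ _

lemma grad_add {f g : M → ℝ} {p : M} (hf : MDifferentiableAt (𝓡∂ (n + 1)) 𝓘(ℝ, ℝ) f p)
    (hg : MDifferentiableAt (𝓡∂ (n + 1)) 𝓘(ℝ, ℝ) g p) :
    grad n (fun q => f q + g q) p = grad n f p + grad n g p := by
  refine grad_eq_of_differential_eq fun w => ?_
  rw [inner_add_left, inner_grad_left, inner_grad_left]
  have := (hf.hasMFDerivAt.add hg.hasMFDerivAt).mfderiv
  exact congrArg (fun L : TangentSpace (𝓡∂ (n + 1)) p →L[ℝ] ℝ => L w) this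

lemma grad_const (c : ℝ) (p : M) : grad n (fun _ => c) p = 0 := by
  refine grad_eq_of_differential_eq fun w => ?_
  rw [inner_zero_left]
  exact congrArg (fun L : TangentSpace (𝓡∂ (n + 1)) p →L[ℝ] ℝ => L w) mfderiv_const

lemma grad_sub_const {f : M → ℝ} (hf : MDifferentiable (𝓡∂ (n + 1)) 𝓘(ℝ, ℝ) f) (c : ℝ) (p : M) :
    grad n (fun q => f q - c) p = grad n f p := by
  simp only [sub_eq_add_neg]
  rw [grad_add (hf p) mdifferentiableAt_const, grad_const, add_zero]

lemma grad_sum {ι : Type*} (s : Finset ι) {f : ι → M → ℝ} {p : M}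
    (hf : ∀ i, MDifferentiableAt (𝓡∂ (n + 1)) 𝓘(ℝ, ℝ) (f i) p) :
    MDifferentiableAt (𝓡∂ (n + 1)) 𝓘(ℝ, ℝ) (fun q => ∑ i ∈ s, f i q) p ∧
      grad n (fun q => ∑ i ∈ s, f i q) p = ∑ i ∈ s, grad n (f i) p := by
  classical
  induction s using Finset.induction_on with
  | empty => simpa using ⟨mdifferentiableAt_const, grad_const 0 p⟩
  | insert i s hi ih =>
    simp only [Finset.sum_insert hi]
    exact ⟨(hf i).add ih.1, by rw [grad_add (hf i) ih.1, ih.2]⟩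

end GradientCalculus

/-! ### The weighted probability measures -/

section WeightedMeasure

variable {X : Type*} [MeasurableSpace X] {ν : Measure X} {φ : X → ℝ}

lemma integral_withDensity_ofReal (hφ : AEMeasurable φ ν) (h0 : ∀ x, 0 ≤ φ x) (f : X → ℝ) :
    ∫ x, f x ∂(ν.withDensity fun x => ENNReal.ofReal (φ x)) = ∫ x, φ x * f x ∂ν := by
  rw [integral_withDensity_eq_integral_toReal_smul₀ hφ.ennreal_ofReal
    (ae_of_all _ fun x => ENNReal.ofReal_lt_top)]
  simp only [ENNReal.toReal_ofReal (h0 _), smul_eq_mul]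

lemma integrable_withDensity_ofReal_iff (hφ : AEMeasurable φ ν) (h0 : ∀ x, 0 ≤ φ x) {f : X → ℝ} :
    Integrable f (ν.withDensity fun x => ENNReal.ofReal (φ x)) ↔
      Integrable (fun x => φ x * f x) ν := by
  have := integrable_withDensity_iff_integrable_smul₀ (μ := ν) (E := ℝ)
    (f := fun x => (φ x).toNNReal) hφ.real_toNNReal (g := f)
  simp only [NNReal.smul_def, Real.coe_toNNReal _ (h0 _), smul_eq_mul] at this
  exact this

lemma isProbabilityMeasure_withDensity_div (hφ : Integrable φ ν) (h0 : ∀ x, 0 ≤ φ x)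
    (hZ : 0 < ∫ x, φ x ∂ν) :
    IsProbabilityMeasure (ν.withDensity fun x => ENNReal.ofReal (φ x / ∫ x, φ x ∂ν)) := by
  refine ⟨?_⟩
  rw [withDensity_apply _ MeasurableSet.univ, Measure.restrict_univ,
    ← ofReal_integral_eq_lintegral_ofReal (hφ.div_const _)
      (ae_of_all _ fun x => div_nonneg (h0 x) hZ.le), integral_div, div_self hZ.ne',
    ENNReal.ofReal_one]

end WeightedMeasure

namespace Data

variable {n : ℕ} {M : Type*} [TopologicalSpace M]
  [MeasurableSpace M] [BorelSpace M] [ChartedSpace (EuclideanHalfSpace (n + 1)) M]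
  [IsManifold (𝓡∂ (n + 1)) ∞ M] [RiemannianBundle (fun x : M => TangentSpace (𝓡∂ (n + 1)) x)]
  [IsContMDiffRiemannianBundle (𝓡∂ (n + 1)) ∞ (EuclideanSpace ℝ (Fin (n + 1)))
    (fun x : M => TangentSpace (𝓡∂ (n + 1)) x)] (D : Data n M)

lemma ZV_pos : 0 < D.ZV := by
  have : Nonempty M := ⟨D.boundary_nonempty.some⟩
  have : NeZero (volumeMeasure n M) := ⟨volumeMeasure_ne_zero⟩
  exact integral_exp_pos D.integrable_V

lemma ZW_pos : 0 < D.ZW := by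
  have : NeZero (boundaryMeasure n M) := ⟨boundaryMeasure_ne_zero D.boundary_nonempty⟩
  exact integral_exp_pos D.integrable_W

lemma θ_pos : 0 < D.θ := by
  have := D.ZV_pos
  have := D.ZW_pos
  have := D.γ_pos
  unfold θ
  positivity

lemma one_sub_θ_pos : 0 < 1 - D.θ := by
  have h1 := D.ZV_pos
  have h2 := mul_pos D.γ_pos D.ZW_pos
  have : 1 - D.θ = D.ZV / (D.γ * D.ZW + D.ZV) := by
    unfold θ
    field_simp
    ring
  rw [this]
  positivity

instance : IsProbabilityMeasure D.μV :=
  isProbabilityMeasure_withDensity_div D.integrable_V (fun _ => (Real.exp_pos _).le) D.ZV_pos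

instance : IsProbabilityMeasure D.μW :=
  isProbabilityMeasure_withDensity_div D.integrable_W (fun _ => (Real.exp_pos _).le) D.ZW_pos

lemma integral_μV (f : M → ℝ) :
    ∫ x, f x ∂D.μV = (∫ x, f x * Real.exp (D.V x) ∂(volumeMeasure n M)) / D.ZV := by
  rw [μV, integral_withDensity_ofReal (D.integrable_V.aestronglyMeasurable.aemeasurable.div_const _)
    fun x => div_nonneg (Real.exp_pos _).le D.ZV_pos.le, ← integral_div]
  exact integral_congr_ae (ae_of_all _ fun x => by ring)

lemma integral_μW (f : M → ℝ) :
    ∫ x, f x ∂D.μW = (∫ x, f x * Real.exp (D.W x) ∂(boundaryMeasure n M)) / D.ZW := by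
  rw [μW, integral_withDensity_ofReal (D.integrable_W.aestronglyMeasurable.aemeasurable.div_const _)
    fun x => div_nonneg (Real.exp_pos _).le D.ZW_pos.le, ← integral_div]
  exact integral_congr_ae (ae_of_all _ fun x => by ring)

lemma integrable_μV_iff {f : M → ℝ} :
    Integrable f D.μV ↔ Integrable (fun x => f x * Real.exp (D.V x)) (volumeMeasure n M) := by
  rw [μV, integrable_withDensity_ofReal_iff
    (D.integrable_V.aestronglyMeasurable.aemeasurable.div_const _)
    fun x => div_nonneg (Real.exp_pos _).le D.ZV_pos.le]
  have : (fun x => Real.exp (D.V x) / D.ZV * f x) =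
      fun x => (D.ZV)⁻¹ * (f x * Real.exp (D.V x)) := by
    ext x; ring
  rw [this]
  exact integrable_const_mul_iff (isUnit_iff_ne_zero.2 (inv_ne_zero D.ZV_pos.ne')) _

omit [IsContMDiffRiemannianBundle (𝓡∂ (n + 1)) ∞
  (EuclideanSpace ℝ (Fin (n + 1))) (fun x : M => TangentSpace (𝓡∂ (n + 1)) x)] in
lemma ae_μW_mem_boundary : ∀ᵐ x ∂D.μW, x ∈ (𝓡∂ (n + 1)).boundary M :=
  (withDensity_absolutelyContinuous _ _).ae_le
    (mem_ae_iff.2 (boundaryMeasure_compl_boundary (n := n) (M := M)))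

end Data

/-! ### Green's inequality on the manifold -/

section Partition

variable {n : ℕ} {M : Type*} [TopologicalSpace M] [T2Space M] [SecondCountableTopology M]
  [ChartedSpace (EuclideanHalfSpace (n + 1)) M] [IsManifold (𝓡∂ (n + 1)) ∞ M]

/-- A non-negative `C¹` function with compact support is a finite sum of such functions, each
supported in the domain of a chart. -/
lemma exists_finset_sum_chart_support {u : M → ℝ} (hu : ContMDiff (𝓡∂ (n + 1)) 𝓘(ℝ, ℝ) 1 u)
    (hus : HasCompactSupport u) (hu0 : ∀ p, 0 ≤ u p) :
    ∃ (s : Finset M) (v : M → M → ℝ), (∀ x, ContMDiff (𝓡∂ (n + 1)) 𝓘(ℝ, ℝ) 1 (v x)) ∧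
      (∀ x, HasCompactSupport (v x)) ∧ (∀ x p, 0 ≤ v x p) ∧
      (∀ x, tsupport (v x) ⊆ (extChartAt (𝓡∂ (n + 1)) x).source) ∧
      u = fun p => ∑ x ∈ s, v x p := by
  have : LocallyCompactSpace M := Manifold.locallyCompact_of_finiteDimensional (𝓡∂ (n + 1))
  obtain ⟨ρ, hρ⟩ := SmoothPartitionOfUnity.exists_isSubordinate_chartAt_source (𝓡∂ (n + 1)) M
  have hfin := ρ.locallyFinite.finite_nonempty_inter_compact hus
  refine ⟨hfin.toFinset, fun x p => ρ x p * u p, fun x => ?_, fun x => ?_, fun x p => ?_,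
    fun x => ?_, ?_⟩
  · exact ((ρ x).contMDiff.of_le (by exact_mod_cast le_top)).mul hu
  · exact hus.mul_left
  · exact mul_nonneg (ρ.nonneg x p) (hu0 p)
  · refine (tsupport_mul_subset_left (f := ρ x) (g := u)).trans ?_
    rw [extChartAt_source]
    exact hρ x
  · ext p
    rw [← Finset.sum_mul]
    by_cases hp : u p = 0
    · simp [hp]
    · have h1 : ∑ᶠ x, ρ x p = 1 := ρ.sum_eq_one (mem_univ p)
      rw [finsum_eq_sum_of_support_subset (s := hfin.toFinset)] at h1
      · rw [h1, one_mul]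
      · intro x hx
        rw [Finite.coe_toFinset]
        exact ⟨p, hx, subset_tsupport u hp⟩

end Partition

namespace Data

variable {n : ℕ} {M : Type*} [TopologicalSpace M] [T2Space M] [SecondCountableTopology M]
  [MeasurableSpace M] [BorelSpace M] [ChartedSpace (EuclideanHalfSpace (n + 1)) M]
  [IsManifold (𝓡∂ (n + 1)) ∞ M] [RiemannianBundle (fun x : M => TangentSpace (𝓡∂ (n + 1)) x)]
  [IsContMDiffRiemannianBundle (𝓡∂ (n + 1)) ∞ (EuclideanSpace ℝ (Fin (n + 1)))
    (fun x : M => TangentSpace (𝓡∂ (n + 1)) x)] (D : Data n M)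

omit [T2Space M] [SecondCountableTopology M] in
lemma integrable_mul_negPartLV {h u : M → ℝ} (hA : D.AssumptionA h)
    (hu : ContMDiff (𝓡∂ (n + 1)) 𝓘(ℝ, ℝ) 1 u) (hus : HasCompactSupport u) :
    Integrable (fun p => u p * D.negPartLV h p) D.μV := by
  obtain ⟨C, hC⟩ := hus.exists_bound_of_continuous hu.continuous
  exact (hA.LV_memLp.integrable one_le_two).bdd_mul hu.continuous.aestronglyMeasurable
    (ae_of_all _ hC)

/-- Green's inequality for functions supported in a chart. -/
lemma integral_exp_boundary_le_of_chart_support {h u : M → ℝ} {x : M} (hA : D.AssumptionA h)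
    (hu : ContMDiff (𝓡∂ (n + 1)) 𝓘(ℝ, ℝ) 1 u) (hus : HasCompactSupport u) (hu0 : ∀ p, 0 ≤ u p)
    (hux : tsupport u ⊆ (extChartAt (𝓡∂ (n + 1)) x).source) :
    Integrable (fun p => u p * Real.exp (D.V p)) (boundaryMeasure n M) ∧
    Integrable (fun p => (u p * D.negPartLV h p - inner ℝ (grad n u p) (grad n h p)) *
      Real.exp (D.V p)) (volumeMeasure n M) ∧
    ∫ p, u p * Real.exp (D.V p) ∂(boundaryMeasure n M) ≤
      ∫ p, (u p * D.negPartLV h p - inner ℝ (grad n u p) (grad n h p)) *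
        Real.exp (D.V p) ∂(volumeMeasure n M) := by
  have hVc : Continuous fun p => Real.exp (D.V p) := Real.continuous_exp.comp D.continuous_V
  have hus' : ∀ p, p ∉ tsupport u → u p = 0 := fun p hp => image_eq_zero_of_notMem_tsupport hp
  have hbd : Integrable (fun p => u p * Real.exp (D.V p)) (boundaryMeasure n M) := by
    refine (integrableOn_iff_integrable_of_support_subset fun p hp => ?_).1
      (integrableOn_boundary_source_of_continuousOn (x := x)
        (hu.continuous.mul hVc).continuousOn hus hux fun p _ hp => ?_)
    · by_contra hpx
      exact hp (by simp only [hus' p fun h => hpx (hux h), zero_mul])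
    · simp only [hus' p hp, zero_mul]
  have hin : Integrable (fun p => inner ℝ (grad n u p) (grad n h p) * Real.exp (D.V p))
      (volumeMeasure n M) := by
    refine (integrableOn_iff_integrable_of_support_subset fun p hp => ?_).1
      (integrableOn_source_of_continuousOn (x := x)
        ((continuous_inner_grad hu (hA.contMDiff.of_le one_le_two)).mul hVc).continuousOn hus hux
        fun p _ hp => ?_)
    · by_contra hpx
      exact hp (by
        simp only [inner_grad_eq_zero_of_notMem_tsupport fun h => hpx (hux h), zero_mul])
    · simp only [inner_grad_eq_zero_of_notMem_tsupport hp, zero_mul]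
  have hvol : Integrable (fun p => (u p * D.negPartLV h p - inner ℝ (grad n u p) (grad n h p)) *
      Real.exp (D.V p)) (volumeMeasure n M) := by
    simp only [sub_mul]
    exact (D.integrable_μV_iff.1 (D.integrable_mul_negPartLV hA hu hus)).sub hin
  refine ⟨hbd, hvol, ?_⟩
  rw [← setIntegral_eq_integral_of_forall_compl_eq_zero
      (s := (extChartAt (𝓡∂ (n + 1)) x).source) (μ := boundaryMeasure n M) fun p hp => by
        simp only [hus' p fun h => hp (hux h), zero_mul],
    ← setIntegral_eq_integral_of_forall_compl_eq_zero
      (s := (extChartAt (𝓡∂ (n + 1)) x).source) (μ := volumeMeasure n M) fun p hp => by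
        simp only [hus' p fun h => hp (hux h), zero_mul, sub_zero,
          inner_grad_eq_zero_of_notMem_tsupport fun h => hp (hux h)]]
  have htw : tsupport (fun p => u p * Real.exp (D.V p)) ⊆ tsupport u := tsupport_mul_subset_left
  refine integral_boundary_source_le (hu.continuous.mul hVc) hus.mul_right (htw.trans hux) ?_
    hA.contMDiff (fun p hp _ => hA.normal_deriv p hp) hvol.integrableOn fun p hp hpi => ?_
  · exact hu.contMDiffOn.mul
      ((Real.contDiff_exp (n := 1)).contMDiff.comp_contMDiffOn D.contMDiffOn_V)
  · have hud : MDifferentiableAt (𝓡∂ (n + 1)) 𝓘(ℝ, ℝ) u p := hu.mdifferentiableAt one_ne_zero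
    have hVd : MDifferentiableAt (𝓡∂ (n + 1)) 𝓘(ℝ, ℝ) D.V p :=
      (D.contMDiffOn_V.contMDiffAt (isOpen_manifold_interior.mem_nhds hpi)).mdifferentiableAt
        one_ne_zero
    have hed : MDifferentiableAt (𝓡∂ (n + 1)) 𝓘(ℝ, ℝ) (fun q => Real.exp (D.V q)) p :=
      Real.differentiableAt_exp.mdifferentiableAt.comp p hVd
    rw [grad_mul hud hed, grad_comp (Real.hasDerivAt_exp _) hVd, inner_add_left,
      inner_smul_left, inner_smul_left, inner_smul_left,
      ← laplacian_eq_chartLaplacian hp hpi hA.contMDiff]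
    have hL : -(laplacian n h p + inner ℝ (grad n D.V p) (grad n h p)) ≤ D.negPartLV h p :=
      le_max_left _ _
    have := mul_le_mul_of_nonneg_left hL (mul_nonneg (hu0 p) (Real.exp_pos (D.V p)).le)
    simp only [conj_trivial]
    linarith

/-- Green's inequality `∫ u e^V dΛ_∂ ≤ ∫ (u (L_V h)⁻ - ⟨∇u, ∇h⟩) e^V dΛ` for `u ≥ 0`, by a partition
of unity. -/
theorem integral_exp_boundary_le {h u : M → ℝ} (hA : D.AssumptionA h)
    (hu : ContMDiff (𝓡∂ (n + 1)) 𝓘(ℝ, ℝ) 1 u) (hus : HasCompactSupport u) (hu0 : ∀ p, 0 ≤ u p) :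
    Integrable (fun p => u p * Real.exp (D.V p)) (boundaryMeasure n M) ∧
    Integrable (fun p => (u p * D.negPartLV h p - inner ℝ (grad n u p) (grad n h p)) *
      Real.exp (D.V p)) (volumeMeasure n M) ∧
    ∫ p, u p * Real.exp (D.V p) ∂(boundaryMeasure n M) ≤
      ∫ p, (u p * D.negPartLV h p - inner ℝ (grad n u p) (grad n h p)) *
        Real.exp (D.V p) ∂(volumeMeasure n M) := by
  obtain ⟨s, v, hv, hvs, hv0, hvx, rfl⟩ := exists_finset_sum_chart_support hu hus hu0
  have key := fun x => D.integral_exp_boundary_le_of_chart_support hA (hv x) (hvs x) (hv0 x) (hvx x)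
  have h1 : (fun p => (∑ x ∈ s, v x p) * Real.exp (D.V p)) =
      fun p => ∑ x ∈ s, v x p * Real.exp (D.V p) := by
    ext p
    rw [Finset.sum_mul]
  have h2 : (fun p => ((∑ x ∈ s, v x p) * D.negPartLV h p -
        inner ℝ (grad n (fun q => ∑ x ∈ s, v x q) p) (grad n h p)) * Real.exp (D.V p)) =
      fun p => ∑ x ∈ s, (v x p * D.negPartLV h p - inner ℝ (grad n (v x) p) (grad n h p)) *
        Real.exp (D.V p) := by
    ext p
    rw [(grad_sum s fun x => (hv x).mdifferentiableAt one_ne_zero).2, sum_inner, Finset.sum_mul,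
      ← Finset.sum_sub_distrib, Finset.sum_mul]
  rw [h1, h2, integral_finsetSum _ fun x _ => (key x).1,
    integral_finsetSum _ fun x _ => (key x).2.1]
  exact ⟨integrable_finsetSum _ fun x _ => (key x).1, integrable_finsetSum _ fun x _ => (key x).2.1,
    Finset.sum_le_sum fun x _ => (key x).2.2⟩

end Data

/-! ### The gradient on the boundary -/

section BoundaryGradient

variable {n : ℕ} {M : Type*} [TopologicalSpace M] [ChartedSpace (EuclideanHalfSpace (n + 1)) M]

variable [IsManifold (𝓡∂ (n + 1)) ∞ M]

/-- Tangent vectors are identified with elements of `ℝⁿ⁺¹` by the chart at their base point. -/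
lemma boundaryCovector_apply (p : M) (v : EuclideanSpace ℝ (Fin (n + 1))) :
    boundaryCovector n p v = v 0 := by
  set φ := extChartAt (𝓡∂ (n + 1)) p with hφ
  have h1 : MDifferentiableAt (𝓡∂ (n + 1)) 𝓘(ℝ, ℝ) (fun q : M => φ q 0) p :=
    ((EuclideanSpace.proj 0 : EuclideanSpace ℝ (Fin (n + 1)) →L[ℝ] ℝ).differentiableAt
      |>.mdifferentiableAt).comp _ (mdifferentiableAt_extChartAt (mem_chart_source _ p))
  have hT := φ.map_source (mem_extChartAt_source p)
  have h2 : HasFDerivWithinAt (writtenInExtChartAt (𝓡∂ (n + 1)) 𝓘(ℝ, ℝ) p fun q : M => φ q 0)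
      (EuclideanSpace.proj 0 : EuclideanSpace ℝ (Fin (n + 1)) →L[ℝ] ℝ) (range (𝓡∂ (n + 1)))
      (φ p) := by
    refine (ContinuousLinearMap.hasFDerivWithinAt _).congr_of_eventuallyEq ?_ ?_
    · filter_upwards [extChartAt_target_mem_nhdsWithin (I := 𝓡∂ (n + 1)) p] with y hy
      show φ (φ.symm y) 0 = y 0
      rw [φ.right_inv hy]
    · show φ (φ.symm (φ p)) 0 = φ p 0
      rw [φ.right_inv hT]
  have h3 := h2.fderivWithin ((𝓡∂ (n + 1)).uniqueDiffOn _ (extChartAt_target_subset_range p hT))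
  have h4 := h1.mfderiv
  exact congrArg (fun L : EuclideanSpace ℝ (Fin (n + 1)) →L[ℝ] ℝ => L v) (h4.trans h3)

/-- The derivative within the boundary is determined in the directions tangent to the boundary. -/
lemma eqOn_of_hasMFDerivWithinAt_boundary {f : M → ℝ} {p : M} (hp : p ∈ (𝓡∂ (n + 1)).boundary M)
    {L L' : TangentSpace (𝓡∂ (n + 1)) p →L[ℝ] ℝ}
    (hL : HasMFDerivWithinAt (𝓡∂ (n + 1)) 𝓘(ℝ, ℝ) f ((𝓡∂ (n + 1)).boundary M) p L)
    (hL' : HasMFDerivWithinAt (𝓡∂ (n + 1)) 𝓘(ℝ, ℝ) f ((𝓡∂ (n + 1)).boundary M) p L')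
    {v : TangentSpace (𝓡∂ (n + 1)) p} (hv : v ∈ boundaryTangent n p) : L v = L' v := by
  set φ := extChartAt (𝓡∂ (n + 1)) p with hφ
  -- the line in the direction `v` stays in the boundary hyperplane of the chart
  set w : EuclideanSpace ℝ (Fin (n + 1)) := v with hw
  have hw0 : w 0 = 0 := (boundaryCovector_apply p w).symm.trans hv
  have hp0 : φ p 0 = 0 := (extChartAt_mem_boundary_iff (mem_extChartAt_source p)).1 hp
  set c : ℝ → EuclideanSpace ℝ (Fin (n + 1)) := fun t => φ p + t • w with hc
  have hcd : HasDerivAt c w 0 := by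
    have := ((hasDerivAt_id (0 : ℝ)).smul_const w).const_add (φ p)
    rwa [one_smul] at this
  have hc0 : c 0 = φ p := by simp [hc]
  obtain ⟨O, hO, hTO⟩ := exists_isOpen_target_eq (n := n) p
  have hpO : φ p ∈ O := by
    have := φ.map_source (mem_extChartAt_source p)
    rw [hφ, hTO] at this
    exact this.1
  have hev : ∀ᶠ t in 𝓝 (0 : ℝ), c t ∈ φ.symm ⁻¹' (𝓡∂ (n + 1)).boundary M ∩ range (𝓡∂ (n + 1)) := by
    have hcO : c ⁻¹' O ∈ 𝓝 (0 : ℝ) :=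
      hcd.continuousAt.preimage_mem_nhds (by rw [hc0]; exact hO.mem_nhds hpO)
    filter_upwards [hcO] with t ht
    have ht0 : c t 0 = 0 := by simp [hc, hp0, hw0]
    have htT : c t ∈ φ.target := by
      rw [hφ, hTO]
      exact ⟨ht, ht0.ge⟩
    exact ⟨(symm_mem_boundary_iff htT).2 ht0, mem_range_model_iff.2 ht0.ge⟩
  have key : ∀ K : TangentSpace (𝓡∂ (n + 1)) p →L[ℝ] ℝ,
      HasMFDerivWithinAt (𝓡∂ (n + 1)) 𝓘(ℝ, ℝ) f ((𝓡∂ (n + 1)).boundary M) p K →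
      HasDerivAt (writtenInExtChartAt (𝓡∂ (n + 1)) 𝓘(ℝ, ℝ) p f ∘ c) (K v) 0 := by
    intro K hK
    have h2 : HasFDerivWithinAt (writtenInExtChartAt (𝓡∂ (n + 1)) 𝓘(ℝ, ℝ) p f)
        (K : EuclideanSpace ℝ (Fin (n + 1)) →L[ℝ] ℝ)
        (φ.symm ⁻¹' (𝓡∂ (n + 1)).boundary M ∩ range (𝓡∂ (n + 1))) (c 0) := by
      rw [hc0]
      exact hK.2
    exact h2.comp_hasDerivAt 0 hcd hev
  exact (key L hL).unique (key L' hL')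

/-- A `C¹` function on the manifold is differentiable within the boundary, so by uniqueness its
boundary differential is the restriction of its differential to the tangent vectors of the
boundary. -/
lemma boundaryDifferential_apply {f : M → ℝ} {p : M} (hp : p ∈ (𝓡∂ (n + 1)).boundary M)
    (hf : MDifferentiableAt (𝓡∂ (n + 1)) 𝓘(ℝ, ℝ) f p) (v : boundaryTangent n p) :
    boundaryDifferential n f p v = differential n f p v :=
  eqOn_of_hasMFDerivWithinAt_boundary hp hf.mdifferentiableWithinAt.hasMFDerivWithinAt
    hf.hasMFDerivAt.hasMFDerivWithinAt v.2

variable [RiemannianBundle (fun x : M => TangentSpace (𝓡∂ (n + 1)) x)]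

/-- The boundary gradient is the orthogonal projection of the gradient to the tangent space of the
boundary. -/
lemma inner_boundaryGrad {f : M → ℝ} {p : M} (hp : p ∈ (𝓡∂ (n + 1)).boundary M)
    (hf : MDifferentiableAt (𝓡∂ (n + 1)) 𝓘(ℝ, ℝ) f p) (v : boundaryTangent n p) :
    inner ℝ (boundaryGrad n f p) v = inner ℝ (grad n f p) (v : TangentSpace (𝓡∂ (n + 1)) p) := by
  rw [inner_grad_left, boundaryGrad, InnerProductSpace.toDual_symm_apply,
    boundaryDifferential_apply hp hf]

lemma norm_boundaryGrad_le {f : M → ℝ} {p : M} (hp : p ∈ (𝓡∂ (n + 1)).boundary M)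
    (hf : MDifferentiableAt (𝓡∂ (n + 1)) 𝓘(ℝ, ℝ) f p) :
    ‖boundaryGrad n f p‖ ≤ ‖grad n f p‖ := by
  have h1 := inner_boundaryGrad hp hf (boundaryGrad n f p)
  rw [real_inner_self_eq_norm_sq] at h1
  have h2 := real_inner_le_norm (grad n f p) (boundaryGrad n f p : TangentSpace (𝓡∂ (n + 1)) p)
  rw [← h1, Submodule.coe_norm, sq] at h2
  rw [Submodule.coe_norm]
  by_contra hlt
  rw [not_le] at hlt
  have h0 := (norm_nonneg _).trans_lt hlt
  nlinarith

lemma boundaryGrad_sub_const {f : M → ℝ} {p : M} (hp : p ∈ (𝓡∂ (n + 1)).boundary M)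
    (hf : MDifferentiable (𝓡∂ (n + 1)) 𝓘(ℝ, ℝ) f) (c : ℝ) :
    boundaryGrad n (fun q => f q - c) p = boundaryGrad n f p := by
  refine ext_inner_right ℝ fun v => ?_
  have h1 : MDifferentiableAt (𝓡∂ (n + 1)) 𝓘(ℝ, ℝ) (fun q => f q - c) p :=
    (hf p).sub mdifferentiableAt_const
  rw [inner_boundaryGrad hp h1, inner_boundaryGrad hp (hf p), grad_sub_const hf]

lemma Cb1_subset_boundaryCb1 : Cb1 n M ⊆ boundaryCb1 n M := by
  rintro f ⟨hf, C, hC⟩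
  exact ⟨hf.contMDiffOn, C, fun p hp => ⟨(hC p).1,
    (norm_boundaryGrad_le hp (hf.mdifferentiableAt one_ne_zero)).trans (hC p).2⟩⟩

omit [IsManifold (𝓡∂ (n + 1)) ∞ M] in
lemma sub_const_mem_Cb1 {f : M → ℝ} (hf : f ∈ Cb1 n M) (c : ℝ) :
    (fun p => f p - c) ∈ Cb1 n M := by
  obtain ⟨hf, C, hC⟩ := hf
  refine ⟨hf.sub contMDiff_const, C + |c|, fun p => ⟨?_, ?_⟩⟩
  · exact (abs_sub _ _).trans (by linarith [(hC p).1])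
  · rw [grad_sub_const (hf.mdifferentiable one_ne_zero)]
    exact (hC p).2.trans (le_add_of_nonneg_right (abs_nonneg c))

end BoundaryGradient

/-! ### The boundary mean is controlled by the interior -/

section CauchySchwarz

variable {X : Type*} [MeasurableSpace X] {ν : Measure X}

lemma toReal_eLpNorm_two {a : X → ℝ} (ha : MemLp a 2 ν) :
    (eLpNorm a 2 ν).toReal = Real.sqrt (∫ x, a x ^ 2 ∂ν) := by
  rw [ha.eLpNorm_eq_integral_rpow_norm two_ne_zero ENNReal.ofNat_ne_top, ENNReal.toReal_ofReal
    (by positivity), Real.sqrt_eq_rpow]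
  simp

lemma integral_mul_le_sqrt_mul_sqrt {a b : X → ℝ} (ha : MemLp a 2 ν) (hb : MemLp b 2 ν)
    (ha0 : ∀ x, 0 ≤ a x) (hb0 : ∀ x, 0 ≤ b x) :
    ∫ x, a x * b x ∂ν ≤ Real.sqrt (∫ x, a x ^ 2 ∂ν) * Real.sqrt (∫ x, b x ^ 2 ∂ν) := by
  have h := integral_mul_le_Lp_mul_Lq_of_nonneg Real.HolderConjugate.two_two
    (ae_of_all ν ha0) (ae_of_all ν hb0) (by simpa using ha) (by simpa using hb)
  simpa [Real.sqrt_eq_rpow] using h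

end CauchySchwarz

section GradBound

variable {n : ℕ} {M : Type*} [TopologicalSpace M] [ChartedSpace (EuclideanHalfSpace (n + 1)) M]
  [IsManifold (𝓡∂ (n + 1)) ∞ M] [RiemannianBundle (fun x : M => TangentSpace (𝓡∂ (n + 1)) x)]
  [IsContMDiffRiemannianBundle (𝓡∂ (n + 1)) ∞ (EuclideanSpace ℝ (Fin (n + 1)))
    (fun x : M => TangentSpace (𝓡∂ (n + 1)) x)]

lemma exists_norm_grad_le {u : M → ℝ} (hu : ContMDiff (𝓡∂ (n + 1)) 𝓘(ℝ, ℝ) 1 u)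
    (hus : HasCompactSupport u) : ∃ C, ∀ p, ‖grad n u p‖ ≤ C := by
  have hcs : HasCompactSupport fun p => ‖grad n u p‖ := by
    refine hus.of_isClosed_subset (isClosed_tsupport _) (closure_minimal (fun p hp => ?_)
      (isClosed_tsupport u))
    by_contra hpu
    refine hp ?_
    have := inner_grad_eq_zero_of_notMem_tsupport (n := n) (h := u) hpu
    rw [inner_self_eq_zero] at this
    simp only [this, norm_zero]
  obtain ⟨C, hC⟩ := hcs.exists_bound_of_continuous (continuous_norm_grad hu)
  exact ⟨C, fun p => by simpa using hC p⟩

end GradBound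

section Cutoff

/-- The function `φ(t) = sin²(π t / 2)` on the line. It satisfies `φ(0) = 0`, `φ(1) = 1`,
`0 ≤ φ ≤ 1` and has a bounded derivative, so that `φ ∘ χ` is a cutoff function with values in
`[0, 1]` for every `χ ∈ C_0^2`. -/
def sinCutoff (t : ℝ) : ℝ := Real.sin (Real.pi / 2 * t) ^ 2

lemma sinCutoff_zero : sinCutoff 0 = 0 := by simp [sinCutoff]

lemma sinCutoff_nonneg (t : ℝ) : 0 ≤ sinCutoff t := sq_nonneg _

lemma sinCutoff_le_one (t : ℝ) : sinCutoff t ≤ 1 := Real.sin_sq_le_one _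

lemma contDiff_sinCutoff : ContDiff ℝ ∞ sinCutoff :=
  (Real.contDiff_sin.comp (contDiff_const.mul contDiff_id)).pow 2

lemma exists_hasDerivAt_sinCutoff (t : ℝ) :
    ∃ c, |c| ≤ Real.pi ∧ HasDerivAt sinCutoff c t := by
  have h := (((hasDerivAt_id t).const_mul (Real.pi / 2)).sin).pow 2
  refine ⟨_, ?_, h⟩
  have h1 := Real.abs_sin_le_one (Real.pi / 2 * t)
  have h2 := Real.abs_cos_le_one (Real.pi / 2 * t)
  have h3 := mul_le_one₀ h1 (abs_nonneg _) h2
  simp only [id, Nat.cast_ofNat, mul_one, abs_mul, abs_div, abs_of_pos Real.pi_pos,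
    Nat.add_one_sub_one, pow_one, abs_two]
  nlinarith [Real.pi_pos]

/-- The cutoff `φ` is quadratically close to `1` near its maximum `t = 1`, so that `1 - φ(χ)` is
small in `L¹` when `χ - 1` is small in `L²`. -/
lemma one_sub_sinCutoff_le (t : ℝ) : 1 - sinCutoff t ≤ Real.pi ^ 2 * (t - 1) ^ 2 := by
  have h1 : 1 - sinCutoff t = Real.sin (Real.pi / 2 * (t - 1)) ^ 2 := by
    have : Real.pi / 2 * (t - 1) = Real.pi / 2 * t - Real.pi / 2 := by ring
    rw [this, Real.sin_sub_pi_div_two, neg_sq, sinCutoff, Real.cos_sq']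
  have h2 : Real.sin (Real.pi / 2 * (t - 1)) ^ 2 ≤ (Real.pi / 2 * (t - 1)) ^ 2 :=
    sq_le_sq.2 Real.abs_sin_le_abs
  rw [h1]
  nlinarith [sq_nonneg (Real.pi * (t - 1))]

/-- The approximation `(t² + ε²)^{1/2}` of the absolute value, smooth for `ε > 0`. -/
def smoothAbs (ε t : ℝ) : ℝ := Real.sqrt (t ^ 2 + ε ^ 2)

lemma contDiff_smoothAbs {ε : ℝ} (hε : 0 < ε) : ContDiff ℝ ∞ (smoothAbs ε) :=
  ((contDiff_id.pow 2).add contDiff_const).sqrt fun t => by positivity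

lemma smoothAbs_nonneg (ε t : ℝ) : 0 ≤ smoothAbs ε t := Real.sqrt_nonneg _

lemma sq_smoothAbs (ε t : ℝ) : smoothAbs ε t ^ 2 = t ^ 2 + ε ^ 2 := Real.sq_sqrt (by positivity)

lemma abs_le_smoothAbs (ε t : ℝ) : |t| ≤ smoothAbs ε t :=
  Real.abs_le_sqrt (le_add_of_nonneg_right (sq_nonneg ε))

lemma smoothAbs_le {ε : ℝ} (hε : 0 < ε) (t : ℝ) : smoothAbs ε t ≤ |t| + ε := by
  refine Real.sqrt_le_iff.2 ⟨by positivity, ?_⟩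
  rw [← sq_abs t]
  nlinarith [abs_nonneg t]

lemma exists_hasDerivAt_smoothAbs {ε : ℝ} (hε : 0 < ε) (t : ℝ) :
    ∃ c, |c| ≤ 1 ∧ HasDerivAt (smoothAbs ε) c t := by
  have h0 : t ^ 2 + ε ^ 2 ≠ 0 := by positivity
  have h := (((hasDerivAt_id t).pow 2).add_const (ε ^ 2)).sqrt h0
  refine ⟨_, ?_, h⟩
  have h1 := abs_le_smoothAbs ε t
  have h2 : 0 < smoothAbs ε t := Real.sqrt_pos.2 (by positivity)
  have h3 : |(2 * smoothAbs ε t)| = 2 * smoothAbs ε t := abs_of_pos (by positivity)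
  rw [abs_div]
  refine div_le_one_of_le₀ ?_ (abs_nonneg _)
  refine le_of_le_of_eq ?_ h3.symm
  simpa [abs_mul] using h1

end Cutoff

namespace Data

variable {n : ℕ} {M : Type*} [TopologicalSpace M] [ChartedSpace (EuclideanHalfSpace (n + 1)) M]
  [RiemannianBundle (fun x : M => TangentSpace (𝓡∂ (n + 1)) x)] [MeasurableSpace M]

section Nonneg

variable (D : Data n M)

lemma energyV_nonneg (f : M → ℝ) : 0 ≤ D.energyV f := integral_nonneg fun _ => sq_nonneg _

lemma energyW_nonneg (f : M → ℝ) : 0 ≤ D.energyW f := integral_nonneg fun _ => sq_nonneg _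

end Nonneg

variable [BorelSpace M] [IsManifold (𝓡∂ (n + 1)) ∞ M]
  [IsContMDiffRiemannianBundle (𝓡∂ (n + 1)) ∞ (EuclideanSpace ℝ (Fin (n + 1)))
    (fun x : M => TangentSpace (𝓡∂ (n + 1)) x)] (D : Data n M)

lemma integrable_μ_iff {f : M → ℝ} : Integrable f D.μ ↔ Integrable f D.μV ∧ Integrable f D.μW := by
  rw [μ, integrable_add_measure,
    integrable_smul_measure (ENNReal.ofReal_pos.2 D.θ_pos).ne' ENNReal.ofReal_ne_top,
    integrable_smul_measure (ENNReal.ofReal_pos.2 D.one_sub_θ_pos).ne' ENNReal.ofReal_ne_top]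

lemma integral_μ {f : M → ℝ} (hV : Integrable f D.μV) (hW : Integrable f D.μW) :
    ∫ x, f x ∂D.μ = D.θ * ∫ x, f x ∂D.μV + (1 - D.θ) * ∫ x, f x ∂D.μW := by
  rw [μ, integral_add_measure (hV.smul_measure ENNReal.ofReal_ne_top)
    (hW.smul_measure ENNReal.ofReal_ne_top), integral_smul_measure, integral_smul_measure,
    ENNReal.toReal_ofReal D.θ_pos.le, ENNReal.toReal_ofReal D.one_sub_θ_pos.le]
  rfl

lemma memLp_grad {h : M → ℝ} (hA : D.AssumptionA h) :
    MemLp (fun x => ‖grad n h x‖) 2 D.μV := by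
  have hc := continuous_norm_grad (hA.contMDiff.of_le one_le_two)
  rw [memLp_two_iff_integrable_sq hc.aestronglyMeasurable]
  exact (D.integrable_μ_iff.1 hA.grad_memLp.integrable_sq).1

lemma C₀_nonneg : 0 ≤ D.C₀ :=
  div_nonneg (mul_nonneg D.ZV_pos.le (Real.exp_pos _).le) D.ZW_pos.le

variable [T2Space M] [SecondCountableTopology M]

/-- Green's inequality for the probability measures `μ_V` and `μ_W^∂`. The constant `C₀` converts
`e^V` on the boundary into `e^W` and accounts for the normalisation. -/
lemma integral_μW_le {h u : M → ℝ} (hA : D.AssumptionA h)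
    (hu : ContMDiff (𝓡∂ (n + 1)) 𝓘(ℝ, ℝ) 1 u) (hus : HasCompactSupport u) (hu0 : ∀ p, 0 ≤ u p) :
    ∫ p, u p ∂D.μW ≤
      D.C₀ * ∫ p, (u p * D.negPartLV h p + ‖grad n u p‖ * ‖grad n h p‖) ∂D.μV := by
  obtain ⟨h1, h2, h3⟩ := D.integral_exp_boundary_le hA hu hus hu0
  set S := supNormOn ((𝓡∂ (n + 1)).boundary M) fun x => max (D.W x - D.V x) 0 with hS
  have hWV : ∀ p ∈ (𝓡∂ (n + 1)).boundary M, D.W p ≤ S + D.V p := fun p hp => by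
    have hb : BddAbove ((fun x => |max (D.W x - D.V x) 0|) '' (𝓡∂ (n + 1)).boundary M) := by
      simpa only [abs_of_nonneg (le_max_right (D.W _ - D.V _) 0)] using hA.bddAbove
    have := le_csSup hb (mem_image_of_mem _ hp)
    have h4 := (le_max_left (D.W p - D.V p) 0).trans (le_abs_self _)
    have h5 : |max (D.W p - D.V p) 0| ≤ S := this
    linarith
  have h4 : ∫ p, u p * Real.exp (D.W p) ∂(boundaryMeasure n M) ≤
      Real.exp S * ∫ p, u p * Real.exp (D.V p) ∂(boundaryMeasure n M) := by
    rw [← integral_const_mul]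
    refine integral_mono_of_nonneg (ae_of_all _ fun p => mul_nonneg (hu0 p) (Real.exp_pos _).le)
      (h1.const_mul _) ?_
    filter_upwards [mem_ae_iff.2 (boundaryMeasure_compl_boundary (n := n) (M := M))] with p hp
    have := Real.exp_le_exp.2 (hWV p hp)
    rw [Real.exp_add] at this
    have := mul_le_mul_of_nonneg_left this (hu0 p)
    linarith
  have h5 : ∫ p, (u p * D.negPartLV h p - inner ℝ (grad n u p) (grad n h p)) ∂D.μV ≤
      ∫ p, (u p * D.negPartLV h p + ‖grad n u p‖ * ‖grad n h p‖) ∂D.μV := by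
    refine integral_mono (D.integrable_μV_iff.2 h2) ((D.integrable_mul_negPartLV hA hu hus).add ?_)
      fun p => ?_
    · obtain ⟨C, hC⟩ := exists_norm_grad_le hu hus
      exact ((D.memLp_grad hA).integrable one_le_two).bdd_mul
        (continuous_norm_grad hu).aestronglyMeasurable (ae_of_all _ fun p => by simpa using hC p)
    · have := (abs_le.1 (abs_real_inner_le_norm (grad n u p) (grad n h p))).1
      show _ - _ ≤ _ + _
      linarith
  rw [integral_μV] at h5
  have hW := D.ZW_pos
  have hV := D.ZV_pos
  rw [integral_μW, C₀, div_mul_eq_mul_div]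
  refine div_le_div_of_nonneg_right ?_ hW.le
  rw [div_le_iff₀ hV] at h5
  calc _ ≤ _ := h4
    _ ≤ Real.exp S * _ := mul_le_mul_of_nonneg_left (h3.trans h5) (Real.exp_pos _).le
    _ = _ := by ring

end Data

namespace Data

variable {n : ℕ} {M : Type*} [TopologicalSpace M] [T2Space M] [SecondCountableTopology M]
  [MeasurableSpace M] [BorelSpace M] [ChartedSpace (EuclideanHalfSpace (n + 1)) M]
  [IsManifold (𝓡∂ (n + 1)) ∞ M] [RiemannianBundle (fun x : M => TangentSpace (𝓡∂ (n + 1)) x)]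
  [IsContMDiffRiemannianBundle (𝓡∂ (n + 1)) ∞ (EuclideanSpace ℝ (Fin (n + 1)))
    (fun x : M => TangentSpace (𝓡∂ (n + 1)) x)] (D : Data n M)

/-- The boundary estimate with the regularisation `ε` of the absolute value and the cutoff `φ(χ)`:
Green's inequality for `u = (g² + ε²)^{1/2} φ(χ)`, followed by the Cauchy–Schwarz inequality. -/
lemma integral_abs_μW_le_add {h g χ : M → ℝ} {K ε : ℝ} (hA : D.AssumptionA h)
    (hg : ContMDiff (𝓡∂ (n + 1)) 𝓘(ℝ, ℝ) 1 g) (hK : ∀ p, |g p| ≤ K ∧ ‖grad n g p‖ ≤ K)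
    (hχ : χ ∈ C02 n M) (hε : 0 < ε) :
    ∫ p, |g p| ∂D.μW ≤
      D.C₀ * (D.C₁ h * Real.sqrt (∫ p, g p ^ 2 ∂D.μV + ε ^ 2) + D.C₂ h * Real.sqrt (D.energyV g) +
        (K + ε) * Real.pi * (D.C₂ h * Real.sqrt (D.energyV χ))) +
      (K + ε) * Real.pi ^ 2 * ∫ p, (χ p - 1) ^ 2 ∂D.μW := by
  obtain ⟨hχ2, hχs⟩ := hχ
  have hχ1 := hχ2.of_le one_le_two
  have hK0 : 0 ≤ K := by
    obtain ⟨p, -⟩ := D.boundary_nonempty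
    exact (abs_nonneg _).trans (hK p).1
  have hKε : 0 ≤ K + ε := by positivity
  have hψ : ContMDiff (𝓡∂ (n + 1)) 𝓘(ℝ, ℝ) 1 fun p => smoothAbs ε (g p) :=
    ((contDiff_smoothAbs hε).of_le (by exact_mod_cast le_top)).contMDiff.comp hg
  have hφ : ContMDiff (𝓡∂ (n + 1)) 𝓘(ℝ, ℝ) 1 fun p => sinCutoff (χ p) :=
    (contDiff_sinCutoff.of_le (by exact_mod_cast le_top)).contMDiff.comp hχ1
  have hφs : HasCompactSupport fun p => sinCutoff (χ p) := hχs.comp_left sinCutoff_zero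
  have hψK : ∀ p, smoothAbs ε (g p) ≤ K + ε := fun p =>
    (smoothAbs_le hε _).trans (by linarith [(hK p).1])
  set u : M → ℝ := fun p => smoothAbs ε (g p) * sinCutoff (χ p) with hu
  have hu1 : ContMDiff (𝓡∂ (n + 1)) 𝓘(ℝ, ℝ) 1 u := hψ.mul hφ
  have hus : HasCompactSupport u := hφs.mul_left
  have hu0 : ∀ p, 0 ≤ u p := fun p => mul_nonneg (smoothAbs_nonneg _ _) (sinCutoff_nonneg _)
  obtain ⟨Cχ, hCχ⟩ := exists_norm_grad_le hχ1 hχs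
  obtain ⟨Kχ, hKχ⟩ := hχs.exists_bound_of_continuous hχ1.continuous
  have hgu : ∀ p, ‖grad n u p‖ ≤ ‖grad n g p‖ + (K + ε) * Real.pi * ‖grad n χ p‖ := by
    intro p
    obtain ⟨a, ha, hda⟩ := exists_hasDerivAt_smoothAbs hε (g p)
    obtain ⟨b, hb, hdb⟩ := exists_hasDerivAt_sinCutoff (χ p)
    rw [hu, grad_mul (hψ.mdifferentiableAt one_ne_zero) (hφ.mdifferentiableAt one_ne_zero),
      grad_comp hda (hg.mdifferentiableAt one_ne_zero),
      grad_comp hdb (hχ1.mdifferentiableAt one_ne_zero)]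
    refine (norm_add_le _ _).trans ?_
    rw [norm_smul, norm_smul, norm_smul, norm_smul, Real.norm_of_nonneg (smoothAbs_nonneg _ _),
      Real.norm_of_nonneg (sinCutoff_nonneg _), Real.norm_eq_abs, Real.norm_eq_abs, add_comm]
    refine add_le_add ?_ ?_
    · calc _ ≤ 1 * (1 * ‖grad n g p‖) := by
            gcongr
            exact sinCutoff_le_one _
        _ = _ := by ring
    · rw [mul_assoc]
      gcongr
      exact hψK p
  -- square integrability of the factors
  have mψ : MemLp (fun p => smoothAbs ε (g p)) 2 D.μV :=
    MemLp.of_bound hψ.continuous.aestronglyMeasurable (K + ε) (ae_of_all _ fun p => by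
      rw [Real.norm_of_nonneg (smoothAbs_nonneg _ _)]; exact hψK p)
  have mg : MemLp (fun p => ‖grad n g p‖) 2 D.μV :=
    MemLp.of_bound (continuous_norm_grad hg).aestronglyMeasurable K (ae_of_all _ fun p => by
      rw [norm_norm]; exact (hK p).2)
  have mχ : MemLp (fun p => ‖grad n χ p‖) 2 D.μV :=
    MemLp.of_bound (continuous_norm_grad hχ1).aestronglyMeasurable Cχ (ae_of_all _ fun p => by
      rw [norm_norm]; exact hCχ p)
  have mh := D.memLp_grad hA
  have i1 : Integrable (fun p => smoothAbs ε (g p) * D.negPartLV h p) D.μV :=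
    mψ.integrable_mul hA.LV_memLp
  have i2 : Integrable (fun p => ‖grad n g p‖ * ‖grad n h p‖) D.μV := mg.integrable_mul mh
  have i3 : Integrable (fun p => ‖grad n χ p‖ * ‖grad n h p‖) D.μV := mχ.integrable_mul mh
  have hneg0 : ∀ p, 0 ≤ D.negPartLV h p := fun p => le_max_right _ _
  have c1 := integral_mul_le_sqrt_mul_sqrt mψ hA.LV_memLp (fun p => smoothAbs_nonneg _ _) hneg0
  have c2 := integral_mul_le_sqrt_mul_sqrt mg mh (fun p => norm_nonneg _) fun p => norm_nonneg _
  have c3 := integral_mul_le_sqrt_mul_sqrt mχ mh (fun p => norm_nonneg _) fun p => norm_nonneg _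
  rw [← toReal_eLpNorm_two hA.LV_memLp] at c1
  rw [← toReal_eLpNorm_two mh] at c2 c3
  have ig2 : Integrable (fun p => g p ^ 2) D.μV :=
    Integrable.of_bound (hg.continuous.pow 2).aestronglyMeasurable (K ^ 2) (ae_of_all _ fun p => by
      rw [Real.norm_eq_abs, abs_pow]; exact pow_le_pow_left₀ (abs_nonneg _) (hK p).1 2)
  have e1 : ∫ p, smoothAbs ε (g p) ^ 2 ∂D.μV = ∫ p, g p ^ 2 ∂D.μV + ε ^ 2 := by
    simp only [sq_smoothAbs]
    rw [integral_add ig2 (integrable_const _)]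
    simp
  rw [e1] at c1
  have hR : ∫ p, (u p * D.negPartLV h p + ‖grad n u p‖ * ‖grad n h p‖) ∂D.μV ≤
      D.C₁ h * Real.sqrt (∫ p, g p ^ 2 ∂D.μV + ε ^ 2) + D.C₂ h * Real.sqrt (D.energyV g) +
        (K + ε) * Real.pi * (D.C₂ h * Real.sqrt (D.energyV χ)) := by
    have h1 : ∫ p, (u p * D.negPartLV h p + ‖grad n u p‖ * ‖grad n h p‖) ∂D.μV ≤
        ∫ p, (smoothAbs ε (g p) * D.negPartLV h p + ‖grad n g p‖ * ‖grad n h p‖ +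
          (K + ε) * Real.pi * (‖grad n χ p‖ * ‖grad n h p‖)) ∂D.μV := by
      refine integral_mono_of_nonneg (ae_of_all _ fun p => add_nonneg
        (mul_nonneg (hu0 p) (hneg0 p)) (by positivity)) ((i1.add i2).add (i3.const_mul _))
        (ae_of_all _ fun p => ?_)
      have h2 := mul_le_mul_of_nonneg_right (hgu p) (norm_nonneg (grad n h p))
      have h3 : u p ≤ smoothAbs ε (g p) :=
        mul_le_of_le_one_right (smoothAbs_nonneg _ _) (sinCutoff_le_one _)
      have h4 := mul_le_mul_of_nonneg_right h3 (hneg0 p)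
      show _ ≤ _
      linarith
    have i12 : Integrable (fun p => smoothAbs ε (g p) * D.negPartLV h p +
        ‖grad n g p‖ * ‖grad n h p‖) D.μV := i1.add i2
    rw [integral_add i12 (i3.const_mul _), integral_add i1 i2, integral_const_mul] at h1
    have h5 := mul_le_mul_of_nonneg_left c3 (mul_nonneg hKε Real.pi_pos.le)
    simp only [C₁, C₂, energyV]
    linarith
  have hu_le := (D.integral_μW_le hA hu1 hus hu0).trans
    (mul_le_mul_of_nonneg_left hR D.C₀_nonneg)
  have iu : Integrable u D.μW :=
    Integrable.of_bound hu1.continuous.aestronglyMeasurable (K + ε) (ae_of_all _ fun p => by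
      rw [Real.norm_of_nonneg (hu0 p)]
      exact (mul_le_of_le_one_right (smoothAbs_nonneg _ _) (sinCutoff_le_one _)).trans (hψK p))
  have iχ : Integrable (fun p => (χ p - 1) ^ 2) D.μW :=
    Integrable.of_bound ((hχ1.continuous.sub continuous_const).pow 2).aestronglyMeasurable
      ((Kχ + 1) ^ 2) (ae_of_all _ fun p => by
        rw [Real.norm_eq_abs, abs_pow]
        refine pow_le_pow_left₀ (abs_nonneg _) ?_ 2
        have := hKχ p
        rw [Real.norm_eq_abs] at this
        exact (abs_sub _ _).trans (by rw [abs_one]; linarith))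
  have hL : ∫ p, |g p| ∂D.μW ≤ ∫ p, (u p + (K + ε) * Real.pi ^ 2 * (χ p - 1) ^ 2) ∂D.μW := by
    refine integral_mono_of_nonneg (ae_of_all _ fun p => abs_nonneg _) (iu.add (iχ.const_mul _))
      (ae_of_all _ fun p => ?_)
    have h1 := abs_le_smoothAbs ε (g p)
    have h2 := one_sub_sinCutoff_le (χ p)
    have h3 : smoothAbs ε (g p) * (1 - sinCutoff (χ p)) ≤
        (K + ε) * (Real.pi ^ 2 * (χ p - 1) ^ 2) :=
      mul_le_mul (hψK p) h2 (by linarith [sinCutoff_le_one (χ p)]) hKε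
    show |g p| ≤ smoothAbs ε (g p) * sinCutoff (χ p) + _
    linarith
  rw [integral_add iu (iχ.const_mul _), integral_const_mul] at hL
  linarith

/-- The boundary mean is controlled by the interior: this is how the reflection couples the
two parts of the diffusion. The bound `integral_abs_μW_le_add` is applied to the functions `χ_k` of
the conservativity; its last two terms vanish as `k → ∞`, and then `ε → 0`. -/
theorem integral_abs_μW_le {h g : M → ℝ} (hA : D.AssumptionA h) (hD : D.Conservative)
    (hg : g ∈ Cb1 n M) :
    ∫ p, |g p| ∂D.μW ≤
      D.C₀ * (D.C₁ h * Real.sqrt (∫ p, g p ^ 2 ∂D.μV) + D.C₂ h * Real.sqrt (D.energyV g)) := by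
  obtain ⟨hg1, K, hK⟩ := hg
  obtain ⟨χ, hχ, hχ1, hχE⟩ := hD
  have hθ := D.θ_pos
  have hθ' := D.one_sub_θ_pos
  have hEV : Tendsto (fun k => D.energyV (χ k)) atTop (𝓝 0) := by
    refine squeeze_zero (fun k => D.energyV_nonneg _) (fun k => ?_)
      (by simpa using hχE.const_mul D.θ⁻¹)
    rw [inv_mul_eq_div, le_div_iff₀ hθ, energy]
    have := mul_nonneg (mul_nonneg hθ'.le D.δ_nonneg) (D.energyW_nonneg (χ k))
    linarith
  have hχW : Tendsto (fun k => ∫ p, (χ k p - 1) ^ 2 ∂D.μW) atTop (𝓝 0) := by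
    refine squeeze_zero (fun k => integral_nonneg fun p => sq_nonneg _) (fun k => ?_)
      (by simpa using hχ1.const_mul (1 - D.θ)⁻¹)
    obtain ⟨C, hC⟩ := (hχ k).2.exists_bound_of_continuous (hχ k).1.continuous
    have hb : ∀ p, ‖(χ k p - 1) ^ 2‖ ≤ (C + 1) ^ 2 := fun p => by
      rw [norm_pow]
      refine pow_le_pow_left₀ (norm_nonneg _) ((norm_sub_le _ _).trans ?_) 2
      rw [norm_one]
      linarith [hC p]
    have hm : Continuous fun p => (χ k p - 1) ^ 2 :=
      ((hχ k).1.continuous.sub continuous_const).pow 2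
    rw [inv_mul_eq_div, le_div_iff₀ hθ', D.integral_μ
      (Integrable.of_bound hm.aestronglyMeasurable _ (ae_of_all _ hb))
      (Integrable.of_bound hm.aestronglyMeasurable _ (ae_of_all _ hb))]
    have := mul_nonneg hθ.le (integral_nonneg (μ := D.μV) fun p => sq_nonneg (χ k p - 1))
    linarith
  have key : ∀ ε, 0 < ε → ∫ p, |g p| ∂D.μW ≤
      D.C₀ * (D.C₁ h * Real.sqrt (∫ p, g p ^ 2 ∂D.μV + ε ^ 2) +
        D.C₂ h * Real.sqrt (D.energyV g)) := by
    intro ε hε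
    have hlim : Tendsto (fun k => D.C₀ * (D.C₁ h * Real.sqrt (∫ p, g p ^ 2 ∂D.μV + ε ^ 2) +
        D.C₂ h * Real.sqrt (D.energyV g) +
          (K + ε) * Real.pi * (D.C₂ h * Real.sqrt (D.energyV (χ k)))) +
        (K + ε) * Real.pi ^ 2 * ∫ p, (χ k p - 1) ^ 2 ∂D.μW) atTop
        (𝓝 (D.C₀ * (D.C₁ h * Real.sqrt (∫ p, g p ^ 2 ∂D.μV + ε ^ 2) +
        D.C₂ h * Real.sqrt (D.energyV g) +
          (K + ε) * Real.pi * (D.C₂ h * Real.sqrt 0)) + (K + ε) * Real.pi ^ 2 * 0)) :=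
      (((((hEV.sqrt).const_mul _).const_mul _).const_add _).const_mul _).add (hχW.const_mul _)
    simp only [Real.sqrt_zero, mul_zero, add_zero] at hlim
    exact ge_of_tendsto' hlim fun k => D.integral_abs_μW_le_add hA hg1 hK (hχ k) hε
  have hlim : Tendsto (fun ε : ℝ => D.C₀ * (D.C₁ h * Real.sqrt (∫ p, g p ^ 2 ∂D.μV + ε ^ 2) +
        D.C₂ h * Real.sqrt (D.energyV g))) (𝓝[>] 0)
      (𝓝 (D.C₀ * (D.C₁ h * Real.sqrt (∫ p, g p ^ 2 ∂D.μV + 0 ^ 2) +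
        D.C₂ h * Real.sqrt (D.energyV g)))) := by
    refine Tendsto.mono_left (Continuous.tendsto ?_ 0) nhdsWithin_le_nhds
    fun_prop
  simp only [ne_eq, OfNat.ofNat_ne_zero, not_false_eq_true, zero_pow, add_zero] at hlim
  exact ge_of_tendsto hlim (eventually_nhdsWithin_of_forall fun ε hε => key ε hε)

end Data

/-! ### The super and weak Poincaré inequalities -/

section RealInequalities

/-- The difference of the two sides is `(θ A - (1 - θ) B)²`. -/
lemma mul_add_sq_le (θ A B : ℝ) :
    θ * (1 - θ) * (A + B) ^ 2 ≤ θ * A ^ 2 + (1 - θ) * B ^ 2 := by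
  nlinarith [sq_nonneg (θ * A - (1 - θ) * B)]

/-- The inequalities for the two components add up to one for the convex combination. Here
`v = μ_V(|f|)` and `w = μ_W^∂(|f|)`, and `(θ v)² + ((1 - θ) w)² ≤ (θ v + (1 - θ) w)² = 1`. -/
lemma weighted_super_le {θ r δ X Y v w EV EW bV bW : ℝ} (h0 : 0 < θ) (h1 : 0 < 1 - θ)
    (hv : 0 ≤ v) (hw : 0 ≤ w) (hsum : θ * v + (1 - θ) * w = 1) (hbV : 0 ≤ bV)
    (hX : X ≤ r * EV + bV * v ^ 2) (hY : Y ≤ δ * r * EW + bW * w ^ 2) :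
    θ * X + (1 - θ) * Y - r * (θ * EV + (1 - θ) * δ * EW) ≤ max (bV / θ) (bW / (1 - θ)) := by
  set B := max (bV / θ) (bW / (1 - θ)) with hB
  have hB1 : bV ≤ B * θ := (div_le_iff₀ h0).1 (le_max_left _ _)
  have hB2 : bW ≤ B * (1 - θ) := (div_le_iff₀ h1).1 (le_max_right _ _)
  have hB0 : 0 ≤ B := (div_nonneg hbV h0.le).trans (le_max_left _ _)
  have e1 : θ * (bV * v ^ 2) ≤ B * (θ * v) ^ 2 := by
    have := mul_le_mul_of_nonneg_right hB1 (mul_nonneg h0.le (sq_nonneg v))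
    nlinarith
  have e2 : (1 - θ) * (bW * w ^ 2) ≤ B * ((1 - θ) * w) ^ 2 := by
    have := mul_le_mul_of_nonneg_right hB2 (mul_nonneg h1.le (sq_nonneg w))
    nlinarith
  have e3 : B * (θ * v) ^ 2 + B * ((1 - θ) * w) ^ 2 ≤ B * (θ * v + (1 - θ) * w) ^ 2 := by
    have := mul_nonneg hB0 (mul_nonneg (mul_nonneg h0.le hv) (mul_nonneg h1.le hw))
    nlinarith
  rw [hsum, one_pow, mul_one] at e3
  have e4 := mul_le_mul_of_nonneg_left hX h0.le
  have e5 := mul_le_mul_of_nonneg_left hY h1.le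
  linarith

/-- The weak inequalities for the two components and the bound `A + B` on the difference of the
means `m = μ_V(f)`, `w = μ_W^∂(f)` give the one for the convex combination. Here `X`, `Y` are the
variances of `f` and `S` is its supremum norm. The mean of `f` being zero, the squared means
contribute `θ (1 - θ) (w - m)²`, and the weights in `mul_add_sq_le` make `A² = k X` count `θ k X`,
so that it adds to `θ X`, and `B² = q EV` count `(1 - θ) q EV`. -/
lemma weighted_weak_le {θ r δ X Y m w EV EW a₁ a₂ k q s₁ s₂ S A B : ℝ} (h0 : 0 < θ)
    (h1 : 0 < 1 - θ) (hδ : 0 < δ) (hm : θ * m + (1 - θ) * w = 0) (hmw : |w - m| ≤ A + B)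
    (hA : A ^ 2 = k * X) (hB : B ^ 2 = q * EV) (hk : 0 ≤ k) (hEV : 0 ≤ EV) (hEW : 0 ≤ EW)
    (hE : θ * EV + (1 - θ) * δ * EW = 1)
    (hX : X ≤ a₁ * EV + s₁ * (2 * S) ^ 2) (hY : Y ≤ a₂ * EW + s₂ * (2 * S) ^ 2)
    (hs : θ * (1 + k) * s₁ + (1 - θ) * s₂ ≤ r / 4) :
    θ * (X + m ^ 2) + (1 - θ) * (Y + w ^ 2) - r * S ^ 2 ≤
      max ((1 + k) * a₁ + (1 - θ) / θ * q) (1 / δ * a₂) := by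
  -- the variance of the two means, as the total mean `θ m + (1 - θ) w` vanishes
  have e1 : θ * m ^ 2 + (1 - θ) * w ^ 2 = θ * (1 - θ) * (w - m) ^ 2 := by
    have : θ * m ^ 2 + (1 - θ) * w ^ 2 - θ * (1 - θ) * (w - m) ^ 2 =
        (θ * m + (1 - θ) * w) ^ 2 := by ring
    rw [hm] at this
    linarith
  have e2 : (w - m) ^ 2 ≤ (A + B) ^ 2 := by
    rw [← sq_abs]
    exact pow_le_pow_left₀ (abs_nonneg _) hmw 2
  have e3 := mul_le_mul_of_nonneg_left e2 (mul_nonneg h0.le h1.le)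
  have e4 := mul_add_sq_le θ A B
  rw [hA, hB] at e4
  have e5 := mul_le_mul_of_nonneg_left hX (mul_nonneg h0.le (by linarith : (0 : ℝ) ≤ 1 + k))
  have e6 := mul_le_mul_of_nonneg_left hY h1.le
  have e7 := mul_le_mul_of_nonneg_right hs (sq_nonneg (2 * S))
  set P := (1 + k) * a₁ + (1 - θ) / θ * q with hP
  set Q := 1 / δ * a₂ with hQ
  have e8 : θ * EV * P ≤ θ * EV * max P Q :=
    mul_le_mul_of_nonneg_left (le_max_left _ _) (mul_nonneg h0.le hEV)
  have e9 : (1 - θ) * δ * EW * Q ≤ (1 - θ) * δ * EW * max P Q :=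
    mul_le_mul_of_nonneg_left (le_max_right _ _) (mul_nonneg (mul_nonneg h1.le hδ.le) hEW)
  have e10 : θ * EV * P = θ * (1 + k) * (a₁ * EV) + (1 - θ) * (q * EV) := by
    rw [hP]; field_simp
  have e11 : (1 - θ) * δ * EW * Q = (1 - θ) * (a₂ * EW) := by
    rw [hQ]; field_simp
  have e12 : θ * EV * max P Q + (1 - θ) * δ * EW * max P Q = max P Q := by
    rw [← add_mul, hE, one_mul]
  linarith

end RealInequalities

lemma abs_le_supNormOn {X : Type*} {S : Set X} {f : X → ℝ} {C : ℝ} (hC : ∀ x ∈ S, |f x| ≤ C)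
    {x : X} (hx : x ∈ S) : |f x| ≤ supNormOn S f :=
  le_csSup ⟨C, by rintro _ ⟨y, hy, rfl⟩; exact hC y hy⟩ (mem_image_of_mem _ hx)

lemma supNormOn_nonneg {X : Type*} (S : Set X) (f : X → ℝ) : 0 ≤ supNormOn S f :=
  Real.sSup_nonneg (by rintro _ ⟨y, -, rfl⟩; exact abs_nonneg _)

lemma supNormOn_le {X : Type*} {S : Set X} {f : X → ℝ} {C : ℝ} (hC : ∀ x ∈ S, |f x| ≤ C)
    (h0 : 0 ≤ C) : supNormOn S f ≤ C :=
  Real.sSup_le (by rintro _ ⟨y, hy, rfl⟩; exact hC y hy) h0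

/-- The variance identity for a bounded function. -/
lemma integral_sub_integral_sq {X : Type*} [MeasurableSpace X] {ν : Measure X}
    [IsProbabilityMeasure ν] {f : X → ℝ} {C : ℝ} (hf : AEStronglyMeasurable f ν)
    (hC : ∀ x, |f x| ≤ C) :
    ∫ x, f x ^ 2 ∂ν = ∫ x, (f x - ∫ y, f y ∂ν) ^ 2 ∂ν + (∫ x, f x ∂ν) ^ 2 := by
  have hm : MemLp f 2 ν := MemLp.of_bound hf C (ae_of_all _ hC)
  have h := ProbabilityTheory.variance_eq_sub hm
  rw [ProbabilityTheory.variance_eq_integral hf.aemeasurable] at h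
  simp only [Pi.pow_apply] at h
  linarith

namespace Data

variable {n : ℕ} {M : Type*} [TopologicalSpace M]
  [MeasurableSpace M] [BorelSpace M] [ChartedSpace (EuclideanHalfSpace (n + 1)) M]
  [IsManifold (𝓡∂ (n + 1)) ∞ M] [RiemannianBundle (fun x : M => TangentSpace (𝓡∂ (n + 1)) x)]
  [IsContMDiffRiemannianBundle (𝓡∂ (n + 1)) ∞ (EuclideanSpace ℝ (Fin (n + 1)))
    (fun x : M => TangentSpace (𝓡∂ (n + 1)) x)] (D : Data n M)

omit [BorelSpace M] [IsManifold (𝓡∂ (n + 1)) ∞ M] [IsContMDiffRiemannianBundle (𝓡∂ (n + 1)) ∞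
  (EuclideanSpace ℝ (Fin (n + 1))) (fun x : M => TangentSpace (𝓡∂ (n + 1)) x)] in
lemma energyV_sub_const {f : M → ℝ} (hf : f ∈ Cb1 n M) (c : ℝ) :
    D.energyV (fun p => f p - c) = D.energyV f := by
  unfold energyV
  simp only [grad_sub_const (hf.1.mdifferentiable one_ne_zero)]

omit [IsContMDiffRiemannianBundle (𝓡∂ (n + 1)) ∞ (EuclideanSpace ℝ (Fin (n + 1)))
    (fun x : M => TangentSpace (𝓡∂ (n + 1)) x)] in
lemma energyW_sub_const {f : M → ℝ} (hf : f ∈ Cb1 n M) (c : ℝ) :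
    D.energyW (fun p => f p - c) = D.energyW f := by
  refine integral_congr_ae ?_
  filter_upwards [D.ae_μW_mem_boundary] with p hp
  rw [boundaryGrad_sub_const hp (hf.1.mdifferentiable one_ne_zero)]

/-- The super Poincaré inequality for `μ`. Where `β_V` or `β_W^∂` is infinite, so is the bound. -/
theorem β_le {βV βW : ℝ → ℝ≥0∞} (hV : D.IsSuperRateV βV) (hW : D.IsSuperRateW βW) {r : ℝ}
    (hδ : 0 < D.δ) (hr : 0 < r) :
    D.β r ≤ max (βV r / ENNReal.ofReal D.θ) (βW (D.δ * r) / ENNReal.ofReal (1 - D.θ)) := by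
  have hθ := D.θ_pos
  have hθ' := D.one_sub_θ_pos
  by_cases h1 : βV r = ⊤
  · rw [h1, ENNReal.top_div_of_ne_top ENNReal.ofReal_ne_top]
    simp
  by_cases h2 : βW (D.δ * r) = ⊤
  · rw [h2, ENNReal.top_div_of_ne_top ENNReal.ofReal_ne_top]
    simp
  refine iSup_le fun f => iSup_le fun hf => iSup_le fun hf1 => ?_
  obtain ⟨C, hC⟩ := hf.2
  have hb : ∀ ν : Measure M, [IsFiniteMeasure ν] → Integrable (fun p => |f p|) ν ∧
      Integrable (fun p => f p ^ 2) ν := fun ν _ =>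
    ⟨Integrable.of_bound hf.1.continuous.abs.aestronglyMeasurable C (ae_of_all _ fun p => by
      rw [norm_abs_eq_norm]; exact (hC p).1),
    Integrable.of_bound (hf.1.continuous.pow 2).aestronglyMeasurable (C ^ 2)
      (ae_of_all _ fun p => by
        rw [norm_pow]; exact pow_le_pow_left₀ (norm_nonneg _) (hC p).1 2)⟩
  rw [D.integral_μ (hb _).1 (hb _).1] at hf1
  rw [D.integral_μ (hb _).2 (hb _).2, energy]
  have key := weighted_super_le hθ hθ' (integral_nonneg fun p => abs_nonneg (f p))
    (integral_nonneg fun p => abs_nonneg (f p)) hf1 ENNReal.toReal_nonneg (hV r hr h1 f hf)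
    (hW _ (mul_pos hδ hr) h2 f (Cb1_subset_boundaryCb1 hf))
  refine (ENNReal.ofReal_le_ofReal key).trans ?_
  rcases le_total ((βV r).toReal / D.θ) ((βW (D.δ * r)).toReal / (1 - D.θ)) with h | h
  · rw [max_eq_right h, ENNReal.ofReal_div_of_pos hθ', ENNReal.ofReal_toReal h2]
    exact le_max_right _ _
  · rw [max_eq_left h, ENNReal.ofReal_div_of_pos hθ, ENNReal.ofReal_toReal h1]
    exact le_max_left _ _

variable [T2Space M] [SecondCountableTopology M]

/-- The weak Poincaré inequality for `μ`. The inequalities for the components are applied to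
`f - μ_V(f)` and `f - μ_W^∂(f)`, whose supremum norms are at most twice that of `f`; this is where
`r / 4` comes from. -/
theorem α_le_weakBound {h : M → ℝ} {αV αW : ℝ → ℝ≥0∞} (hδ : 0 < D.δ) (hD : D.Conservative)
    (hA : D.AssumptionA h) (hV : D.IsWeakRateV αV) (hW : D.IsWeakRateW αW) {r s₁ s₂ : ℝ}
    (hs₁ : 0 < s₁) (hs₂ : 0 < s₂)
    (hs : D.θ * (1 + D.C₀ ^ 2 * D.C₁ h ^ 2) * s₁ + (1 - D.θ) * s₂ ≤ r / 4) :
    D.α r ≤ D.weakBound h αV αW s₁ s₂ := by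
  have hθ := D.θ_pos
  have hθ' := D.one_sub_θ_pos
  have hk : 0 ≤ D.C₀ ^ 2 * D.C₁ h ^ 2 := by positivity
  unfold weakBound
  by_cases h1 : αV s₁ = ⊤
  · rw [h1, ENNReal.mul_top (ENNReal.ofReal_pos.2 (by linarith)).ne']
    simp
  by_cases h2 : αW s₂ = ⊤
  · rw [h2, ENNReal.mul_top (ENNReal.ofReal_pos.2 (by positivity)).ne']
    simp
  refine iSup_le fun f => iSup_le fun hf => iSup_le fun hf0 => iSup_le fun hfE => ?_
  obtain ⟨C, hC⟩ := hf.2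
  have hfc := hf.1.continuous
  have hb : ∀ ν : Measure M, [IsFiniteMeasure ν] → Integrable f ν ∧
      Integrable (fun p => f p ^ 2) ν := fun ν _ =>
    ⟨Integrable.of_bound hfc.aestronglyMeasurable C (ae_of_all _ fun p => (hC p).1),
    Integrable.of_bound (hfc.pow 2).aestronglyMeasurable (C ^ 2)
      (ae_of_all _ fun p => by
        rw [norm_pow]; exact pow_le_pow_left₀ (norm_nonneg _) (hC p).1 2)⟩
  rw [D.integral_μ (hb _).1 (hb _).1] at hf0
  rw [D.integral_μ (hb _).2 (hb _).2,
    integral_sub_integral_sq hfc.aestronglyMeasurable fun p => (hC p).1,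
    integral_sub_integral_sq (ν := D.μW) hfc.aestronglyMeasurable fun p => (hC p).1]
  set m := ∫ p, f p ∂D.μV with hm
  set w := ∫ p, f p ∂D.μW with hw
  set S := supNormOn univ f with hS
  have hfS : ∀ p, |f p| ≤ S := fun p =>
    abs_le_supNormOn (fun q _ => (hC q).1) (mem_univ p)
  have hS0 : 0 ≤ S := supNormOn_nonneg _ _
  have hmean : ∀ ν : Measure M, [IsProbabilityMeasure ν] → ∀ p, |f p - ∫ q, f q ∂ν| ≤ 2 * S := by
    intro ν _ p
    have h3 := norm_integral_le_of_norm_le_const (μ := ν) (f := f) (ae_of_all _ hfS)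
    rw [probReal_univ, mul_one, Real.norm_eq_abs] at h3
    exact (abs_sub _ _).trans (by linarith [hfS p])
  have hX : ∫ p, (f p - m) ^ 2 ∂D.μV ≤ (αV s₁).toReal * D.energyV f + s₁ * (2 * S) ^ 2 := by
    have h3 := hV s₁ hs₁ h1 _ (sub_const_mem_Cb1 hf m) (by
      rw [integral_sub (hb _).1 (integrable_const _)]
      simp [hm])
    rw [D.energyV_sub_const hf] at h3
    refine h3.trans ?_
    gcongr
    · exact supNormOn_nonneg _ _
    · exact supNormOn_le (fun p _ => hmean D.μV p) (by positivity)
  have hY : ∫ p, (f p - w) ^ 2 ∂D.μW ≤ (αW s₂).toReal * D.energyW f + s₂ * (2 * S) ^ 2 := by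
    have h3 := hW s₂ hs₂ h2 _ (Cb1_subset_boundaryCb1 (sub_const_mem_Cb1 hf w)) (by
      rw [integral_sub (hb _).1 (integrable_const _)]
      simp [hw])
    rw [D.energyW_sub_const hf] at h3
    refine h3.trans ?_
    gcongr
    · exact supNormOn_nonneg _ _
    · exact supNormOn_le (fun p _ => hmean D.μW p) (by positivity)
  have hmw : |w - m| ≤ D.C₀ * D.C₁ h * Real.sqrt (∫ p, (f p - m) ^ 2 ∂D.μV) +
      D.C₀ * D.C₂ h * Real.sqrt (D.energyV f) := by
    have h3 := D.integral_abs_μW_le hA hD (sub_const_mem_Cb1 hf m)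
    rw [D.energyV_sub_const hf] at h3
    have h4 : w - m = ∫ p, (f p - m) ∂D.μW := by
      rw [integral_sub (hb _).1 (integrable_const _)]
      simp [hw]
    rw [h4]
    exact (abs_integral_le_integral_abs).trans (h3.trans (le_of_eq (by ring)))
  have key := weighted_weak_le (q := D.C₀ ^ 2 * D.C₂ h ^ 2) hθ hθ' hδ hf0 hmw
    (by rw [mul_pow, mul_pow, Real.sq_sqrt (integral_nonneg fun p => sq_nonneg _)])
    (by rw [mul_pow, mul_pow, Real.sq_sqrt (D.energyV_nonneg f)])
    hk (D.energyV_nonneg f) (D.energyW_nonneg f) hfE hX hY hs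
  rw [← mul_assoc] at key
  refine (ENNReal.ofReal_le_ofReal key).trans ?_
  rcases le_total ((1 + D.C₀ ^ 2 * D.C₁ h ^ 2) * (αV s₁).toReal +
      (1 - D.θ) / D.θ * D.C₀ ^ 2 * D.C₂ h ^ 2) (1 / D.δ * (αW s₂).toReal) with h3 | h3
  · rw [max_eq_right h3, ENNReal.ofReal_mul (by positivity), ENNReal.ofReal_toReal h2]
    exact le_max_right _ _
  · rw [max_eq_left h3, ENNReal.ofReal_add (by positivity) (by positivity),
      ENNReal.ofReal_mul (by positivity), ENNReal.ofReal_toReal h1]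
    exact le_max_left _ _

omit [BorelSpace M] [IsManifold (𝓡∂ (n + 1)) ∞ M]
  [IsContMDiffRiemannianBundle (𝓡∂ (n + 1)) ∞ (EuclideanSpace ℝ (Fin (n + 1)))
    (fun x : M => TangentSpace (𝓡∂ (n + 1)) x)] [T2Space M] [SecondCountableTopology M] in
/-- A constant that exceeds all coefficients of the bound may replace them. -/
lemma weakBound_le {h : M → ℝ} {αV αW : ℝ → ℝ≥0∞} {s₁ s₂ c : ℝ} {a b : ℝ≥0∞}
    (h1 : 1 + D.C₀ ^ 2 * D.C₁ h ^ 2 ≤ c) (h2 : (1 - D.θ) / D.θ * D.C₀ ^ 2 * D.C₂ h ^ 2 ≤ c)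
    (h3 : 1 / D.δ ≤ c) (ha : αV s₁ ≤ a) (hb : αW s₂ ≤ b) :
    D.weakBound h αV αW s₁ s₂ ≤
      ENNReal.ofReal c + ENNReal.ofReal c * a + ENNReal.ofReal c * b := by
  refine max_le ?_ ?_
  · refine le_add_right ?_
    rw [add_comm]
    exact add_le_add (ENNReal.ofReal_le_ofReal h2) (mul_le_mul' (ENNReal.ofReal_le_ofReal h1) ha)
  · exact le_add_left (mul_le_mul' (ENNReal.ofReal_le_ofReal h3) hb)

end Data

end StickyReflected

end

theorem mainTheorem1 {n : ℕ} {M : Type*} [TopologicalSpace M] [T2Space M]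
    [SecondCountableTopology M] [MeasurableSpace M] [BorelSpace M]
    [ChartedSpace (EuclideanHalfSpace (n + 1)) M] [IsManifold (𝓡∂ (n + 1)) ∞ M]
    [RiemannianBundle (fun x : M => TangentSpace (𝓡∂ (n + 1)) x)]
    [IsContMDiffRiemannianBundle (𝓡∂ (n + 1)) ∞ (EuclideanSpace ℝ (Fin (n + 1)))
      (fun x : M => TangentSpace (𝓡∂ (n + 1)) x)]
    (D : StickyReflected.Data n M) (hδ : 0 < D.δ) :
    -- part (1)
    (∀ βV βW : ℝ → ℝ≥0∞, D.IsSuperRateV βV → D.IsSuperRateW βW → ∀ r : ℝ, 0 < r →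
      D.β r ≤ max (βV r / ENNReal.ofReal D.θ) (βW (D.δ * r) / ENNReal.ofReal (1 - D.θ))) ∧
    -- part (2)
    (D.Conservative → ∀ h : M → ℝ, D.AssumptionA h →
      (∀ αV αW : ℝ → ℝ≥0∞, D.IsWeakRateV αV → D.IsWeakRateW αW → ∀ r : ℝ, 0 < r →
        D.α r ≤ ⨅ (s₁ : ℝ) (s₂ : ℝ) (_ : 0 < s₁) (_ : 0 < s₂)
          (_ : D.θ * (1 + D.C₀ ^ 2 * D.C₁ h ^ 2) * s₁ + (1 - D.θ) * s₂ ≤ r / 4),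
          D.weakBound h αV αW s₁ s₂) ∧
      (∀ αV αW : ℝ → ℝ≥0∞, D.IsWeakRateV αV → D.IsWeakRateW αW → ∀ r : ℝ, 0 < r →
        D.α r ≤ D.weakBound h αV αW (r / (4 + 4 * D.θ * D.C₀ ^ 2 * D.C₁ h ^ 2))
          (r / (4 + 4 * D.θ * D.C₀ ^ 2 * D.C₁ h ^ 2))) ∧
      (∃ c : ℝ, 1 < c ∧
        ∀ αV αW : ℝ → ℝ≥0∞, D.IsWeakRateV αV → D.IsWeakRateW αW → ∀ r : ℝ, 0 < r →
          D.α r ≤ ENNReal.ofReal c + ENNReal.ofReal c * αV (r / c)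
            + ENNReal.ofReal c * αW (r / c) ∧
          (AntitoneOn αV (Ioi 0) → AntitoneOn αW (Ioi 0) →
            D.weakBound h αV αW (r / (4 + 4 * D.θ * D.C₀ ^ 2 * D.C₁ h ^ 2))
                (r / (4 + 4 * D.θ * D.C₀ ^ 2 * D.C₁ h ^ 2)) ≤
              ENNReal.ofReal c + ENNReal.ofReal c * αV (r / c)
                + ENNReal.ofReal c * αW (r / c)))) := by
  have hθ := D.θ_pos
  have hθ' := D.one_sub_θ_pos
  refine ⟨fun βV βW hV hW r hr => D.β_le hV hW hδ hr, fun hD h hA => ?_⟩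
  set k := D.C₀ ^ 2 * D.C₁ h ^ 2 with hk
  have hk0 : 0 ≤ k := by positivity
  have hk' : 4 + 4 * D.θ * D.C₀ ^ 2 * D.C₁ h ^ 2 = 4 * (1 + D.θ * k) := by rw [hk]; ring
  have hpos : 0 < 1 + D.θ * k := by positivity
  rw [hk']
  refine ⟨fun αV αW hV hW r hr => ?_, fun αV αW hV hW r hr => ?_, ?_⟩
  · exact le_iInf fun s₁ => le_iInf fun s₂ => le_iInf fun h1 => le_iInf fun h2 => le_iInf fun h3 =>
      D.α_le_weakBound hδ hD hA hV hW h1 h2 h3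
  · refine D.α_le_weakBound hδ hD hA hV hW (by positivity) (by positivity) (le_of_eq ?_)
    field_simp
    ring
  · set q := (1 - D.θ) / D.θ * D.C₀ ^ 2 * D.C₂ h ^ 2 with hq
    have hq0 : 0 ≤ q := by positivity
    have hδ' : 0 < 1 / D.δ := by positivity
    have hθk : 0 ≤ D.θ * k := by positivity
    -- `c` exceeds each coefficient of the bound, and `r / c` is at most the admissible `s(r)`.
    set c := 4 * (1 + D.θ * k) + (1 + k) + q + 1 / D.δ with hc
    have hc4 : 4 * (1 + D.θ * k) ≤ c := by linarith
    have hc0 : 0 < c := by linarith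
    refine ⟨c, by linarith, fun αV αW hV hW r hr => ⟨?_, fun hmV hmW => ?_⟩⟩
    · refine (D.α_le_weakBound hδ hD hA hV hW (s₁ := r / c) (s₂ := r / c) (by positivity)
        (by positivity) ?_).trans
        (D.weakBound_le (by linarith) (by linarith) (by linarith) le_rfl le_rfl)
      have : D.θ * (1 + k) * (r / c) + (1 - D.θ) * (r / c) = (1 + D.θ * k) * r / c := by ring
      rw [← hk, this, div_le_div_iff₀ hc0 four_pos]
      nlinarith
    · have h1 : r / c ≤ r / (4 * (1 + D.θ * k)) :=
        div_le_div_of_nonneg_left hr.le (by positivity) hc4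
      have h2 : 0 < r / c := by positivity
      exact D.weakBound_le (by linarith) (by linarith) (by linarith)
        (hmV h2 (h2.trans_le h1) h1) (hmW h2 (h2.trans_le h1) h1)
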